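/- **The walk.** For $q=1,2$ let $a_q=|a_q|e^{i\alpha_q}$, $b_q=|b_q|e^{i\beta_q}\in\mathbb C$ with $|a_q|^2+|b_q|^2=1$ and $\alpha_q,\beta_q,\delta_q\in[-\pi,\pi)$, and put $$C_{0,q}=e^{i\delta_q/2}\begin{pmatrix}a_q&b_q\\-\overline{b_q}&\overline{a_q}\end{pmatrix}.$$ On $\mathcal H=\ell^2(\mathbb Z^2;\mathbb C^2)$ let $C_q$ act by $C_{0,q}$ at every site, let $S_q=L_q\oplus L_q^*$ with $(L_q\psi)(x)=\psi(x+e_q)$, and let $U=S_2C_2S_1C_1$. For $\Psi_0\in\mathcal H$ with $\|\Psi_0\|=1$ let $\Psi_t=U^t\Psi_0$, and let $X_t$ be a random variable in $\mathbb Z^2$ with $P(X_t=x)=\|\Psi_t(x)\|^2$. Put $a=|a_1||a_2|$, $b=|b_1||b_2|$. **Fourier side.** Let $\hat\Psi_0(k)=\sum_x e^{-ik\cdot x}\Psi_0(x)$ (convergence in $L^2$) for $k\in\mathbb R^2$, and let $$\hat U(k)=\begin{pmatrix}e^{ik_2}&0\\0&e^{-ik_2}\end{pmatrix}C_{0,2}\begin{pmatrix}e^{ik_1}&0\\0&e^{-ik_1}\end{pmatrix}C_{0,1}$$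 be the Fourier transformed evolution operator. With $l_1=k_2+k_1+\alpha_2+\alpha_1$, $l_2=k_2-k_1+\beta_2-\beta_1$ and $\tau=a\cos l_1-b\cos l_2$, its eigenvalues are $\lambda_p(k)=\big(\tau+(-1)^{p-1}i\sqrt{1-\tau^2}\big)e^{i(\delta_1+\delta_2)/2}$, $p=1,2$. Let $|\lambda_1(k)\rangle,|\lambda_2(k)\rangle$ be any choice of orthonormal eigenvectors of $\hat U(k)$ for $\lambda_1(k),\lambda_2(k)$, and put $P_p(k)=|\langle\hat\Psi_0(k)|\lambda_p(k)\rangle|^2$ and $v_{p,q}(k)=\frac{i}{\lambda_p(k)}\frac{\partial\lambda_p}{\partial k_q}(k)$, which is defined and real whenever $\tau^2<1$, that is, for almost every $k$ in the case below (set $v_{p,q}(k)=0$ elsewhere). The asymptotic velocity operators $\hat v_1,\hat v_2$ on $\mathcal H$ act in Fourier space as multiplication by $\hat v_q(k)=\sum_p v_{p,q}(k)\,|\lambda_p(k)\rangle\langle\lambda_p(k)|$. **Theorem.** Assume $a>0$, $b>0$ and $a+b=1$. Let $$\sigma=\Big\{v\in\mathbb R^2:\ \frac{(v_1+v_2)^2}{4a}+\frac{(v_1-v_2)^2}{4b}\le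 1\Big\},\qquad f(v)=\frac{w(v)}{(1-v_1^2)(1-v_2^2)},\qquad w(v)=\sum_{p=1,2}\ \sum_{\substack{k\in[-\pi,\pi)^2\\(v_{p,1}(k),v_{p,2}(k))=v}}P_p(k),$$ where a sum with infinitely many non-zero terms is read as $0$ (this concerns only a null set of $v\in\sigma$). Then: 1. $f$ is integrable on $\sigma$ and, for every $\xi\in\mathbb R^2$, $$\lim_{t\to\infty}\mathbb E\big(e^{i\xi\cdot X_t/t}\big)=\int_{\sigma}\frac{dv}{(2\pi)^2}\,e^{i\xi\cdot v}f(v).$$ 2. For every $v$ in the interior of $\sigma$ with $v_1\ne\pm v_2$, $$w(v)=\sum_{p=1,2}\ \sum_{j=0,1}\ \sum_{\varepsilon=\pm1}P_p\big(k_{p,\varepsilon,j}(v)\big),$$ where $k=k_{p,\varepsilon,j}(v)$ is the solution of $$k_2+k_1+\alpha_2+\alpha_1=l_1+2\pi j,\qquad k_2-k_1+\beta_2-\beta_1=l_2,$$ $$l_1=-\operatorname{sgn}\big((-1)^{p-1}(v_1+v_2)\big)\arccos c_1,\qquad l_2=-\operatorname{sgn}\big((-1)^{p-1}(v_1-v_2)\big)\arccos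 c_2,$$ $$c_1=\varepsilon\,\frac{1-\frac{(1+b)(v_1+v_2)^2}{4a}-\frac{(v_1-v_2)^2}{4}}{\sqrt{(1-v_1^2)(1-v_2^2)}},\qquad c_2=\varepsilon\,\frac{1-\frac{(v_1+v_2)^2}{4}-\frac{(1+a)(v_1-v_2)^2}{4b}}{\sqrt{(1-v_1^2)(1-v_2^2)}}.$$ 3. $\sigma$ is the support of the joint spectral measure of $(\hat v_1,\hat v_2)$. -/

import Mathlib

open MeasureTheory Filter Topology

noncomputable section

namespace QuantumWalk

/-! ### The walk on the square lattice -/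

/-- The coin space `ℂ²`. -/
abbrev Coin := EuclideanSpace ℂ (Fin 2)

/-- Positions `x = (x₁, x₂) ∈ ℤ²`; the index `0 : Fin 2` is the first coordinate. -/
abbrev Site := Fin 2 → ℤ

/-- The state space `ℓ²(ℤ²; ℂ²)`. -/
abbrev StateSpace := lp (fun _ : Site => Coin) 2

/-- The parameters of the two coins.  The coin with index `q` is
`exp(i δ_q / 2) * [[a_q, b_q], [-conj b_q, conj a_q]]`, with `a_q = |a_q| exp(i α_q)` and
`b_q = |b_q| exp(i β_q)`. -/
structure Params where
  coinA : Fin 2 → ℂ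
  coinB : Fin 2 → ℂ
  α : Fin 2 → ℝ
  β : Fin 2 → ℝ
  δ : Fin 2 → ℝ
  polarA : ∀ q, coinA q = (‖coinA q‖ : ℂ) * Complex.exp (Complex.I * (α q : ℂ))
  polarB : ∀ q, coinB q = (‖coinB q‖ : ℂ) * Complex.exp (Complex.I * (β q : ℂ))
  unit : ∀ q, ‖coinA q‖ ^ 2 + ‖coinB q‖ ^ 2 = 1
  α_mem : ∀ q, α q ∈ Set.Ico (-Real.pi) Real.pi
  β_mem : ∀ q, β q ∈ Set.Ico (-Real.pi) Real.pi
  δ_mem : ∀ q, δ q ∈ Set.Ico (-Real.pi) Real.pi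

namespace Params

variable (W : Params)

/-- `a = |a₂| |a₁|`. -/
def a : ℝ := ‖W.coinA 1‖ * ‖W.coinA 0‖

/-- `b = |b₂| |b₁|`. -/
def b : ℝ := ‖W.coinB 1‖ * ‖W.coinB 0‖

/-- The coin matrix `C_{0,q}`. -/
def coinMatrix (q : Fin 2) : Matrix (Fin 2) (Fin 2) ℂ :=
  Complex.exp (Complex.I * (W.δ q : ℂ) / 2) •
    !![W.coinA q, W.coinB q; -(starRingEnd ℂ) (W.coinB q), (starRingEnd ℂ) (W.coinA q)]

end Params

/-- The homogeneous coin operator `C_q = ⨁_x C_{0,q}`. -/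
def coinOp (W : Params) (q : Fin 2) (Ψ : Site → Coin) : Site → Coin :=
  fun x => Matrix.toEuclideanLin (W.coinMatrix q) (Ψ x)

/-- The shift `S_q = L_q ⊕ L_q^*`, where `(L_q ψ)(x) = ψ(x + e_q)`. -/
def shiftOp (q : Fin 2) (Ψ : Site → Coin) : Site → Coin :=
  fun x => !₂[Ψ (x + Pi.single q 1) 0, Ψ (x - Pi.single q 1) 1]

/-- One step `U = S₂ C₂ S₁ C₁` of the walk. -/
def stepOp (W : Params) (Ψ : Site → Coin) : Site → Coin :=
  shiftOp 1 (coinOp W 1 (shiftOp 0 (coinOp W 0 Ψ)))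

/-- The state `Ψ_t = U^t Ψ₀`. -/
def evolved (W : Params) (Ψ₀ : StateSpace) (t : ℕ) : Site → Coin :=
  (stepOp W)^[t] (fun x => Ψ₀ x)

/-- The law of the position `X_t`: `P(X_t = x) = ‖Ψ_t(x)‖²`. -/
def positionLaw (W : Params) (Ψ₀ : StateSpace) (t : ℕ) : Measure Site :=
  Measure.sum fun x => ENNReal.ofReal (‖evolved W Ψ₀ t x‖ ^ 2) • Measure.dirac x

/-- The characteristic function `E(exp(i ξ · X_t / t))` of `X_t / t`. -/
def positionCharFun (W : Params) (Ψ₀ : StateSpace) (t : ℕ) (ξ : Fin 2 → ℝ) : ℂ :=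
  ∫ x, Complex.exp (Complex.I * ((∑ q, ξ q * ((x q : ℝ) / (t : ℝ)) : ℝ) : ℂ))
    ∂(positionLaw W Ψ₀ t)

/-! ### Fourier side -/

/-- The coordinate sequences of a state are square summable. -/
theorem memℓp_coord (Ψ : StateSpace) (i : Fin 2) :
    Memℓp (fun x : Site => (Ψ x) i) 2 :=
  (lp.memℓp Ψ).mono' fun x => PiLp.norm_apply_le (Ψ x) i

/-- The `i`-th coordinate of a state, an element of `ℓ²(ℤ²; ℂ)`. -/
def coord (Ψ : StateSpace) (i : Fin 2) : lp (fun _ : Site => ℂ) 2 :=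
  ⟨fun x => (Ψ x) i, memℓp_coord Ψ i⟩

/-- The Fourier transform `Ψ̂(k) = ∑ₓ Ψ(x) exp(-i k · x)` (convergence in `L²`), a `2π`-periodic
function of `k ∈ ℝ²`.  On the torus `(ℝ/ℤ)²` the function `mFourierBasis.repr.symm ψ` is
`θ ↦ ∑ₓ ψ(x) exp(2π i x · θ)`; it is evaluated at `θ = -k / (2π)`. -/
def fourier (Ψ : StateSpace) (k : Fin 2 → ℝ) : Coin :=
  WithLp.toLp 2 fun i =>
    (UnitAddTorus.mFourierBasis.repr.symm (coord Ψ i))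
      (fun j => ((-(k j) / (2 * Real.pi) : ℝ) : UnitAddCircle))

/-- The fundamental domain `[-π, π)²` of the wave numbers. -/
def torus : Set (Fin 2 → ℝ) := Set.univ.pi fun _ => Set.Ico (-Real.pi) Real.pi

/-- The Fourier transform of the shift `S_q`, namely `diag(exp(i k_q), exp(-i k_q))`. -/
def shiftHat (q : Fin 2) (k : Fin 2 → ℝ) : Matrix (Fin 2) (Fin 2) ℂ :=
  !![Complex.exp (Complex.I * (k q : ℂ)), 0; 0, Complex.exp (-(Complex.I * (k q : ℂ)))]

/-- The Fourier transformed evolution operator, a matrix for every wave number. -/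
def stepHat (W : Params) (k : Fin 2 → ℝ) : Matrix (Fin 2) (Fin 2) ℂ :=
  shiftHat 1 k * W.coinMatrix 1 * shiftHat 0 k * W.coinMatrix 0

/-- `l₁ = k₂ + k₁ + α₂ + α₁`. -/
def ell₁ (W : Params) (k : Fin 2 → ℝ) : ℝ := k 1 + k 0 + W.α 1 + W.α 0

/-- `l₂ = k₂ - k₁ + β₂ - β₁`. -/
def ell₂ (W : Params) (k : Fin 2 → ℝ) : ℝ := k 1 - k 0 + W.β 1 - W.β 0

/-- `τ = a cos l₁ - b cos l₂`. -/
def tau (W : Params) (k : Fin 2 → ℝ) : ℝ :=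
  W.a * Real.cos (ell₁ W k) - W.b * Real.cos (ell₂ W k)

/-- The eigenvalues `λ_p(k) = (τ + (-1)^{p-1} i √(1 - τ²)) exp(i (δ₂ + δ₁) / 2)`, `p = 1, 2`;
the index `p : Fin 2` is shifted by one. -/
def eigval (W : Params) (p : Fin 2) (k : Fin 2 → ℝ) : ℂ :=
  ((tau W k : ℂ) + (-1) ^ (p : ℕ) * Complex.I * (Real.sqrt (1 - tau W k ^ 2) : ℂ)) *
    Complex.exp (Complex.I * ((W.δ 1 + W.δ 0 : ℝ) : ℂ) / 2)

/-- A choice, for every wave number `k`, of an orthonormal basis of `ℂ²` of eigenvectors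
`|λ_p(k)⟩` of the Fourier transformed evolution operator. -/
def IsEigenframe (W : Params) (e : (Fin 2 → ℝ) → OrthonormalBasis (Fin 2) ℂ Coin) : Prop :=
  ∀ k p, Matrix.toEuclideanLin (stepHat W k) (e k p) = eigval W p k • e k p

/-- The velocities `v_{p,q}(k) = (i / λ_p(k)) ∂λ_p(k)/∂k_q`, which are real. -/
def vel (W : Params) (p : Fin 2) (k : Fin 2 → ℝ) : Fin 2 → ℝ := fun q =>
  (Complex.I / eigval W p k *
    deriv (fun s : ℝ => eigval W p (Function.update k q s)) (k q)).re

/-- The weights `P_p(k) = |⟨Ψ̂₀(k) | λ_p(k)⟩|²`. -/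
def weightP (Ψ₀ : StateSpace) (e : (Fin 2 → ℝ) → OrthonormalBasis (Fin 2) ℂ Coin)
    (p : Fin 2) (k : Fin 2 → ℝ) : ℝ :=
  ‖inner ℂ (fourier Ψ₀ k) (e k p)‖ ^ 2

/-! ### The limit density in the case `a + b = 1` -/

/-- `1 - (v₁ + v₂)² / (4a) - (v₁ - v₂)² / (4b)`. -/
def ellipseForm (W : Params) (v : Fin 2 → ℝ) : ℝ :=
  1 - (v 0 + v 1) ^ 2 / (4 * W.a) - (v 0 - v 1) ^ 2 / (4 * W.b)

/-- The ellipse `(v₁ + v₂)² / (4a) + (v₁ - v₂)² / (4b) ≤ 1`. -/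
def ellipse (W : Params) : Set (Fin 2 → ℝ) :=
  {v | (v 0 + v 1) ^ 2 / (4 * W.a) + (v 0 - v 1) ^ 2 / (4 * W.b) ≤ 1}

/-- The function `w(v)`: the weights `P_p` summed over all the preimages `k(v)` of `v` under the
velocity maps `k ↦ (v_{p,1}(k), v_{p,2}(k))` on the torus, for `p = 1, 2`. -/
def weightW (W : Params) (Ψ₀ : StateSpace)
    (e : (Fin 2 → ℝ) → OrthonormalBasis (Fin 2) ℂ Coin) (v : Fin 2 → ℝ) : ℝ :=
  ∑ p : Fin 2, ∑ᶠ k ∈ {k | k ∈ torus ∧ vel W p k = v}, weightP Ψ₀ e p k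

/-- The density `f(v) = w(v) / ((1 - v₁²)(1 - v₂²))`. -/
def limitDensity (W : Params) (Ψ₀ : StateSpace)
    (e : (Fin 2 → ℝ) → OrthonormalBasis (Fin 2) ℂ Coin) (v : Fin 2 → ℝ) : ℝ :=
  weightW W Ψ₀ e v / ((1 - v 0 ^ 2) * (1 - v 1 ^ 2))

/-- `c₁ = cos l₁` as a function of `v`, on the branch with sign `ε = ±1`. -/
def branchC₁ (W : Params) (ε : ℝ) (v : Fin 2 → ℝ) : ℝ :=
  ε * (1 - (1 + W.b) * (v 0 + v 1) ^ 2 / (4 * W.a) - (v 0 - v 1) ^ 2 / 4) /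
    Real.sqrt ((1 - v 0 ^ 2) * (1 - v 1 ^ 2))

/-- `c₂ = cos l₂` as a function of `v`, on the branch with sign `ε = ±1`. -/
def branchC₂ (W : Params) (ε : ℝ) (v : Fin 2 → ℝ) : ℝ :=
  ε * (1 - (v 0 + v 1) ^ 2 / 4 - (1 + W.a) * (v 0 - v 1) ^ 2 / (4 * W.b)) /
    Real.sqrt ((1 - v 0 ^ 2) * (1 - v 1 ^ 2))

/-- `l₁ = -sgn(± (v₁ + v₂)) arccos c₁`, with the sign `+` for `p = 1` and `-` for `p = 2`. -/
def branchL₁ (W : Params) (p : Fin 2) (ε : ℝ) (v : Fin 2 → ℝ) : ℝ :=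
  -(SignType.sign ((-1) ^ (p : ℕ) * (v 0 + v 1)) : ℝ) * Real.arccos (branchC₁ W ε v)

/-- `l₂ = -sgn(± (v₁ - v₂)) arccos c₂`, with the sign `+` for `p = 1` and `-` for `p = 2`. -/
def branchL₂ (W : Params) (p : Fin 2) (ε : ℝ) (v : Fin 2 → ℝ) : ℝ :=
  -(SignType.sign ((-1) ^ (p : ℕ) * (v 0 - v 1)) : ℝ) * Real.arccos (branchC₂ W ε v)

/-- The explicit inverse branches `k(v)` of the velocity map with index `p`.  There are four of
them (modulo `2π`), indexed by the sign `ε = ±1` of `c₁ + c₂` and by a translation by `j (π, π)`,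
`j = 0, 1`. -/
def branchK (W : Params) (p : Fin 2) (ε : ℝ) (j : Fin 2) (v : Fin 2 → ℝ) : Fin 2 → ℝ :=
  ![((branchL₁ W p ε v - W.α 1 - W.α 0) - (branchL₂ W p ε v - W.β 1 + W.β 0)) / 2
      + (j : ℕ) * Real.pi,
    ((branchL₁ W p ε v - W.α 1 - W.α 0) + (branchL₂ W p ε v - W.β 1 + W.β 0)) / 2
      + (j : ℕ) * Real.pi]

/-! ### Velocity operators and their joint spectral measure -/

/-- `V = (v̂₁, v̂₂)` is the pair of asymptotic velocity operators: in Fourier space, `v̂_q` acts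
as multiplication by the Hermitian matrix `∑_p v_{p,q}(k) |λ_p(k)⟩⟨λ_p(k)|`. -/
def IsVelocityPair (W : Params) (e : (Fin 2 → ℝ) → OrthonormalBasis (Fin 2) ℂ Coin)
    (V : Fin 2 → StateSpace →L[ℂ] StateSpace) : Prop :=
  ∀ q Ψ, ∀ᵐ k ∂(volume.restrict torus),
    fourier (V q Ψ) k =
      ∑ p, ((vel W p k q : ℂ) * inner ℂ (e k p) (fourier Ψ k)) • e k p

/-- `E` is the joint spectral measure of the pair `V` of bounded self-adjoint operators: a
projection-valued measure on the Borel sets of `ℝ²` with `V q = ∫ v_q dE(v)` for `q = 1, 2`. -/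
structure IsJointSpectralMeasure {H : Type*} [NormedAddCommGroup H] [InnerProductSpace ℂ H]
    [CompleteSpace H] (V : Fin 2 → H →L[ℂ] H) (E : Set (Fin 2 → ℝ) → H →L[ℂ] H) : Prop where
  isProj : ∀ s, MeasurableSet s → IsStarProjection (E s)
  univ : E Set.univ = 1
  inter : ∀ s t, MeasurableSet s → MeasurableSet t → E (s ∩ t) = E s * E t
  iUnion : ∀ s : ℕ → Set (Fin 2 → ℝ), (∀ n, MeasurableSet (s n)) →
    (∀ m n, m ≠ n → Disjoint (s m) (s n)) →
    ∀ ψ, HasSum (fun n => E (s n) ψ) (E (⋃ n, s n) ψ)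
  spectral : ∀ ψ, ∃ μ : Measure (Fin 2 → ℝ),
    (∀ s, MeasurableSet s → μ s = ENNReal.ofReal (‖E s ψ‖ ^ 2)) ∧
    ∀ q, Integrable (fun v => v q) μ ∧ inner ℂ ψ (V q ψ) = ((∫ v, v q ∂μ : ℝ) : ℂ)

/-- The support of a projection-valued measure. -/
def spectralSupport {H : Type*} [NormedAddCommGroup H] [InnerProductSpace ℂ H]
    (E : Set (Fin 2 → ℝ) → H →L[ℂ] H) : Set (Fin 2 → ℝ) :=
  {v | ∀ N, IsOpen N → v ∈ N → E N ≠ 0}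

end QuantumWalk

end

noncomputable section

namespace QuantumWalk

/-! ### The dispersion relation -/

section Dispersion

variable (W : Params)

/-! Write D = 1 - τ² and c = cos l₁ + cos l₂ (`csum`).

Weak limit. The characteristic function at time t is ⟨Ψ_t, e^{iξ·x/t} Ψ_t⟩. Conjugating the walk by
a plane wave translates the wave number in its symbol, so in Fourier space this is (2π)⁻² times the
integral of ⟨Û(k)^t Ψ̂₀(k), Û(k - ξ/t)^t Ψ̂₀(k)⟩, up to an error that vanishes because e^{iξ·x/t} Ψ₀
→ Ψ₀ in norm and the evolution is unitary. Expanded in eigenvectors, the cross terms die by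
continuity of the spectral projections, and the diagonal phases converge to e^{iξ·v_p(k)} by the
definition of the derivative (`tendsto_inner_iterate`). Dominated convergence gives the limit (2π)⁻²
∫ Σ_p e^{iξ·v_p(k)} P_p(k) dk (`tendsto_positionCharFun`).

Change of variables k ↦ v_p(k). When a + b = 1, three identities hold where D > 0: the quadratic
form 1 - (v₁+v₂)²/(4a) - (v₁-v₂)²/(4b) equals abc²/D (`ellipseForm_vel`), the product (1 - v₁²)(1 -
v₂²) equals (2abc/D)² (`speed_prod_vel`), and the Jacobian determinant is -(2abc/D)²
(`det_velDeriv`). The first puts the velocities in the ellipse; the other two say that the Jacobian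
cancels exactly the denominator of f.

Fibres. The numerators of c₁ and c₂ equal (2abc/D) cos l₁ and (2abc/D) cos l₂, so v and the sign of
c determine both cosines, hence τ, and then v₁ ± v₂ determine both sines. This fixes k up to the
lattice spanned by (π, π) and (-π, π), which has two classes modulo 2π. Thus the torus, off the null
set c = 0, splits into four pieces on which the velocity map is injective (`injOn_vel_piece`), and a
point inside the ellipse off the axes v₁ = ±v₂ has exactly the four explicit preimages for each p
(`weightW_eq_sum_branchK`).

Spectral measure. The velocity operators are diagonal in the eigenframe, so their joint spectral
projection of a set s is multiplication by the indicator of v_p(k) ∈ s. Its support is the ellipse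
because the velocities stay in the ellipse, reach every interior point, and are continuous at the
preimages found there.

The eigenframe is an arbitrary choice without regularity in k. Every statement about measurability,
continuity or periodicity therefore goes through the spectral projections, which are polynomials in
Û(k) (`eigenProj_eq`). -/

/-- The gradient of `tau`. -/
def dtau (k : Fin 2 → ℝ) : Fin 2 → ℝ :=
  ![-(W.a * Real.sin (ell₁ W k)) - W.b * Real.sin (ell₂ W k),
    -(W.a * Real.sin (ell₁ W k)) + W.b * Real.sin (ell₂ W k)]

/-- The mixed second derivative of `tau`. -/
def tauMixed (k : Fin 2 → ℝ) : ℝ :=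
  -(W.a * Real.cos (ell₁ W k)) - W.b * Real.cos (ell₂ W k)

/-- The Hessian of `tau`. -/
def hessTau (k : Fin 2 → ℝ) (q : Fin 2) : (Fin 2 → ℝ) →L[ℝ] ℝ :=
  ∑ r, (if q = r then -tau W k else tauMixed W k) •
    ContinuousLinearMap.proj (R := ℝ) (φ := fun _ : Fin 2 => ℝ) r

theorem hasFDerivAt_ell₁ (k : Fin 2 → ℝ) :
    HasFDerivAt (ell₁ W) (ContinuousLinearMap.proj (R := ℝ) (φ := fun _ : Fin 2 => ℝ) 1 +
      ContinuousLinearMap.proj (R := ℝ) (φ := fun _ : Fin 2 => ℝ) 0) k := by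
  unfold ell₁
  exact (((hasFDerivAt_apply 1 k).add (hasFDerivAt_apply 0 k)).add_const _).add_const _

theorem hasFDerivAt_ell₂ (k : Fin 2 → ℝ) :
    HasFDerivAt (ell₂ W) (ContinuousLinearMap.proj (R := ℝ) (φ := fun _ : Fin 2 => ℝ) 1 -
      ContinuousLinearMap.proj (R := ℝ) (φ := fun _ : Fin 2 => ℝ) 0) k := by
  unfold ell₂
  exact (((hasFDerivAt_apply 1 k).sub (hasFDerivAt_apply 0 k)).add_const _).sub_const _

theorem hasFDerivAt_tau (k : Fin 2 → ℝ) :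
    HasFDerivAt (tau W) (∑ q, dtau W k q •
      ContinuousLinearMap.proj (R := ℝ) (φ := fun _ : Fin 2 => ℝ) q) k := by
  have := ((hasFDerivAt_ell₁ W k).cos.const_mul W.a).sub ((hasFDerivAt_ell₂ W k).cos.const_mul W.b)
  refine this.congr_fderiv ?_
  ext v
  simp [dtau, Fin.sum_univ_two]
  ring

theorem hasFDerivAt_dtau (k : Fin 2 → ℝ) (q : Fin 2) :
    HasFDerivAt (fun k => dtau W k q) (hessTau W k q) k := by
  have h1 := (hasFDerivAt_ell₁ W k).sin.const_mul W.a
  have h2 := (hasFDerivAt_ell₂ W k).sin.const_mul W.b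
  fin_cases q
  · refine (h1.neg.sub h2).congr_fderiv ?_
    ext v
    simp [hessTau, tauMixed, tau, Fin.sum_univ_two]
    ring
  · refine (h1.neg.add h2).congr_fderiv ?_
    ext v
    simp [hessTau, tauMixed, tau, Fin.sum_univ_two]
    ring

theorem continuous_tau : Continuous (tau W) :=
  continuous_iff_continuousAt.2 fun k => (hasFDerivAt_tau W k).continuousAt

theorem continuous_dtau (q : Fin 2) : Continuous fun k => dtau W k q :=
  continuous_iff_continuousAt.2 fun k => (hasFDerivAt_dtau W k q).continuousAt

theorem hasDerivAt_update (k : Fin 2 → ℝ) (q : Fin 2) (s : ℝ) :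
    HasDerivAt (fun s : ℝ => Function.update k q s) (Pi.single q 1) s := by
  rw [hasDerivAt_pi]
  intro i
  by_cases h : i = q
  · subst h
    simp only [Function.update_self, Pi.single_eq_same]
    exact hasDerivAt_id' s
  · simpa [Function.update_of_ne h, Pi.single_eq_of_ne h] using hasDerivAt_const s (k i)

theorem hasDerivAt_tau_update (k : Fin 2 → ℝ) (q : Fin 2) :
    HasDerivAt (fun s : ℝ => tau W (Function.update k q s)) (dtau W k q) (k q) := by
  have h := hasFDerivAt_tau W k
  rw [← Function.update_eq_self q k] at h
  have := h.comp_hasDerivAt (k q) (hasDerivAt_update k q (k q))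
  refine this.congr_deriv ?_
  rw [Function.update_eq_self]
  fin_cases q <;> simp [Fin.sum_univ_two]

variable {W}

theorem abs_tau_le (ha : 0 < W.a) (hb : 0 < W.b) (hab : W.a + W.b = 1) (k : Fin 2 → ℝ) :
    |tau W k| ≤ 1 := by
  have h1 := Real.neg_one_le_cos (ell₁ W k)
  have h2 := Real.cos_le_one (ell₁ W k)
  have h3 := Real.neg_one_le_cos (ell₂ W k)
  have h4 := Real.cos_le_one (ell₂ W k)
  rw [abs_le, tau]
  constructor <;> nlinarith

theorem tau_sq_le_one (ha : 0 < W.a) (hb : 0 < W.b) (hab : W.a + W.b = 1) (k : Fin 2 → ℝ) :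
    tau W k ^ 2 ≤ 1 := by
  rw [sq_le_one_iff_abs_le_one]
  exact abs_tau_le ha hb hab k

theorem eigval_eq_exp (ha : 0 < W.a) (hb : 0 < W.b) (hab : W.a + W.b = 1) (p : Fin 2)
    (k : Fin 2 → ℝ) :
    eigval W p k = Complex.exp (Complex.I * (((-1) ^ (p : ℕ) * Real.arccos (tau W k) : ℝ) : ℂ)) *
      Complex.exp (Complex.I * ((W.δ 1 + W.δ 0 : ℝ) : ℂ) / 2) := by
  have h := abs_le.1 (abs_tau_le ha hb hab k)
  rw [eigval]
  congr 1
  rw [mul_comm Complex.I, Complex.exp_mul_I, ← Complex.ofReal_cos, ← Complex.ofReal_sin]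
  fin_cases p
  · simp [Real.cos_arccos h.1 h.2, Real.sin_arccos]
    ring
  · simp [Real.cos_arccos h.1 h.2, Real.sin_arccos]
    ring

theorem norm_eigval (ha : 0 < W.a) (hb : 0 < W.b) (hab : W.a + W.b = 1) (p : Fin 2)
    (k : Fin 2 → ℝ) : ‖eigval W p k‖ = 1 := by
  rw [eigval_eq_exp ha hb hab, mul_div_assoc, ← Complex.ofReal_ofNat, ← Complex.ofReal_div,
    norm_mul, mul_comm Complex.I, mul_comm Complex.I, Complex.norm_exp_ofReal_mul_I,
    Complex.norm_exp_ofReal_mul_I, one_mul]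

theorem hasFDerivAt_arccos_tau {k : Fin 2 → ℝ} (hk : tau W k ^ 2 < 1) :
    HasFDerivAt (fun k => Real.arccos (tau W k)) (-(1 / √(1 - tau W k ^ 2)) •
      ∑ q, dtau W k q • ContinuousLinearMap.proj (R := ℝ) (φ := fun _ : Fin 2 => ℝ) q) k := by
  have h1 : tau W k ≠ -1 := by rintro h; rw [h] at hk; norm_num at hk
  have h2 : tau W k ≠ 1 := by rintro h; rw [h] at hk; norm_num at hk
  exact (Real.hasDerivAt_arccos h1 h2).comp_hasFDerivAt k (hasFDerivAt_tau W k)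

/-- Differentiability is not needed: if it fails, `deriv` is 0 by convention. This covers the band
touching points τ² = 1, where the square root in the eigenvalue may have a corner. -/
theorem deriv_complex_eq_zero_of_extr {f : ℝ → ℂ} {x : ℝ}
    (hre : IsLocalExtr (fun s => (f s).re) x) (him : IsLocalExtr (fun s => (f s).im) x) :
    deriv f x = 0 := by
  by_cases hf : DifferentiableAt ℝ f x
  · have h := hf.hasDerivAt
    have h1 : HasDerivAt (fun s => (f s).re) (deriv f x).re x :=
      Complex.reCLM.hasFDerivAt.comp_hasDerivAt x h
    have h2 : HasDerivAt (fun s => (f s).im) (deriv f x).im x :=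
      Complex.imCLM.hasFDerivAt.comp_hasDerivAt x h
    apply Complex.ext
    · rw [← h1.deriv, hre.deriv_eq_zero, Complex.zero_re]
    · rw [← h2.deriv, him.deriv_eq_zero, Complex.zero_im]
  · exact deriv_zero_of_not_differentiableAt hf

/-- For τ² < 1 this is the derivative of the phase ±arccos τ. For τ² = 1 the right side is a
division by zero, hence 0, and so is the velocity: τ is at an extreme value and √(1 - τ²) at its
minimum. The formula thus holds for every k. -/
theorem vel_eq (ha : 0 < W.a) (hb : 0 < W.b) (hab : W.a + W.b = 1) (p : Fin 2)
    (k : Fin 2 → ℝ) (q : Fin 2) :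
    vel W p k q = (-1) ^ (p : ℕ) * (dtau W k q / √(1 - tau W k ^ 2)) := by
  rcases (tau_sq_le_one ha hb hab k).lt_or_eq with hk | hk
  · have h1 := hasFDerivAt_arccos_tau hk
    have h2 : HasDerivAt (fun s : ℝ => Real.arccos (tau W (Function.update k q s)))
        (-(1 / √(1 - tau W k ^ 2)) * dtau W k q) (k q) := by
      have h3 : tau W k ≠ -1 := by rintro h; rw [h] at hk; norm_num at hk
      have h4 : tau W k ≠ 1 := by rintro h; rw [h] at hk; norm_num at hk
      have h5 := (Real.hasDerivAt_arccos h3 h4)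
      rw [← Function.update_eq_self q k] at h5
      have := h5.comp (k q) (hasDerivAt_tau_update W k q)
      refine this.congr_deriv ?_
      rw [Function.update_eq_self]
    have h3 := (((h2.const_mul ((-1) ^ (p : ℕ))).ofReal_comp.const_mul Complex.I).cexp.mul_const
      (Complex.exp (Complex.I * ((W.δ 1 + W.δ 0 : ℝ) : ℂ) / 2)))
    have h4 : (fun s : ℝ => eigval W p (Function.update k q s)) = _ :=
      funext fun s => eigval_eq_exp ha hb hab p _
    have h5 := norm_eigval ha hb hab p k
    have h6 : eigval W p k ≠ 0 := by rw [← norm_ne_zero_iff, h5]; norm_num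
    rw [vel, h4, h3.deriv, Function.update_eq_self, mul_right_comm (Complex.exp _),
      ← eigval_eq_exp ha hb hab, div_mul_eq_mul_div,
      mul_left_comm, mul_div_cancel_left₀ _ h6]
    have h7 : Complex.I * (Complex.I * (((-1) ^ (p : ℕ) * (-(1 / √(1 - tau W k ^ 2)) * dtau W k q)
        : ℝ) : ℂ)) = (((-1) ^ (p : ℕ) * (dtau W k q / √(1 - tau W k ^ 2)) : ℝ) : ℂ) := by
      rw [← mul_assoc, Complex.I_mul_I]
      push_cast
      ring
    rw [h7, Complex.ofReal_re]
  · have hmin : ∀ k', √(1 - tau W k ^ 2) ≤ √(1 - tau W k' ^ 2) := fun k' => by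
      rw [hk]; simp
    have hd : deriv (fun s : ℝ => eigval W p (Function.update k q s)) (k q) = 0 := by
      unfold eigval
      rw [deriv_mul_const_field, deriv_complex_eq_zero_of_extr, zero_mul]
      · have h1 : ∀ s : ℝ, ((tau W (Function.update k q s) : ℂ) + (-1) ^ (p : ℕ) * Complex.I *
            (√(1 - tau W (Function.update k q s) ^ 2) : ℂ)).re =
            tau W (Function.update k q s) := fun s => by fin_cases p <;> simp
        simp only [h1]
        rcases eq_or_eq_neg_of_sq_eq_sq _ _ (hk.trans (one_pow 2).symm) with h | h
        · refine Or.inr (Eventually.of_forall fun s => ?_)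
          simp only [Function.update_eq_self]
          rw [h]
          exact (abs_le.1 (abs_tau_le ha hb hab _)).2
        · refine Or.inl (Eventually.of_forall fun s => ?_)
          simp only [Function.update_eq_self]
          rw [h]
          exact (abs_le.1 (abs_tau_le ha hb hab _)).1
      · have h1 : ∀ s : ℝ, ((tau W (Function.update k q s) : ℂ) + (-1) ^ (p : ℕ) * Complex.I *
            (√(1 - tau W (Function.update k q s) ^ 2) : ℂ)).im = (-1) ^ (p : ℕ) *
            √(1 - tau W (Function.update k q s) ^ 2) := fun s => by fin_cases p <;> simp
        simp only [h1]
        fin_cases p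
        · refine Or.inl (Eventually.of_forall fun s => ?_)
          simp [hk]
        · refine Or.inr (Eventually.of_forall fun s => ?_)
          simp [hk]
    rw [vel, hd, hk]
    simp

/-- The function `cos l₁ + cos l₂`, whose sign distinguishes the branches. -/
def csum (W : Params) (k : Fin 2 → ℝ) : ℝ := Real.cos (ell₁ W k) + Real.cos (ell₂ W k)

/-- The identity on which the case a + b = 1 rests. It bounds D below by abc², so that c ≠ 0
excludes degenerate eigenvalues, and division by D turns it into the equation of the ellipse. -/
theorem one_sub_tau_sq (hab : W.a + W.b = 1) (k : Fin 2 → ℝ) :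
    1 - tau W k ^ 2 = W.a * W.b * csum W k ^ 2 + W.a * Real.sin (ell₁ W k) ^ 2 +
      W.b * Real.sin (ell₂ W k) ^ 2 := by
  have hb' : W.b = 1 - W.a := by linarith
  rw [tau, csum, Real.sin_sq, Real.sin_sq, hb']
  ring

theorem tau_sq_lt_one (ha : 0 < W.a) (hb : 0 < W.b) (hab : W.a + W.b = 1) {k : Fin 2 → ℝ}
    (hk : csum W k ≠ 0) : tau W k ^ 2 < 1 := by
  have h1 := one_sub_tau_sq hab k
  have h2 : 0 < W.a * W.b * csum W k ^ 2 := by positivity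
  have h3 : 0 ≤ W.a * Real.sin (ell₁ W k) ^ 2 + W.b * Real.sin (ell₂ W k) ^ 2 := by positivity
  linarith

/-! ### Algebraic identities satisfied by the velocities -/

theorem vel_add (ha : 0 < W.a) (hb : 0 < W.b) (hab : W.a + W.b = 1) (p : Fin 2)
    (k : Fin 2 → ℝ) :
    vel W p k 0 + vel W p k 1 =
      (-1) ^ (p : ℕ) * (-2 * W.a * Real.sin (ell₁ W k) / √(1 - tau W k ^ 2)) := by
  rw [vel_eq ha hb hab, vel_eq ha hb hab, dtau]
  simp
  ring

theorem vel_sub (ha : 0 < W.a) (hb : 0 < W.b) (hab : W.a + W.b = 1) (p : Fin 2)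
    (k : Fin 2 → ℝ) :
    vel W p k 0 - vel W p k 1 =
      (-1) ^ (p : ℕ) * (-2 * W.b * Real.sin (ell₂ W k) / √(1 - tau W k ^ 2)) := by
  rw [vel_eq ha hb hab, vel_eq ha hb hab, dtau]
  simp
  ring

theorem neg_one_pow_sq (p : ℕ) : ((-1 : ℝ) ^ p) ^ 2 = 1 := by
  rw [← pow_mul, mul_comm, pow_mul, neg_one_sq, one_pow]

theorem vel_add_sq (ha : 0 < W.a) (hb : 0 < W.b) (hab : W.a + W.b = 1) (p : Fin 2)
    (k : Fin 2 → ℝ) :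
    (vel W p k 0 + vel W p k 1) ^ 2 =
      4 * W.a ^ 2 * Real.sin (ell₁ W k) ^ 2 / (1 - tau W k ^ 2) := by
  rw [vel_add ha hb hab, mul_pow, neg_one_pow_sq, div_pow,
    Real.sq_sqrt (by linarith [tau_sq_le_one ha hb hab k])]
  ring

theorem vel_sub_sq (ha : 0 < W.a) (hb : 0 < W.b) (hab : W.a + W.b = 1) (p : Fin 2)
    (k : Fin 2 → ℝ) :
    (vel W p k 0 - vel W p k 1) ^ 2 =
      4 * W.b ^ 2 * Real.sin (ell₂ W k) ^ 2 / (1 - tau W k ^ 2) := by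
  rw [vel_sub ha hb hab, mul_pow, neg_one_pow_sq, div_pow,
    Real.sq_sqrt (by linarith [tau_sq_le_one ha hb hab k])]
  ring

theorem ellipseForm_vel (ha : 0 < W.a) (hb : 0 < W.b) (hab : W.a + W.b = 1) (p : Fin 2)
    {k : Fin 2 → ℝ} (hk : tau W k ^ 2 < 1) :
    ellipseForm W (vel W p k) = W.a * W.b * csum W k ^ 2 / (1 - tau W k ^ 2) := by
  have h : 1 - tau W k ^ 2 ≠ 0 := by linarith
  rw [ellipseForm, vel_add_sq ha hb hab, vel_sub_sq ha hb hab]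
  field_simp
  linear_combination one_sub_tau_sq hab k

theorem vel_eq_zero_of_tau_sq (ha : 0 < W.a) (hb : 0 < W.b) (hab : W.a + W.b = 1) (p : Fin 2)
    {k : Fin 2 → ℝ} (hk : ¬ tau W k ^ 2 < 1) : vel W p k = 0 := by
  ext q
  rw [vel_eq ha hb hab, (tau_sq_le_one ha hb hab k).eq_of_not_lt hk]
  simp

theorem mem_ellipse_iff (v : Fin 2 → ℝ) : v ∈ ellipse W ↔ 0 ≤ ellipseForm W v := by
  rw [ellipse, ellipseForm, Set.mem_ofPred_eq]
  constructor <;> intro h <;> linarith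

theorem vel_mem_ellipse (ha : 0 < W.a) (hb : 0 < W.b) (hab : W.a + W.b = 1) (p : Fin 2)
    (k : Fin 2 → ℝ) : vel W p k ∈ ellipse W := by
  rw [mem_ellipse_iff]
  by_cases hk : tau W k ^ 2 < 1
  · rw [ellipseForm_vel ha hb hab p hk]
    have : 0 < 1 - tau W k ^ 2 := by linarith
    positivity
  · rw [vel_eq_zero_of_tau_sq ha hb hab p hk]
    simp [ellipseForm]

/-- The numerators of 1 - v₁² and 1 - v₂² over D are 2ab(1 + cos(l₁ + l₂)) and 2ab(1 + cos(l₁ -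
l₂)), and (1 + cos(l₁ + l₂))(1 + cos(l₁ - l₂)) = (cos l₁ + cos l₂)². -/
theorem speed_prod_vel (ha : 0 < W.a) (hb : 0 < W.b) (hab : W.a + W.b = 1) (p : Fin 2)
    {k : Fin 2 → ℝ} (hk : tau W k ^ 2 < 1) :
    (1 - vel W p k 0 ^ 2) * (1 - vel W p k 1 ^ 2) =
      (2 * W.a * W.b * csum W k / (1 - tau W k ^ 2)) ^ 2 := by
  have h : 1 - tau W k ^ 2 ≠ 0 := by linarith
  have hD : 0 ≤ 1 - tau W k ^ 2 := by linarith
  have h1 := Real.sin_sq_add_cos_sq (ell₁ W k)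
  have h2 := Real.sin_sq_add_cos_sq (ell₂ W k)
  have hb' : W.b = 1 - W.a := by linarith
  have e0 : 1 - tau W k ^ 2 - dtau W k 0 ^ 2 = 2 * W.a * W.b * (1 + Real.cos (ell₁ W k) *
      Real.cos (ell₂ W k) - Real.sin (ell₁ W k) * Real.sin (ell₂ W k)) := by
    simp only [dtau, tau, Matrix.cons_val_zero, hb']
    linear_combination (-W.a ^ 2) * h1 - (1 - W.a) ^ 2 * h2
  have e1 : 1 - tau W k ^ 2 - dtau W k 1 ^ 2 = 2 * W.a * W.b * (1 + Real.cos (ell₁ W k) *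
      Real.cos (ell₂ W k) + Real.sin (ell₁ W k) * Real.sin (ell₂ W k)) := by
    simp only [dtau, tau, Matrix.cons_val_one, Matrix.cons_val_fin_one, hb']
    linear_combination (-W.a ^ 2) * h1 - (1 - W.a) ^ 2 * h2
  have e2 : (1 - tau W k ^ 2 - dtau W k 0 ^ 2) * (1 - tau W k ^ 2 - dtau W k 1 ^ 2) =
      (2 * W.a * W.b * csum W k) ^ 2 := by
    rw [e0, e1, csum]
    linear_combination (-(2 * W.a * W.b) ^ 2) * (Real.sin (ell₂ W k) ^ 2 * h1 +
      (1 - Real.cos (ell₁ W k) ^ 2) * h2)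
  rw [vel_eq ha hb hab, vel_eq ha hb hab, mul_pow, mul_pow, neg_one_pow_sq, div_pow, div_pow,
    Real.sq_sqrt hD, div_pow, ← e2]
  field_simp

/-- The factor in front of cos l₁ is, up to the sign of c, the square root of (1 - v₁²)(1 - v₂²).
Hence the quotient recovers cos l₁ once ε is taken to be that sign; `branch_numerator₂_vel` does the
same for cos l₂. -/
theorem branch_numerator₁_vel (ha : 0 < W.a) (hb : 0 < W.b) (hab : W.a + W.b = 1) (p : Fin 2)
    {k : Fin 2 → ℝ} (hk : tau W k ^ 2 < 1) :
    1 - (1 + W.b) * (vel W p k 0 + vel W p k 1) ^ 2 / (4 * W.a) -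
      (vel W p k 0 - vel W p k 1) ^ 2 / 4 =
      2 * W.a * W.b * csum W k / (1 - tau W k ^ 2) * Real.cos (ell₁ W k) := by
  have h : 1 - tau W k ^ 2 ≠ 0 := by linarith
  rw [vel_add_sq ha hb hab, vel_sub_sq ha hb hab]
  field_simp
  have hb' : W.b = 1 - W.a := by linarith
  rw [tau, csum, Real.sin_sq, Real.sin_sq, hb']
  ring

theorem branch_numerator₂_vel (ha : 0 < W.a) (hb : 0 < W.b) (hab : W.a + W.b = 1) (p : Fin 2)
    {k : Fin 2 → ℝ} (hk : tau W k ^ 2 < 1) :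
    1 - (vel W p k 0 + vel W p k 1) ^ 2 / 4 -
      (1 + W.a) * (vel W p k 0 - vel W p k 1) ^ 2 / (4 * W.b) =
      2 * W.a * W.b * csum W k / (1 - tau W k ^ 2) * Real.cos (ell₂ W k) := by
  have h : 1 - tau W k ^ 2 ≠ 0 := by linarith
  rw [vel_add_sq ha hb hab, vel_sub_sq ha hb hab]
  field_simp
  have hb' : W.b = 1 - W.a := by linarith
  rw [tau, csum, Real.sin_sq, Real.sin_sq, hb']
  ring

theorem sqrt_speed_prod_vel (ha : 0 < W.a) (hb : 0 < W.b) (hab : W.a + W.b = 1) (p : Fin 2)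
    {k : Fin 2 → ℝ} {ε : ℝ} (hε : ε ^ 2 = 1) (hk : 0 < ε * csum W k) :
    √((1 - vel W p k 0 ^ 2) * (1 - vel W p k 1 ^ 2)) =
      ε * (2 * W.a * W.b * csum W k / (1 - tau W k ^ 2)) := by
  have hk' : tau W k ^ 2 < 1 := tau_sq_lt_one ha hb hab (right_ne_zero_of_mul hk.ne')
  rw [speed_prod_vel ha hb hab p hk']
  have h : 0 < 1 - tau W k ^ 2 := by linarith
  have : (2 * W.a * W.b * csum W k / (1 - tau W k ^ 2)) ^ 2 =
      (ε * (2 * W.a * W.b * csum W k / (1 - tau W k ^ 2))) ^ 2 := by rw [mul_pow, hε, one_mul]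
  rw [this, Real.sqrt_sq]
  have : ε * (2 * W.a * W.b * csum W k / (1 - tau W k ^ 2)) =
    2 * W.a * W.b * (ε * csum W k) / (1 - tau W k ^ 2) := by ring
  rw [this]
  positivity

theorem branchC₁_vel (ha : 0 < W.a) (hb : 0 < W.b) (hab : W.a + W.b = 1) (p : Fin 2)
    {k : Fin 2 → ℝ} {ε : ℝ} (hε : ε ^ 2 = 1) (hk : 0 < ε * csum W k) :
    branchC₁ W ε (vel W p k) = Real.cos (ell₁ W k) := by
  have hc := right_ne_zero_of_mul hk.ne'
  have hk' : tau W k ^ 2 < 1 := tau_sq_lt_one ha hb hab hc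
  have h : 1 - tau W k ^ 2 ≠ 0 := by linarith
  have hε' : ε ≠ 0 := by rintro rfl; norm_num at hε
  rw [branchC₁, branch_numerator₁_vel ha hb hab p hk', sqrt_speed_prod_vel ha hb hab p hε hk]
  field_simp

theorem branchC₂_vel (ha : 0 < W.a) (hb : 0 < W.b) (hab : W.a + W.b = 1) (p : Fin 2)
    {k : Fin 2 → ℝ} {ε : ℝ} (hε : ε ^ 2 = 1) (hk : 0 < ε * csum W k) :
    branchC₂ W ε (vel W p k) = Real.cos (ell₂ W k) := by
  have hc := right_ne_zero_of_mul hk.ne'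
  have hk' : tau W k ^ 2 < 1 := tau_sq_lt_one ha hb hab hc
  have h : 1 - tau W k ^ 2 ≠ 0 := by linarith
  have hε' : ε ≠ 0 := by rintro rfl; norm_num at hε
  rw [branchC₂, branch_numerator₂_vel ha hb hab p hk', sqrt_speed_prod_vel ha hb hab p hε hk]
  field_simp

end Dispersion

/-! ### Spectral projections of the symbol -/

section Frame

variable {W : Params} {e : (Fin 2 → ℝ) → OrthonormalBasis (Fin 2) ℂ Coin}

theorem toEuclideanLin_eq (M : Matrix (Fin 2) (Fin 2) ℂ) (x : Coin) :
    Matrix.toEuclideanLin M x = WithLp.toLp 2 (M.mulVec x.ofLp) := rfl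

theorem toEuclideanLin_mul (M N : Matrix (Fin 2) (Fin 2) ℂ) (x : Coin) :
    Matrix.toEuclideanLin (M * N) x = Matrix.toEuclideanLin M (Matrix.toEuclideanLin N x) := by
  simp [toEuclideanLin_eq]

theorem iterate_stepHat_apply (he : IsEigenframe W e) (k : Fin 2 → ℝ) (t : ℕ) (x : Coin) :
    (Matrix.toEuclideanLin (stepHat W k))^[t] x =
      ∑ p, eigval W p k ^ t • (inner ℂ (e k p) x • e k p) := by
  induction t with
  | zero => simpa using ((e k).sum_repr' x).symm
  | succ t ih =>
    rw [Function.iterate_succ_apply', ih, map_sum]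
    refine Finset.sum_congr rfl fun p _ => ?_
    rw [map_smul, map_smul, he k p, pow_succ, mul_smul, smul_comm (eigval W p k)]

theorem eigval_ne (p : Fin 2)
    {k : Fin 2 → ℝ} (hk : tau W k ^ 2 < 1) : eigval W p k - eigval W p.rev k ≠ 0 := by
  have h : (√(1 - tau W k ^ 2) : ℂ) ≠ 0 := by
    rw [Complex.ofReal_ne_zero]
    exact (Real.sqrt_pos.2 (by linarith)).ne'
  rw [eigval, eigval, ← sub_mul]
  refine mul_ne_zero ?_ (Complex.exp_ne_zero _)
  have : ((tau W k : ℂ) + (-1) ^ (p : ℕ) * Complex.I * (√(1 - tau W k ^ 2) : ℂ)) -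
      ((tau W k : ℂ) + (-1) ^ (p.rev : ℕ) * Complex.I * (√(1 - tau W k ^ 2) : ℂ)) =
      (-1) ^ (p : ℕ) * 2 * Complex.I * (√(1 - tau W k ^ 2) : ℂ) := by
    fin_cases p <;> simp <;> ring
  rw [this]
  simp [h]

/-- The spectral projection of the symbol for the eigenvalue with index `p`, written as a
polynomial in the symbol. -/
def eigenProj (W : Params) (p : Fin 2) (k : Fin 2 → ℝ) (x : Coin) : Coin :=
  (eigval W p k - eigval W p.rev k)⁻¹ •
    (Matrix.toEuclideanLin (stepHat W k) x - eigval W p.rev k • x)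

/-- On ℂ² the projection onto one eigenvector is (Û - λ')/(λ - λ'), with λ' the other eigenvalue.
This passes from an arbitrary frame to an expression that depends measurably, and off the
degeneracies continuously, on k. -/
theorem eigenProj_eq
    (he : IsEigenframe W e) (p : Fin 2) {k : Fin 2 → ℝ} (hk : tau W k ^ 2 < 1) (x : Coin) :
    eigenProj W p k x = inner ℂ (e k p) x • e k p := by
  have h := eigval_ne p hk
  have h1 := iterate_stepHat_apply he k 1 x
  have h2 := (e k).sum_repr' x
  rw [Function.iterate_one] at h1
  rw [eigenProj, inv_smul_eq_iff₀ h, h1]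
  have h3 : eigval W p.rev k • x =
      eigval W p.rev k • ∑ i, inner ℂ (e k i) x • e k i := by rw [h2]
  rw [h3]
  fin_cases p <;> simp only [Fin.sum_univ_two, Fin.zero_eta, Fin.mk_one, pow_one,
    show (Fin.rev 0 : Fin 2) = 1 from rfl, show (Fin.rev 1 : Fin 2) = 0 from rfl] <;> module

theorem continuous_eigval (p : Fin 2) : Continuous (eigval W p) := by
  have := continuous_tau W
  unfold eigval
  fun_prop

theorem continuous_stepHat : Continuous (stepHat W) := by
  have h : ∀ q, Continuous (shiftHat q) := fun q => by
    refine continuous_matrix fun i j => ?_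
    fin_cases i <;> fin_cases j <;> simp [shiftHat] <;> fun_prop
  unfold stepHat
  have h0 := h 0
  have h1 := h 1
  fun_prop

theorem continuous_stepHat_apply :
    Continuous fun y : (Fin 2 → ℝ) × Coin => Matrix.toEuclideanLin (stepHat W y.1) y.2 := by
  simp only [toEuclideanLin_eq]
  refine (PiLp.continuous_toLp 2 _).comp ?_
  exact (continuous_stepHat.comp continuous_fst).matrix_mulVec
    ((PiLp.continuous_ofLp 2 _).comp continuous_snd)

theorem measurable_eigenProj (p : Fin 2) :
    Measurable fun y : (Fin 2 → ℝ) × Coin => eigenProj W p y.1 y.2 := by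
  have h1 := continuous_eigval (W := W) p
  have h2 := continuous_eigval (W := W) p.rev
  unfold eigenProj
  have h3 := ((h1.comp continuous_fst).sub (h2.comp continuous_fst) :
    Continuous fun y : (Fin 2 → ℝ) × Coin => eigval W p y.1 - eigval W p.rev y.1).measurable.inv
  have h4 := (continuous_stepHat_apply.sub ((h2.comp continuous_fst).smul continuous_snd) :
    Continuous fun y : (Fin 2 → ℝ) × Coin => Matrix.toEuclideanLin (stepHat W y.1) y.2 -
      eigval W p.rev y.1 • y.2).measurable
  exact h3.smul h4

theorem continuousAt_eigenProj (p : Fin 2)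
    {k : Fin 2 → ℝ} (hk : tau W k ^ 2 < 1) (x : Coin) :
    ContinuousAt (fun k => eigenProj W p k x) k := by
  have h1 := (continuous_eigval (W := W) p).continuousAt (x := k)
  have h2 := (continuous_eigval (W := W) p.rev).continuousAt (x := k)
  unfold eigenProj
  refine ((h1.sub h2).inv₀ (eigval_ne p hk)).smul (ContinuousAt.sub ?_ ?_)
  · exact (continuous_stepHat_apply.comp (continuous_id.prodMk continuous_const)).continuousAt
  · exact h2.smul continuousAt_const

/-- The constant phase from δ₁ + δ₂ cancels, leaving exp of ±i t (arccos τ(k - ξ/t) - arccos τ(k));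
the exponent is a difference quotient in the direction -ξ. -/
theorem tendsto_phase (ha : 0 < W.a) (hb : 0 < W.b) (hab : W.a + W.b = 1) (p : Fin 2)
    {k : Fin 2 → ℝ} (hk : tau W k ^ 2 < 1) (ξ : Fin 2 → ℝ) :
    Tendsto (fun t : ℕ => (starRingEnd ℂ) (eigval W p k ^ t) *
      eigval W p (k + (t : ℝ)⁻¹ • -ξ) ^ t) atTop
      (𝓝 (Complex.exp (Complex.I * ((∑ q, ξ q * vel W p k q : ℝ) : ℂ)))) := by
  have h1 := ((hasFDerivAt_arccos_tau hk).lim_real (-ξ)).comp tendsto_natCast_atTop_atTop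
  have h2 := (h1.const_mul ((-1) ^ (p : ℕ))).ofReal.const_mul Complex.I |>.cexp
  convert h2 using 2 with t
  · rw [eigval_eq_exp ha hb hab, eigval_eq_exp ha hb hab, mul_pow, mul_pow, map_mul,
      mul_mul_mul_comm, ← Complex.exp_nat_mul, ← Complex.exp_nat_mul, ← Complex.exp_nat_mul,
      ← Complex.exp_conj, ← Complex.exp_conj, ← Complex.exp_add, ← Complex.exp_add,
      ← Complex.exp_add]
    congr 1
    simp only [map_mul, map_div₀, Complex.conj_I, Complex.conj_ofReal, map_ofNat, map_natCast,
      Function.comp_apply, smul_eq_mul]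
    push_cast
    ring
  · congr 2
    simp only [vel_eq ha hb hab, Fin.sum_univ_two]
    simp
    ring

/-- Expand the left vector in the frame at k and the right one in spectral projections at k - ξ/t.
Off the diagonal the phases have modulus one while the projected vector tends to a multiple of `e k
p`, which is orthogonal to `e k q`; on the diagonal `tendsto_phase` applies. -/
theorem tendsto_inner_iterate (ha : 0 < W.a) (hb : 0 < W.b) (hab : W.a + W.b = 1)
    (he : IsEigenframe W e) {k : Fin 2 → ℝ} (hk : tau W k ^ 2 < 1) (ξ : Fin 2 → ℝ) (x : Coin) :
    Tendsto (fun t : ℕ => inner ℂ ((Matrix.toEuclideanLin (stepHat W k))^[t] x)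
      ((Matrix.toEuclideanLin (stepHat W (k + (t : ℝ)⁻¹ • -ξ)))^[t] x)) atTop
      (𝓝 (∑ p, Complex.exp (Complex.I * ((∑ q, ξ q * vel W p k q : ℝ) : ℂ)) *
        ((‖inner ℂ x (e k p)‖ ^ 2 : ℝ) : ℂ))) := by
  have hη : Tendsto (fun t : ℕ => k + (t : ℝ)⁻¹ • -ξ) atTop (𝓝 k) := by
    have := (tendsto_inv_atTop_nhds_zero_nat (𝕜 := ℝ)).smul_const (-ξ)
      |>.const_add k
    simpa using this
  have hnd : ∀ᶠ t : ℕ in atTop, tau W (k + (t : ℝ)⁻¹ • -ξ) ^ 2 < 1 :=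
    hη.eventually (((continuous_tau W).pow 2).continuousAt.eventually_lt_const hk)
  have hterm : ∀ q p : Fin 2, Tendsto (fun t : ℕ => (starRingEnd ℂ) (inner ℂ (e k q) x) *
      ((starRingEnd ℂ) (eigval W q k ^ t) * eigval W p (k + (t : ℝ)⁻¹ • -ξ) ^ t) *
        inner ℂ (e k q) (eigenProj W p (k + (t : ℝ)⁻¹ • -ξ) x)) atTop
      (𝓝 (if q = p then Complex.exp (Complex.I * ((∑ q, ξ q * vel W p k q : ℝ) : ℂ)) *
        ((‖inner ℂ x (e k p)‖ ^ 2 : ℝ) : ℂ) else 0)) := by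
    intro q p
    have hP := (tendsto_const_nhds (x := e k q)).inner (𝕜 := ℂ)
      ((continuousAt_eigenProj p hk x).tendsto.comp hη)
    rw [eigenProj_eq he p hk, inner_smul_right,
      (orthonormal_iff_ite.1 (e k).orthonormal)] at hP
    by_cases h : q = p
    · subst h
      have := ((tendsto_phase ha hb hab q hk ξ).const_mul
        ((starRingEnd ℂ) (inner ℂ (e k q) x))).mul hP
      refine this.trans (le_of_eq ?_)
      congr 1
      rw [if_pos rfl, if_pos rfl, mul_one, inner_conj_symm, mul_right_comm, mul_comm]
      congr 1
      rw [← inner_conj_symm (e k q) x, Complex.mul_conj, Complex.normSq_eq_norm_sq]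
    · rw [if_neg h, mul_zero] at hP
      rw [if_neg h]
      refine squeeze_zero_norm (fun t => ?_)
        ((hP.norm.const_mul ‖inner ℂ (e k q) x‖).trans (le_of_eq ?_))
      · rw [norm_mul, norm_mul, norm_mul, RCLike.norm_conj, RCLike.norm_conj, norm_pow, norm_pow,
          norm_eigval ha hb hab, norm_eigval ha hb hab]
        simp
      · simp
  have hsum := tendsto_finsetSum Finset.univ fun q _ =>
    tendsto_finsetSum Finset.univ fun p _ => hterm q p
  simp only [Finset.sum_ite_eq, Finset.mem_univ, if_true] at hsum
  refine hsum.congr' ?_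
  filter_upwards [hnd] with t ht
  rw [iterate_stepHat_apply he, iterate_stepHat_apply he, sum_inner]
  refine Finset.sum_congr rfl fun q _ => ?_
  rw [inner_sum]
  refine Finset.sum_congr rfl fun p _ => ?_
  rw [← eigenProj_eq he p ht, inner_smul_left, inner_smul_left, inner_smul_right]
  ring

theorem norm_iterate_stepHat (ha : 0 < W.a) (hb : 0 < W.b) (hab : W.a + W.b = 1)
    (he : IsEigenframe W e) (k : Fin 2 → ℝ) (t : ℕ) (x : Coin) :
    ‖(Matrix.toEuclideanLin (stepHat W k))^[t] x‖ = ‖x‖ := by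
  rw [← sq_eq_sq₀ (norm_nonneg _) (norm_nonneg _), ← (e k).sum_sq_norm_inner_right,
    ← (e k).sum_sq_norm_inner_right x, iterate_stepHat_apply he]
  refine Finset.sum_congr rfl fun q _ => ?_
  simp_rw [smul_smul]
  rw [(e k).orthonormal.inner_right_fintype, norm_mul, norm_pow, norm_eigval ha hb hab, one_pow,
    one_mul]

end Frame

/-! ### The Fourier transform as a unitary map -/

section FourierTransform

/-- The measure on `ℝ / ℤ` with total mass one. -/
local instance measureSpaceCircle : MeasureSpace UnitAddCircle := ⟨AddCircle.haarAddCircle⟩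

local instance isProbabilityMeasureCircle :
    IsProbabilityMeasure (volume : Measure UnitAddCircle) :=
  inferInstanceAs (IsProbabilityMeasure AddCircle.haarAddCircle)

/-- The point of `(ℝ/ℤ)²` that corresponds to a wave number. -/
def torusPoint (k : Fin 2 → ℝ) : UnitAddTorus (Fin 2) :=
  fun j => ((-(k j) / (2 * Real.pi) : ℝ) : UnitAddCircle)

/-- The wave number in the fundamental domain that corresponds to a point of `(ℝ/ℤ)²`. -/
def waveNumber (y : UnitAddTorus (Fin 2)) : Fin 2 → ℝ :=
  fun j => -(2 * Real.pi) * (AddCircle.equivIoc 1 (-(1 / 2)) (y j) : ℝ)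

/-- The minus sign in `torusPoint` reverses the half-open interval: [-π, π) becomes (-1/2, 1/2],
hence `equivIoc` based at -1/2. -/
theorem waveNumber_torusPoint {k : Fin 2 → ℝ} (hk : k ∈ torus) :
    waveNumber (torusPoint k) = k := by
  ext j
  have hpi := Real.pi_pos
  have hj : k j ∈ Set.Ico (-Real.pi) Real.pi := hk j (Set.mem_univ j)
  have h : -(k j) / (2 * Real.pi) ∈ Set.Ioc (-(1 / 2)) (-(1 / 2) + 1 : ℝ) := by
    constructor
    · rw [lt_div_iff₀ (by positivity)]; linarith [hj.2]
    · rw [div_le_iff₀ (by positivity)]; linarith [hj.1]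
  rw [waveNumber, torusPoint, AddCircle.equivIoc_coe_of_mem h]
  field_simp

theorem measurable_torusPoint : Measurable torusPoint := by
  refine measurable_pi_lambda _ fun j => ?_
  exact AddCircle.measurable_mk'.comp (by fun_prop)

theorem measurable_waveNumber : Measurable waveNumber := by
  refine measurable_pi_lambda _ fun j => ?_
  refine Measurable.const_mul ?_ _
  exact measurable_subtype_coe.comp
    ((AddCircle.measurableEquivIoc 1 (-(1 / 2) : ℝ)).measurable.comp (measurable_pi_apply j))

theorem measurableSet_torus : MeasurableSet torus :=
  MeasurableSet.univ_pi fun _ => measurableSet_Ico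

theorem map_circlePoint :
    Measure.map (fun x : ℝ => ((-x / (2 * Real.pi) : ℝ) : UnitAddCircle))
      (volume.restrict (Set.Ico (-Real.pi) Real.pi)) =
      ENNReal.ofReal (2 * Real.pi) • (volume : Measure UnitAddCircle) := by
  have hpi := Real.pi_pos
  have h1 := (AddCircle.measurePreserving_mk 1 (-(1 / 2))).map_eq
  rw [AddCircle.volume_eq_smul_haarAddCircle, ENNReal.ofReal_one, one_smul] at h1
  have h2 := Real.map_volume_mul_left (a := -(2 * Real.pi)⁻¹) (by simp [hpi.ne'])
  have h3 : (fun x : ℝ => -(2 * Real.pi)⁻¹ * x) ⁻¹' Set.Ioc (-(1 / 2)) (-(1 / 2) + 1) =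
      Set.Ico (-Real.pi) Real.pi := by
    ext x
    have : -(2 * Real.pi)⁻¹ * x = -x / (2 * Real.pi) := by ring
    rw [Set.mem_preimage, this, Set.mem_Ioc, Set.mem_Ico, lt_div_iff₀ (by positivity),
      div_le_iff₀ (by positivity)]
    constructor <;> rintro ⟨_, _⟩ <;> constructor <;> linarith
  have h4 : Measure.map (fun x : ℝ => -(2 * Real.pi)⁻¹ * x)
      (volume.restrict (Set.Ico (-Real.pi) Real.pi)) =
      ENNReal.ofReal (2 * Real.pi) • volume.restrict (Set.Ioc (-(1 / 2)) (-(1 / 2) + 1)) := by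
    rw [← h3, ← Measure.restrict_map (by fun_prop) measurableSet_Ioc, h2, Measure.restrict_smul,
      inv_neg, inv_inv, abs_neg, abs_of_pos (by positivity)]
  have h5 : (fun x : ℝ => ((-x / (2 * Real.pi) : ℝ) : UnitAddCircle)) =
      (fun x : ℝ => (x : UnitAddCircle)) ∘ fun x : ℝ => -(2 * Real.pi)⁻¹ * x := by
    ext x
    simp only [Function.comp_apply]
    congr 1
    ring
  rw [h5, ← Measure.map_map AddCircle.measurable_mk' (by fun_prop), h4, Measure.map_smul, h1]
  rfl

theorem map_torusPoint :
    Measure.map torusPoint (volume.restrict torus) =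
      ENNReal.ofReal ((2 * Real.pi) ^ 2) • (volume : Measure (UnitAddTorus (Fin 2))) := by
  have h1 : (volume : Measure (Fin 2 → ℝ)).restrict torus =
      Measure.pi fun _ => volume.restrict (Set.Ico (-Real.pi) Real.pi) :=
    Measure.restrict_pi_pi (fun _ => volume) fun _ => Set.Ico (-Real.pi) Real.pi
  have hfin : IsFiniteMeasure (ENNReal.ofReal (2 * Real.pi) • (volume : Measure UnitAddCircle)) :=
    Measure.smul_finite _ ENNReal.ofReal_ne_top
  have h2 := (measurePreserving_pi (fun _ : Fin 2 => volume.restrict (Set.Ico (-Real.pi) Real.pi))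
    (fun _ : Fin 2 => ENNReal.ofReal (2 * Real.pi) • (volume : Measure UnitAddCircle))
    (f := fun _ x => ((-x / (2 * Real.pi) : ℝ) : UnitAddCircle))
    (fun _ => ⟨AddCircle.measurable_mk'.comp (by fun_prop), map_circlePoint⟩)).map_eq
  rw [h1]
  refine h2.trans (Measure.pi_eq fun s _ => ?_)
  rw [Measure.smul_apply, volume_pi, Measure.pi_pi]
  simp only [Fin.prod_univ_two, Measure.smul_apply, smul_eq_mul]
  rw [ENNReal.ofReal_pow (by positivity)]
  ring

theorem measurePreserving_torusPoint :
    MeasurePreserving torusPoint (volume.restrict torus)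
      (ENNReal.ofReal ((2 * Real.pi) ^ 2) • (volume : Measure (UnitAddTorus (Fin 2)))) :=
  ⟨measurable_torusPoint, map_torusPoint⟩

theorem measurePreserving_waveNumber :
    MeasurePreserving waveNumber
      (ENNReal.ofReal ((2 * Real.pi) ^ 2) • (volume : Measure (UnitAddTorus (Fin 2))))
      (volume.restrict torus) := by
  refine ⟨measurable_waveNumber, ?_⟩
  rw [← map_torusPoint, Measure.map_map measurable_waveNumber measurable_torusPoint]
  have : waveNumber ∘ torusPoint =ᵐ[volume.restrict torus] id := by
    filter_upwards [ae_restrict_mem measurableSet_torus] with k hk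
    exact waveNumber_torusPoint hk
  rw [Measure.map_congr this, Measure.map_id]

theorem ofReal_two_pi_sq_ne_zero : ENNReal.ofReal ((2 * Real.pi) ^ 2) ≠ 0 := by
  have := Real.pi_pos
  rw [Ne, ENNReal.ofReal_eq_zero, not_le]
  positivity

theorem ae_torusPoint {P : UnitAddTorus (Fin 2) → Prop}
    (h : ∀ᵐ y ∂(volume : Measure (UnitAddTorus (Fin 2))), P y) :
    ∀ᵐ k ∂(volume.restrict torus), P (torusPoint k) :=
  measurePreserving_torusPoint.quasiMeasurePreserving.ae (Measure.ae_smul_measure h _)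

theorem memLp_comp_torusPoint {E : Type*} [NormedAddCommGroup E] {f : UnitAddTorus (Fin 2) → E}
    (hf : MemLp f 2 volume) : MemLp (fun k => f (torusPoint k)) 2 (volume.restrict torus) :=
  (hf.smul_measure ENNReal.ofReal_ne_top).comp_measurePreserving measurePreserving_torusPoint

theorem integral_torus_comp_torusPoint {E : Type*} [NormedAddCommGroup E] [NormedSpace ℝ E]
    {f : UnitAddTorus (Fin 2) → E} (hf : AEStronglyMeasurable f volume) :
    ∫ k in torus, f (torusPoint k) = ((2 * Real.pi) ^ 2) • ∫ y, f y := by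
  rw [← integral_map measurable_torusPoint.aemeasurable, map_torusPoint, integral_smul_measure,
    ENNReal.toReal_ofReal (by positivity)]
  rw [map_torusPoint]
  exact hf.smul_measure _

/-- The Fourier transform of a scalar sequence, on the torus `(ℝ/ℤ)²`. -/
def fourierL2 (ψ : lp (fun _ : Site => ℂ) 2) : Lp ℂ 2 (volume : Measure (UnitAddTorus (Fin 2))) :=
  UnitAddTorus.mFourierBasis.repr.symm ψ

theorem fourier_apply (Ψ : StateSpace) (k : Fin 2 → ℝ) (i : Fin 2) :
    fourier Ψ k i = fourierL2 (coord Ψ i) (torusPoint k) := rfl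

theorem memLp_fourier (Ψ : StateSpace) : MemLp (fourier Ψ) 2 (volume.restrict torus) := by
  have h : ∀ i, MemLp (fun k => fourier Ψ k i) 2 (volume.restrict torus) := fun i =>
    memLp_comp_torusPoint (Lp.memLp (fourierL2 (coord Ψ i)))
  exact MemLp.of_eval_piLp h

theorem inner_coord (Φ Ψ : StateSpace) :
    inner ℂ Φ Ψ = ∑ i, inner ℂ (coord Φ i) (coord Ψ i) := by
  rw [lp.inner_eq_tsum]
  simp only [lp.inner_eq_tsum]
  rw [← Summable.tsum_finsetSum fun i _ => lp.summable_inner (𝕜 := ℂ) (coord Φ i) (coord Ψ i)]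
  refine tsum_congr fun x => ?_
  rw [PiLp.inner_apply]
  rfl

theorem integrable_inner_of_memLp {α : Type*} [MeasurableSpace α] {μ : Measure α} {f g : α → Coin}
    (hf : MemLp f 2 μ) (hg : MemLp g 2 μ) : Integrable (fun x => inner ℂ (f x) (g x)) μ := by
  refine (L2.integrable_inner (𝕜 := ℂ) (hf.toLp f) (hg.toLp g)).congr ?_
  filter_upwards [hf.coeFn_toLp, hg.coeFn_toLp] with x h1 h2
  rw [h1, h2]

/-- Parseval's identity in both coin components; the prefactor is the volume of [-π, π)², since the
circle carries a probability measure. -/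
theorem inner_eq_integral (Φ Ψ : StateSpace) :
    inner ℂ Φ Ψ =
      ((2 * Real.pi : ℂ) ^ 2)⁻¹ * ∫ k in torus, inner ℂ (fourier Φ k) (fourier Ψ k) := by
  have hpi : (2 * Real.pi : ℂ) ^ 2 ≠ 0 := by simp [Real.pi_ne_zero]
  have h0 : ∀ i, Integrable
      (fun y => inner ℂ (fourierL2 (coord Φ i) y) (fourierL2 (coord Ψ i) y)) :=
    fun i => L2.integrable_inner _ _
  have h1 : ∀ i, inner ℂ (coord Φ i) (coord Ψ i) =
      ∫ y, inner ℂ (fourierL2 (coord Φ i) y) (fourierL2 (coord Ψ i) y) := fun i => by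
    rw [← L2.inner_def]
    exact (UnitAddTorus.mFourierBasis.repr.symm.inner_map_map _ _).symm
  have h2 : ∀ k, inner ℂ (fourier Φ k) (fourier Ψ k) = ∑ i, inner ℂ
      (fourierL2 (coord Φ i) (torusPoint k)) (fourierL2 (coord Ψ i) (torusPoint k)) := fun k => by
    rw [PiLp.inner_apply]
    rfl
  rw [inner_coord, eq_inv_mul_iff_mul_eq₀ hpi]
  simp only [h1, h2]
  rw [← integral_finsetSum _ fun i _ => h0 i,
    integral_torus_comp_torusPoint (f := fun y => ∑ i, inner ℂ (fourierL2 (coord Φ i) y)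
      (fourierL2 (coord Ψ i) y)) (integrable_finsetSum _ fun i _ => h0 i).aestronglyMeasurable,
    Complex.real_smul]
  push_cast
  rfl

theorem norm_sq_eq_integral (Ψ : StateSpace) :
    ‖Ψ‖ ^ 2 = ((2 * Real.pi) ^ 2)⁻¹ * ∫ k in torus, ‖fourier Ψ k‖ ^ 2 := by
  have h := inner_eq_integral Ψ Ψ
  simp only [inner_self_eq_norm_sq_to_K, Complex.coe_algebraMap, ← Complex.ofReal_pow] at h
  rw [integral_complex_ofReal] at h
  exact_mod_cast h

theorem coord_add (Φ Ψ : StateSpace) (i : Fin 2) : coord (Φ + Ψ) i = coord Φ i + coord Ψ i := by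
  ext x
  rfl

theorem coord_smul (c : ℂ) (Ψ : StateSpace) (i : Fin 2) : coord (c • Ψ) i = c • coord Ψ i := by
  ext x
  rfl

theorem fourier_add (Φ Ψ : StateSpace) :
    ∀ᵐ k ∂(volume.restrict torus), fourier (Φ + Ψ) k = fourier Φ k + fourier Ψ k := by
  have h : ∀ i, ∀ᵐ k ∂(volume.restrict torus),
      fourier (Φ + Ψ) k i = fourier Φ k i + fourier Ψ k i := fun i => by
    refine ae_torusPoint (P := fun y => fourierL2 (coord (Φ + Ψ) i) y =
      fourierL2 (coord Φ i) y + fourierL2 (coord Ψ i) y) ?_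
    rw [coord_add, fourierL2, map_add]
    exact Lp.coeFn_add _ _
  filter_upwards [ae_all_iff.2 h] with k hk
  ext i
  exact hk i

theorem fourier_smul (c : ℂ) (Ψ : StateSpace) :
    ∀ᵐ k ∂(volume.restrict torus), fourier (c • Ψ) k = c • fourier Ψ k := by
  have h : ∀ i, ∀ᵐ k ∂(volume.restrict torus),
      fourier (c • Ψ) k i = c • fourier Ψ k i := fun i => by
    refine ae_torusPoint (P := fun y => fourierL2 (coord (c • Ψ) i) y =
      c • fourierL2 (coord Ψ i) y) ?_
    rw [coord_smul, fourierL2, map_smul]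
    exact Lp.coeFn_smul _ _
  filter_upwards [ae_all_iff.2 h] with k hk
  ext i
  exact hk i

theorem fourier_injective {Φ Ψ : StateSpace}
    (h : ∀ᵐ k ∂(volume.restrict torus), fourier Φ k = fourier Ψ k) : Φ = Ψ := by
  have h1 : ‖Φ + (-1 : ℂ) • Ψ‖ ^ 2 = 0 := by
    rw [norm_sq_eq_integral, integral_eq_zero_of_ae, mul_zero]
    filter_upwards [h, fourier_add Φ ((-1 : ℂ) • Ψ), fourier_smul (-1) Ψ] with k h1 h2 h3
    rw [h2, h3, h1]
    simp
  have h2 : Φ + (-1 : ℂ) • Ψ = 0 := by simpa using h1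
  rwa [neg_one_smul, ← sub_eq_add_neg, sub_eq_zero] at h2

/-- A state with prescribed coordinate sequences. -/
def ofCoord (φ : Fin 2 → lp (fun _ : Site => ℂ) 2) : StateSpace :=
  ⟨fun x => WithLp.toLp 2 fun i => φ i x, by
    have h : ∀ i, Memℓp (fun x => ‖φ i x‖) 2 := fun i => (lp.memℓp (φ i)).norm
    refine ((h 0).add (h 1)).mono' fun x => ?_
    rw [Pi.add_apply, Real.norm_of_nonneg (by positivity)]
    refine (sq_le_sq₀ (norm_nonneg _) (by positivity)).1 ?_
    rw [EuclideanSpace.norm_sq_eq, Fin.sum_univ_two]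
    nlinarith [norm_nonneg (φ 0 x), norm_nonneg (φ 1 x)]⟩

theorem coord_ofCoord (φ : Fin 2 → lp (fun _ : Site => ℂ) 2) (i : Fin 2) :
    coord (ofCoord φ) i = φ i := by
  ext x
  rfl

/-- Surjectivity of the Fourier transform; it lets bounded operators be defined by prescribing their
action on the Fourier side. -/
theorem exists_fourier_eq {g : (Fin 2 → ℝ) → Coin} (hg : MemLp g 2 (volume.restrict torus)) :
    ∃ Ψ : StateSpace, ∀ᵐ k ∂(volume.restrict torus), fourier Ψ k = g k := by
  have h1 : ∀ i, MemLp (fun y => g (waveNumber y) i) 2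
      (volume : Measure (UnitAddTorus (Fin 2))) := fun i => by
    have h2 := ((hg.eval_piLp i).comp_measurePreserving measurePreserving_waveNumber)
    have h3 := h2.smul_measure (c := (ENNReal.ofReal ((2 * Real.pi) ^ 2))⁻¹)
      (ENNReal.inv_ne_top.2 ofReal_two_pi_sq_ne_zero)
    rwa [smul_smul, ENNReal.inv_mul_cancel ofReal_two_pi_sq_ne_zero ENNReal.ofReal_ne_top,
      one_smul] at h3
  refine ⟨ofCoord fun i => UnitAddTorus.mFourierBasis.repr ((h1 i).toLp _), ?_⟩
  have h : ∀ i, ∀ᵐ k ∂(volume.restrict torus), fourier (ofCoord fun i =>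
      UnitAddTorus.mFourierBasis.repr ((h1 i).toLp _)) k i = g (waveNumber (torusPoint k)) i :=
    fun i => by
    refine ae_torusPoint (P := fun y => fourierL2 (coord _ i) y = g (waveNumber y) i) ?_
    rw [coord_ofCoord, fourierL2, LinearIsometryEquiv.symm_apply_apply]
    exact (h1 i).coeFn_toLp
  filter_upwards [ae_all_iff.2 h, ae_restrict_mem measurableSet_torus] with k hk hk'
  ext i
  rw [hk i, waveNumber_torusPoint hk']

/-- The translate is constructed on the Fourier side, as the coefficients of a character times the
transform of ψ; this gives square summability for free. -/
theorem exists_translate (ψ : lp (fun _ : Site => ℂ) 2) (m : Site) :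
    ∃ φ : lp (fun _ : Site => ℂ) 2, (∀ x, φ x = ψ (x - m)) ∧
      ∀ᵐ y ∂(volume : Measure (UnitAddTorus (Fin 2))),
        fourierL2 φ y = UnitAddTorus.mFourier m y * fourierL2 ψ y := by
  have h1 : MemLp (fun y => UnitAddTorus.mFourier m y * fourierL2 ψ y) 2
      (volume : Measure (UnitAddTorus (Fin 2))) := by
    refine (Lp.memLp (fourierL2 ψ)).of_le
      ((UnitAddTorus.mFourier m).continuous.aestronglyMeasurable.mul
        (Lp.aestronglyMeasurable _)) (Eventually.of_forall fun y => ?_)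
    rw [norm_mul]
    refine mul_le_of_le_one_left (norm_nonneg _) ?_
    exact ((UnitAddTorus.mFourier m).norm_coe_le_norm y).trans UnitAddTorus.mFourier_norm.le
  refine ⟨UnitAddTorus.mFourierBasis.repr (h1.toLp _), fun x => ?_, ?_⟩
  · have h2 : ψ = UnitAddTorus.mFourierBasis.repr (fourierL2 ψ) := by
      rw [fourierL2, LinearIsometryEquiv.apply_symm_apply]
    conv_rhs => rw [h2]
    rw [UnitAddTorus.mFourierBasis_repr, UnitAddTorus.mFourierBasis_repr,
      UnitAddTorus.mFourierCoeff, UnitAddTorus.mFourierCoeff]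
    refine integral_congr_ae ?_
    filter_upwards [h1.coeFn_toLp] with y hy
    rw [hy, smul_eq_mul, smul_eq_mul, ← mul_assoc, ← UnitAddTorus.mFourier_add]
    congr 3
    abel
  · rw [fourierL2, LinearIsometryEquiv.symm_apply_apply]
    exact h1.coeFn_toLp

theorem mFourier_torusPoint (m : Site) (k : Fin 2 → ℝ) :
    UnitAddTorus.mFourier m (torusPoint k) =
      Complex.exp (-(Complex.I * ((∑ q, m q * k q : ℝ) : ℂ))) := by
  have hpi : (Real.pi : ℂ) ≠ 0 := by simp [Real.pi_ne_zero]
  simp only [UnitAddTorus.mFourier, ContinuousMap.coe_mk, torusPoint, fourier_coe_apply,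
    Fin.prod_univ_two, Fin.sum_univ_two, ← Complex.exp_add]
  congr 1
  push_cast
  field_simp
  ring

theorem fourier_periodic (Ψ : StateSpace) (k : Fin 2 → ℝ) (n : Site) :
    fourier Ψ (fun q => k q + 2 * Real.pi * n q) = fourier Ψ k := by
  have hpi := Real.pi_ne_zero
  have h : torusPoint (fun q => k q + 2 * Real.pi * n q) = torusPoint k := by
    ext j
    have : -(k j + 2 * Real.pi * n j) / (2 * Real.pi) =
        -(k j) / (2 * Real.pi) + ((-n j : ℤ) : ℝ) * 1 := by
      push_cast
      field_simp
      ring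
    rw [torusPoint, torusPoint, this]
    rw [← zsmul_eq_mul, AddCircle.coe_add, AddCircle.coe_zsmul, AddCircle.coe_period,
      smul_zero, add_zero]
  ext i
  rw [fourier_apply, fourier_apply, h]

end FourierTransform

/-! ### The walk in Fourier space -/

section Walk

theorem shiftHat_mul (q : Fin 2) (k η : Fin 2 → ℝ) :
    shiftHat q k * shiftHat q η = shiftHat q (k + η) := by
  simp [shiftHat, mul_add, Complex.exp_add, add_comm]

/-- The application of a matrix at every site. -/
def siteOp (C : Matrix (Fin 2) (Fin 2) ℂ) (Ψ : Site → Coin) : Site → Coin :=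
  fun x => Matrix.toEuclideanLin C (Ψ x)

/-- One step of the walk with arbitrary coins. -/
def walkStep (C : Fin 2 → Matrix (Fin 2) (Fin 2) ℂ) (Ψ : Site → Coin) : Site → Coin :=
  shiftOp 1 (siteOp (C 1) (shiftOp 0 (siteOp (C 0) Ψ)))

/-- The symbol of `walkStep`. -/
def walkHat (C : Fin 2 → Matrix (Fin 2) (Fin 2) ℂ) (k : Fin 2 → ℝ) : Matrix (Fin 2) (Fin 2) ℂ :=
  shiftHat 1 k * C 1 * shiftHat 0 k * C 0

theorem stepOp_eq_walkStep (W : Params) : stepOp W = walkStep W.coinMatrix := rfl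

/-- The coins of the walk conjugated by a plane wave. -/
def twistedCoin (W : Params) (η : Fin 2 → ℝ) (q : Fin 2) : Matrix (Fin 2) (Fin 2) ℂ :=
  shiftHat q η * W.coinMatrix q

theorem walkHat_twistedCoin (W : Params) (η k : Fin 2 → ℝ) :
    walkHat (twistedCoin W η) k = stepHat W (k + η) := by
  simp only [walkHat, twistedCoin, stepHat, ← shiftHat_mul, Matrix.mul_assoc]

theorem exists_siteOp (C : Matrix (Fin 2) (Fin 2) ℂ) (Ψ : StateSpace) :
    ∃ Φ : StateSpace, (Φ : Site → Coin) = siteOp C Ψ ∧ ∀ᵐ k ∂(volume.restrict torus),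
      fourier Φ k = Matrix.toEuclideanLin C (fourier Ψ k) := by
  refine ⟨ofCoord fun i => ∑ j, C i j • coord Ψ j, ?_, ?_⟩
  · funext x
    ext i
    fin_cases i <;> simp [ofCoord, siteOp, toEuclideanLin_eq, coord, Fin.sum_univ_two] <;> rfl
  · have h : ∀ i, ∀ᵐ k ∂(volume.restrict torus),
        fourier (ofCoord fun i => ∑ j, C i j • coord Ψ j) k i =
          C i 0 • fourier Ψ k 0 + C i 1 • fourier Ψ k 1 := fun i => by
      refine ae_torusPoint (P := fun y => fourierL2 (coord _ i) y =
        C i 0 • fourierL2 (coord Ψ 0) y + C i 1 • fourierL2 (coord Ψ 1) y) ?_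
      rw [coord_ofCoord, fourierL2, Fin.sum_univ_two, map_add, map_smul, map_smul]
      filter_upwards [Lp.coeFn_add (C i 0 • fourierL2 (coord Ψ 0)) (C i 1 • fourierL2 (coord Ψ 1)),
        Lp.coeFn_smul (C i 0) (fourierL2 (coord Ψ 0)),
        Lp.coeFn_smul (C i 1) (fourierL2 (coord Ψ 1))] with y h1 h2 h3
      refine h1.trans ?_
      rw [Pi.add_apply, h2, h3]
      rfl
    filter_upwards [ae_all_iff.2 h] with k hk
    ext i
    rw [hk i]
    fin_cases i <;> simp [toEuclideanLin_eq]

theorem exists_shiftOp (q : Fin 2) (Ψ : StateSpace) :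
    ∃ Φ : StateSpace, (Φ : Site → Coin) = shiftOp q Ψ ∧ ∀ᵐ k ∂(volume.restrict torus),
      fourier Φ k = Matrix.toEuclideanLin (shiftHat q k) (fourier Ψ k) := by
  obtain ⟨φ0, h0, h0'⟩ := exists_translate (coord Ψ 0) (-Pi.single q 1)
  obtain ⟨φ1, h1, h1'⟩ := exists_translate (coord Ψ 1) (Pi.single q 1)
  refine ⟨ofCoord ![φ0, φ1], ?_, ?_⟩
  · funext x
    ext i
    fin_cases i
    · refine (h0 x).trans ?_
      rw [sub_neg_eq_add]
      rfl
    · exact h1 x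
  · have h2 := ae_torusPoint h0'
    have h3 := ae_torusPoint h1'
    filter_upwards [h2, h3] with k h2 h3
    rw [mFourier_torusPoint] at h2 h3
    ext i
    fin_cases i
    · simp only [fourier_apply, coord_ofCoord, toEuclideanLin_eq]
      simp only [Fin.zero_eta, Matrix.cons_val_zero, h2, ← fourier_apply]
      fin_cases q <;> simp [shiftHat, Matrix.mulVec, dotProduct, Fin.sum_univ_two]
    · simp only [fourier_apply, coord_ofCoord, toEuclideanLin_eq]
      simp only [Fin.mk_one, Matrix.cons_val_one, Matrix.cons_val_fin_one, h3, ← fourier_apply]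
      fin_cases q <;> simp [shiftHat, Matrix.mulVec, dotProduct, Fin.sum_univ_two]

theorem exists_walkStep (C : Fin 2 → Matrix (Fin 2) (Fin 2) ℂ) (Ψ : StateSpace) :
    ∃ Φ : StateSpace, (Φ : Site → Coin) = walkStep C Ψ ∧ ∀ᵐ k ∂(volume.restrict torus),
      fourier Φ k = Matrix.toEuclideanLin (walkHat C k) (fourier Ψ k) := by
  obtain ⟨Φ1, h1, h1'⟩ := exists_siteOp (C 0) Ψ
  obtain ⟨Φ2, h2, h2'⟩ := exists_shiftOp 0 Φ1
  obtain ⟨Φ3, h3, h3'⟩ := exists_siteOp (C 1) Φ2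
  obtain ⟨Φ4, h4, h4'⟩ := exists_shiftOp 1 Φ3
  refine ⟨Φ4, by rw [h4, h3, h2, h1, walkStep], ?_⟩
  filter_upwards [h1', h2', h3', h4'] with k h1 h2 h3 h4
  rw [h4, h3, h2, h1, walkHat, toEuclideanLin_mul, toEuclideanLin_mul, toEuclideanLin_mul]

theorem exists_iterate_walkStep (C : Fin 2 → Matrix (Fin 2) (Fin 2) ℂ) (Ψ : StateSpace) (t : ℕ) :
    ∃ Φ : StateSpace, (Φ : Site → Coin) = (walkStep C)^[t] Ψ ∧ ∀ᵐ k ∂(volume.restrict torus),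
      fourier Φ k = (Matrix.toEuclideanLin (walkHat C k))^[t] (fourier Ψ k) := by
  induction t with
  | zero => exact ⟨Ψ, rfl, Eventually.of_forall fun _ => rfl⟩
  | succ t ih =>
    obtain ⟨Φ, h1, h2⟩ := ih
    obtain ⟨Φ', h3, h4⟩ := exists_walkStep C Φ
    refine ⟨Φ', by rw [h3, h1, Function.iterate_succ_apply'], ?_⟩
    filter_upwards [h2, h4] with k h2 h4
    rw [h4, h2, Function.iterate_succ_apply']

/-- Multiplication by a plane wave. -/
def planeWave (ζ : Fin 2 → ℝ) (Ψ : Site → Coin) : Site → Coin :=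
  fun x => Complex.exp (Complex.I * ((∑ q, ζ q * (x q : ℝ) : ℝ) : ℂ)) • Ψ x

theorem planeWave_siteOp (ζ : Fin 2 → ℝ) (C : Matrix (Fin 2) (Fin 2) ℂ) (Ψ : Site → Coin) :
    planeWave ζ (siteOp C Ψ) = siteOp C (planeWave ζ Ψ) := by
  funext x
  rw [planeWave, siteOp, siteOp, planeWave, map_smul]

/-- Moving the wave past a shift by ±e_q costs the phase e^{∓iζ_q}, a diagonal matrix that can be
absorbed into the preceding coin. -/
theorem planeWave_shiftOp (ζ : Fin 2 → ℝ) (q : Fin 2) (Ψ : Site → Coin) :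
    planeWave ζ (shiftOp q Ψ) = shiftOp q (siteOp (shiftHat q (-ζ)) (planeWave ζ Ψ)) := by
  funext x
  ext i
  fin_cases i
  · simp only [planeWave, shiftOp, siteOp, toEuclideanLin_eq, shiftHat, PiLp.smul_apply]
    simp [Matrix.mulVec, dotProduct, Fin.sum_univ_two, ← mul_assoc, ← Complex.exp_add]
    left
    congr 1
    fin_cases q <;> simp <;> ring
  · simp only [planeWave, shiftOp, siteOp, toEuclideanLin_eq, shiftHat, PiLp.smul_apply]
    simp [Matrix.mulVec, dotProduct, Fin.sum_univ_two, ← mul_assoc, ← Complex.exp_add]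
    left
    congr 1
    fin_cases q <;> simp <;> ring

theorem siteOp_mul (C D : Matrix (Fin 2) (Fin 2) ℂ) (Ψ : Site → Coin) :
    siteOp (C * D) Ψ = siteOp C (siteOp D Ψ) := by
  funext x
  exact toEuclideanLin_mul C D (Ψ x)

/-- The translation of the wave number by -ζ is performed on the coins, in position space. By
`walkHat_twistedCoin` the new symbol is Û(k - ζ), and no L² class ever has to be translated by a
non-lattice amount. -/
theorem planeWave_iterate_stepOp (W : Params) (ζ : Fin 2 → ℝ) (Ψ : Site → Coin) (t : ℕ) :
    planeWave ζ ((stepOp W)^[t] Ψ) = (walkStep (twistedCoin W (-ζ)))^[t] (planeWave ζ Ψ) := by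
  refine (Function.Semiconj.iterate_right (f := planeWave ζ) (fun Φ => ?_) t) Ψ
  rw [stepOp_eq_walkStep, walkStep, planeWave_shiftOp, planeWave_siteOp, planeWave_shiftOp,
    planeWave_siteOp, walkStep, twistedCoin, twistedCoin, siteOp_mul, siteOp_mul]

/-! ### Convergence of the characteristic functions -/

theorem hasSum_norm_sq (Ψ : StateSpace) : HasSum (fun x => ‖Ψ x‖ ^ 2) (‖Ψ‖ ^ 2) := by
  have := lp.hasSum_norm (p := 2) (by norm_num) Ψ
  simpa using this

theorem exists_planeWave (ζ : Fin 2 → ℝ) (Ψ : StateSpace) :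
    ∃ Φ : StateSpace, (Φ : Site → Coin) = planeWave ζ Ψ := by
  refine ⟨⟨planeWave ζ Ψ, (lp.memℓp Ψ).mono' fun x => ?_⟩, rfl⟩
  rw [planeWave, norm_smul, mul_comm Complex.I, Complex.norm_exp_ofReal_mul_I, one_mul]

theorem tendsto_norm_planeWave_sub (ξ : Fin 2 → ℝ) (Ψ : StateSpace) (Φ : ℕ → StateSpace)
    (hΦ : ∀ t : ℕ, (Φ t : Site → Coin) = planeWave ((t : ℝ)⁻¹ • ξ) Ψ) :
    Tendsto (fun t => ‖Φ t - Ψ‖) atTop (𝓝 0) := by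
  have h1 : ∀ t, ‖Φ t - Ψ‖ ^ 2 = ∑' x, ‖(Φ t - Ψ) x‖ ^ 2 := fun t =>
    (hasSum_norm_sq _).tsum_eq.symm
  have h2 : ∀ t x, ‖(Φ t - Ψ) x‖ = ‖Complex.exp (Complex.I *
      ((∑ q, ((t : ℝ)⁻¹ • ξ) q * (x q : ℝ) : ℝ) : ℂ)) - 1‖ * ‖Ψ x‖ := fun t x => by
    rw [lp.coeFn_sub, Pi.sub_apply, hΦ, planeWave, ← norm_smul, sub_smul, one_smul]
  have h3 : Tendsto (fun t => ‖Φ t - Ψ‖ ^ 2) atTop (𝓝 (∑' _ : Site, (0 : ℝ))) := by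
    simp only [h1]
    -- The constant is 4 = 2², from |e^{iθ} - 1| ≤ 2.
    refine tendsto_tsum_of_dominated_convergence (bound := fun x => 4 * ‖Ψ x‖ ^ 2)
      ((hasSum_norm_sq Ψ).summable.mul_left 4) (fun x => ?_) (Eventually.of_forall fun t x => ?_)
    · have h4 : Tendsto (fun t : ℕ => ∑ q, ((t : ℝ)⁻¹ • ξ) q * (x q : ℝ)) atTop (𝓝 0) := by
        have := tendsto_finsetSum (Finset.univ : Finset (Fin 2)) fun q _ =>
          ((tendsto_inv_atTop_nhds_zero_nat (𝕜 := ℝ)).mul_const (ξ q)).mul_const (x q : ℝ)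
        simpa using this
      have h5 := ((((h4.ofReal).const_mul Complex.I).cexp.sub_const 1).norm.mul_const
        ‖Ψ x‖).pow 2
      simp only [h2]
      simpa using h5
    · rw [h2, norm_pow, norm_mul, norm_norm, norm_norm, mul_pow]
      refine mul_le_mul_of_nonneg_right ?_ (by positivity)
      have := norm_sub_le (Complex.exp (Complex.I *
        ((∑ q, ((t : ℝ)⁻¹ • ξ) q * (x q : ℝ) : ℝ) : ℂ))) 1
      rw [mul_comm Complex.I, Complex.norm_exp_ofReal_mul_I, norm_one] at this
      rw [mul_comm Complex.I]
      nlinarith [norm_nonneg (Complex.exp (((∑ q, ((t : ℝ)⁻¹ • ξ) q * (x q : ℝ) : ℝ) : ℂ)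
        * Complex.I) - 1)]
  rw [tsum_zero] at h3
  have := h3.sqrt
  simpa using this

variable {W : Params} {e : (Fin 2 → ℝ) → OrthonormalBasis (Fin 2) ℂ Coin}

theorem norm_eq_of_fourier_iterate (ha : 0 < W.a) (hb : 0 < W.b) (hab : W.a + W.b = 1)
    (he : IsEigenframe W e) {Φ Ψ : StateSpace} (η : Fin 2 → ℝ) (t : ℕ)
    (h : ∀ᵐ k ∂(volume.restrict torus),
      fourier Φ k = (Matrix.toEuclideanLin (stepHat W (k + η)))^[t] (fourier Ψ k)) :
    ‖Φ‖ = ‖Ψ‖ := by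
  rw [← sq_eq_sq₀ (norm_nonneg _) (norm_nonneg _), norm_sq_eq_integral, norm_sq_eq_integral]
  congr 1
  refine integral_congr_ae ?_
  filter_upwards [h] with k hk
  rw [hk, norm_iterate_stepHat ha hb hab he]

theorem exists_evolved (ha : 0 < W.a) (hb : 0 < W.b) (hab : W.a + W.b = 1)
    (he : IsEigenframe W e) (Ψ₀ : StateSpace) (t : ℕ) :
    ∃ Φ : StateSpace, (Φ : Site → Coin) = evolved W Ψ₀ t ∧ ‖Φ‖ = ‖Ψ₀‖ ∧
      ∀ᵐ k ∂(volume.restrict torus),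
        fourier Φ k = (Matrix.toEuclideanLin (stepHat W k))^[t] (fourier Ψ₀ k) := by
  obtain ⟨Φ, h1, h2⟩ := exists_iterate_walkStep W.coinMatrix Ψ₀ t
  refine ⟨Φ, h1, ?_, h2⟩
  refine norm_eq_of_fourier_iterate ha hb hab he 0 t ?_
  simp only [add_zero]
  exact h2

theorem isProbabilityMeasure_positionLaw (ha : 0 < W.a) (hb : 0 < W.b) (hab : W.a + W.b = 1)
    (he : IsEigenframe W e) {Ψ₀ : StateSpace} (hΨ₀ : ‖Ψ₀‖ = 1) (t : ℕ) :
    IsProbabilityMeasure (positionLaw W Ψ₀ t) := by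
  obtain ⟨Φ, h1, h2, -⟩ := exists_evolved ha hb hab he Ψ₀ t
  refine ⟨?_⟩
  have h3 := hasSum_norm_sq Φ
  rw [positionLaw, Measure.sum_apply _ MeasurableSet.univ, ← h1]
  simp only [Measure.smul_apply, measure_univ, smul_eq_mul, mul_one]
  rw [← ENNReal.ofReal_tsum_of_nonneg (fun _ => by positivity) h3.summable, h3.tsum_eq, h2, hΨ₀]
  simp

theorem positionLaw_real_singleton (Ψ₀ : StateSpace) (t : ℕ) (x : Site) :
    (positionLaw W Ψ₀ t).real {x} = ‖evolved W Ψ₀ t x‖ ^ 2 := by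
  rw [measureReal_def, positionLaw, Measure.sum_apply _ (measurableSet_singleton x),
    tsum_eq_single x]
  · simp
  · intro y hy
    simp [hy]

theorem positionCharFun_eq_inner (ha : 0 < W.a) (hb : 0 < W.b) (hab : W.a + W.b = 1)
    (he : IsEigenframe W e) {Ψ₀ : StateSpace} (hΨ₀ : ‖Ψ₀‖ = 1) (t : ℕ) (ξ : Fin 2 → ℝ)
    {Φ Φ' : StateSpace} (hΦ : (Φ : Site → Coin) = evolved W Ψ₀ t)
    (hΦ' : (Φ' : Site → Coin) = planeWave ((t : ℝ)⁻¹ • ξ) Φ) :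
    positionCharFun W Ψ₀ t ξ = inner ℂ Φ Φ' := by
  have := isProbabilityMeasure_positionLaw ha hb hab he hΨ₀ t
  have hint : Integrable (fun x : Site =>
      Complex.exp (Complex.I * ((∑ q, ξ q * ((x q : ℝ) / (t : ℝ)) : ℝ) : ℂ)))
      (positionLaw W Ψ₀ t) := by
    refine Integrable.of_bound (Measurable.of_discrete).aestronglyMeasurable 1
      (Eventually.of_forall fun x => ?_)
    rw [mul_comm Complex.I, Complex.norm_exp_ofReal_mul_I]
  rw [positionCharFun, integral_countable hint, lp.inner_eq_tsum]
  refine tsum_congr fun x => ?_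
  rw [positionLaw_real_singleton, hΦ', planeWave, inner_smul_right, inner_self_eq_norm_sq_to_K,
    ← hΦ, Complex.real_smul, mul_comm]
  congr 1
  · have : ∑ q, ξ q * ((x q : ℝ) / (t : ℝ)) = ∑ q, ((t : ℝ)⁻¹ • ξ) q * (x q : ℝ) :=
      Finset.sum_congr rfl fun q _ => by
        rw [Pi.smul_apply, smul_eq_mul]
        ring
    rw [this]
  · push_cast
    rfl

/-- Sum-to-product separates the two coordinates, so the zero set of c lies on countably many
coordinate lines and is null. -/
theorem csum_eq (W : Params) (k : Fin 2 → ℝ) :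
    csum W k = 2 * Real.cos (k 1 + (W.α 1 + W.α 0 + W.β 1 - W.β 0) / 2) *
      Real.cos (k 0 + (W.α 1 + W.α 0 - W.β 1 + W.β 0) / 2) := by
  rw [csum, Real.cos_add_cos, ell₁, ell₂]
  congr 3 <;> ring

theorem ae_cos_coord_ne_zero (q : Fin 2) (c : ℝ) :
    ∀ᵐ k : Fin 2 → ℝ, Real.cos (k q + c) ≠ 0 := by
  have h : ∀ n : ℤ, ∀ᵐ k : Fin 2 → ℝ, k q ≠ (2 * n + 1) * Real.pi / 2 - c := fun n =>
    Measure.ae_eval_ne (fun _ => volume) q _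
  filter_upwards [ae_all_iff.2 h] with k hk h0
  obtain ⟨n, hn⟩ := Real.cos_eq_zero_iff.1 h0
  exact hk n (by linarith)

theorem ae_csum_ne_zero (W : Params) : ∀ᵐ k : Fin 2 → ℝ, csum W k ≠ 0 := by
  filter_upwards [ae_cos_coord_ne_zero 1 ((W.α 1 + W.α 0 + W.β 1 - W.β 0) / 2),
    ae_cos_coord_ne_zero 0 ((W.α 1 + W.α 0 - W.β 1 + W.β 0) / 2)] with k h1 h2
  rw [csum_eq]
  exact mul_ne_zero (mul_ne_zero two_ne_zero h1) h2

theorem ae_tau_sq_lt_one (ha : 0 < W.a) (hb : 0 < W.b) (hab : W.a + W.b = 1) :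
    ∀ᵐ k : Fin 2 → ℝ, tau W k ^ 2 < 1 := by
  filter_upwards [ae_csum_ne_zero W] with k hk
  exact tau_sq_lt_one ha hb hab hk

/-- Split e^{iξ·x/t} Ψ₀ into Ψ₀ and a remainder of vanishing norm. The twisted walk keeps the
remainder small by unitarity; the main part converges pointwise in k and is dominated by ‖Ψ̂₀(k)‖².
-/
theorem tendsto_positionCharFun (ha : 0 < W.a) (hb : 0 < W.b) (hab : W.a + W.b = 1)
    (he : IsEigenframe W e) {Ψ₀ : StateSpace} (hΨ₀ : ‖Ψ₀‖ = 1) (ξ : Fin 2 → ℝ) :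
    Tendsto (fun t : ℕ => positionCharFun W Ψ₀ t ξ) atTop
      (𝓝 (((2 * Real.pi : ℂ) ^ 2)⁻¹ * ∫ k in torus, ∑ p,
        Complex.exp (Complex.I * ((∑ q, ξ q * vel W p k q : ℝ) : ℂ)) *
          (weightP Ψ₀ e p k : ℂ))) := by
  choose Ψ hΨ hΨn hΨf using exists_evolved ha hb hab he Ψ₀
  choose Θ hΘ using fun t : ℕ => exists_planeWave ((t : ℝ)⁻¹ • ξ) Ψ₀
  choose Φ₁ hΦ₁ hΦ₁f using fun t : ℕ =>
    exists_iterate_walkStep (twistedCoin W (-((t : ℝ)⁻¹ • ξ))) Ψ₀ t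
  choose Φ₂ hΦ₂ hΦ₂f using fun t : ℕ =>
    exists_iterate_walkStep (twistedCoin W (-((t : ℝ)⁻¹ • ξ))) (Θ t - Ψ₀) t
  have hshift : ∀ (t : ℕ) (k : Fin 2 → ℝ), walkHat (twistedCoin W (-((t : ℝ)⁻¹ • ξ))) k =
      stepHat W (k + (t : ℝ)⁻¹ • -ξ) := fun t k => by rw [walkHat_twistedCoin, smul_neg]
  simp only [hshift] at hΦ₁f hΦ₂f
  -- Linearity of the twisted evolution, checked on the Fourier side: the evolved Ψ₀ and the evolved
  -- remainder add up to the plane wave times Ψ_t.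
  have hsum : ∀ t : ℕ, ((Φ₁ t + Φ₂ t : StateSpace) : Site → Coin) =
      planeWave ((t : ℝ)⁻¹ • ξ) (Ψ t) := by
    intro t
    obtain ⟨Φ, h1, h2⟩ := exists_iterate_walkStep (twistedCoin W (-((t : ℝ)⁻¹ • ξ))) (Θ t) t
    rw [hΨ, evolved, planeWave_iterate_stepOp, ← hΘ, ← h1]
    congr 1
    refine fourier_injective ?_
    have h3 := fourier_add (Θ t - Ψ₀) Ψ₀
    rw [sub_add_cancel] at h3
    filter_upwards [h2, h3, fourier_add (Φ₁ t) (Φ₂ t), hΦ₁f t, hΦ₂f t] with k h2 h3 h4 h5 h6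
    rw [h2, h4, h5, h6, hshift, h3, iterate_map_add, add_comm]
  have hchar : ∀ t, positionCharFun W Ψ₀ t ξ = inner ℂ (Ψ t) (Φ₁ t) + inner ℂ (Ψ t) (Φ₂ t) :=
    fun t => by
      rw [positionCharFun_eq_inner ha hb hab he hΨ₀ t ξ (hΨ t) (hsum t), inner_add_right]
  have h2 : Tendsto (fun t => inner ℂ (Ψ t) (Φ₂ t)) atTop (𝓝 0) := by
    refine squeeze_zero_norm (fun t => ?_) (tendsto_norm_planeWave_sub ξ Ψ₀ Θ hΘ)
    refine (norm_inner_le_norm _ _).trans ?_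
    rw [hΨn, hΨ₀, one_mul, norm_eq_of_fourier_iterate ha hb hab he _ t (hΦ₂f t)]
  have h1 : Tendsto (fun t => inner ℂ (Ψ t) (Φ₁ t)) atTop
      (𝓝 (((2 * Real.pi : ℂ) ^ 2)⁻¹ * ∫ k in torus, ∑ p,
        Complex.exp (Complex.I * ((∑ q, ξ q * vel W p k q : ℝ) : ℂ)) *
          (weightP Ψ₀ e p k : ℂ))) := by
    simp only [inner_eq_integral]
    refine Tendsto.const_mul _ ?_
    refine tendsto_integral_of_dominated_convergence (fun k => ‖fourier Ψ₀ k‖ ^ 2)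
      (fun t => (integrable_inner_of_memLp (memLp_fourier _)
        (memLp_fourier _)).aestronglyMeasurable) ?_ (fun t => ?_) ?_
    · exact (memLp_fourier Ψ₀).integrable_norm_pow (by norm_num)
    · filter_upwards [hΨf t, hΦ₁f t] with k h1 h2
      refine (norm_inner_le_norm _ _).trans ?_
      rw [h1, h2, norm_iterate_stepHat ha hb hab he, norm_iterate_stepHat ha hb hab he, sq]
    · filter_upwards [ae_all_iff.2 hΨf, ae_all_iff.2 hΦ₁f,
        ae_restrict_of_ae (ae_tau_sq_lt_one ha hb hab)] with k h1 h2 h3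
      simp only [h1, h2]
      exact tendsto_inner_iterate ha hb hab he h3 ξ (fourier Ψ₀ k)
  simp only [hchar]
  simpa using h1.add h2

end Walk

/-! ### Change of variables -/

section ChangeOfVariables

variable {W : Params} {e : (Fin 2 → ℝ) → OrthonormalBasis (Fin 2) ℂ Coin}

/-- The derivative of the velocity map. -/
def velDeriv (W : Params) (p : Fin 2) (k : Fin 2 → ℝ) : (Fin 2 → ℝ) →L[ℝ] (Fin 2 → ℝ) :=
  ContinuousLinearMap.pi fun q => (-1 : ℝ) ^ (p : ℕ) •
    ((√(1 - tau W k ^ 2))⁻¹ • hessTau W k q +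
      (dtau W k q * tau W k / ((1 - tau W k ^ 2) * √(1 - tau W k ^ 2))) •
        ∑ r, dtau W k r • ContinuousLinearMap.proj (R := ℝ) (φ := fun _ : Fin 2 => ℝ) r)

theorem hasFDerivAt_vel (ha : 0 < W.a) (hb : 0 < W.b) (hab : W.a + W.b = 1) (p : Fin 2)
    {k : Fin 2 → ℝ} (hk : tau W k ^ 2 < 1) : HasFDerivAt (vel W p) (velDeriv W p k) k := by
  have hD : 0 < 1 - tau W k ^ 2 := by linarith
  have hS : √(1 - tau W k ^ 2) ≠ 0 := (Real.sqrt_pos.2 hD).ne'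
  have hS2 : √(1 - tau W k ^ 2) ^ 2 = 1 - tau W k ^ 2 := Real.sq_sqrt hD.le
  have heq : vel W p = fun k q => (-1) ^ (p : ℕ) * (dtau W k q / √(1 - tau W k ^ 2)) := by
    funext k q
    exact vel_eq ha hb hab p k q
  rw [heq, hasFDerivAt_pi']
  intro q
  have h1 := (((hasFDerivAt_tau W k).pow 2).const_sub 1).sqrt hD.ne'
  have h2 := ((hasFDerivAt_dtau W k q).mul
    ((hasDerivAt_inv hS).comp_hasFDerivAt k h1)).const_mul ((-1 : ℝ) ^ (p : ℕ))
  refine h2.congr_fderiv ?_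
  ext v
  simp [velDeriv, Fin.sum_univ_two]
  generalize √(1 - tau W k ^ 2) = S at hS hS2 ⊢
  rw [← hS2]
  field_simp
  ring

/-- Up to sign the derivative is D^{-1/2} (H + (τ/D) g gᵀ), with g the gradient and H the Hessian of
τ. The rank-one formula gives D⁻¹ (det H + (τ/D) gᵀ adj(H) g); `key` is D² times this. In absolute
value it agrees with `speed_prod_vel`. -/
theorem det_velDeriv (hab : W.a + W.b = 1) (p : Fin 2) {k : Fin 2 → ℝ} (hk : tau W k ^ 2 < 1) :
    (velDeriv W p k).det = -(2 * W.a * W.b * csum W k / (1 - tau W k ^ 2)) ^ 2 := by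
  have hD : 0 < 1 - tau W k ^ 2 := by linarith
  have hS : √(1 - tau W k ^ 2) ≠ 0 := (Real.sqrt_pos.2 hD).ne'
  have hS2 : √(1 - tau W k ^ 2) ^ 2 = 1 - tau W k ^ 2 := Real.sq_sqrt hD.le
  have h1 := Real.sin_sq_add_cos_sq (ell₁ W k)
  have h2 := Real.sin_sq_add_cos_sq (ell₂ W k)
  have hb' : W.b = 1 - W.a := by linarith
  have key : (tau W k ^ 2 - tauMixed W k ^ 2) * (1 - tau W k ^ 2) +
      tau W k * (-tau W k * (dtau W k 0 ^ 2 + dtau W k 1 ^ 2) -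
        2 * tauMixed W k * (dtau W k 0 * dtau W k 1)) = -(2 * W.a * W.b * csum W k) ^ 2 := by
    have e1 : dtau W k 0 ^ 2 + dtau W k 1 ^ 2 = 2 * W.a ^ 2 * (1 - Real.cos (ell₁ W k) ^ 2) +
        2 * W.b ^ 2 * (1 - Real.cos (ell₂ W k) ^ 2) := by
      rw [← Real.sin_sq, ← Real.sin_sq]
      simp [dtau]
      ring
    have e2 : dtau W k 0 * dtau W k 1 = W.a ^ 2 * (1 - Real.cos (ell₁ W k) ^ 2) -
        W.b ^ 2 * (1 - Real.cos (ell₂ W k) ^ 2) := by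
      rw [← Real.sin_sq, ← Real.sin_sq]
      simp [dtau]
      ring
    rw [e1, e2, tau, tauMixed, csum, hb']
    ring
  rw [div_pow, neg_div', ← key, ContinuousLinearMap.det, ← LinearMap.det_toMatrix',
    Matrix.det_fin_two]
  simp only [LinearMap.toMatrix'_apply, velDeriv, hessTau, Fin.sum_univ_two]
  simp
  generalize √(1 - tau W k ^ 2) = S at hS hS2 ⊢
  rw [← hS2]
  fin_cases p <;> simp <;> field_simp <;> ring

/-- The part of the fundamental domain where `cos l₁ + cos l₂` has the sign `(-1)^i` and
`k₁ < 0` (for `j = 0`) or `k₁ ≥ 0` (for `j = 1`). -/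
def piece (W : Params) (i j : Fin 2) : Set (Fin 2 → ℝ) :=
  {k | k ∈ torus ∧ 0 < (-1) ^ (i : ℕ) * csum W k ∧ (j = 0 ↔ k 0 < 0)}

theorem continuous_csum : Continuous (csum W) := by
  unfold csum ell₁ ell₂
  fun_prop

theorem measurableSet_piece (i j : Fin 2) : MeasurableSet (piece W i j) := by
  have h1 : MeasurableSet {k : Fin 2 → ℝ | 0 < (-1) ^ (i : ℕ) * csum W k} :=
    measurableSet_lt measurable_const (continuous_csum.measurable.const_mul _)
  have h2 : MeasurableSet {k : Fin 2 → ℝ | j = 0 ↔ k 0 < 0} :=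
    MeasurableSet.iff (MeasurableSet.const _)
      (measurableSet_lt (measurable_pi_apply 0) measurable_const)
  exact measurableSet_torus.inter (h1.inter h2)

/-! ### Injectivity of the velocity map on the four pieces -/

theorem exists_int_of_cos_sin {x y : ℝ} (hc : Real.cos x = Real.cos y)
    (hs : Real.sin x = Real.sin y) : ∃ n : ℤ, x - y = 2 * Real.pi * n :=
  Real.Angle.angle_eq_iff_two_pi_dvd_sub.1 (Real.Angle.cos_sin_inj hc hs)

theorem exists_int_of_cos_sin_ell {k k' : Fin 2 → ℝ}
    (hc₁ : Real.cos (ell₁ W k) = Real.cos (ell₁ W k'))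
    (hs₁ : Real.sin (ell₁ W k) = Real.sin (ell₁ W k'))
    (hc₂ : Real.cos (ell₂ W k) = Real.cos (ell₂ W k'))
    (hs₂ : Real.sin (ell₂ W k) = Real.sin (ell₂ W k')) :
    ∃ m n : ℤ, k 0 - k' 0 = Real.pi * (m - n : ℤ) ∧ k 1 - k' 1 = Real.pi * (m + n : ℤ) := by
  obtain ⟨m, hm⟩ := exists_int_of_cos_sin hc₁ hs₁
  obtain ⟨n, hn⟩ := exists_int_of_cos_sin hc₂ hs₂
  refine ⟨m, n, ?_, ?_⟩
  · push_cast
    simp only [ell₁, ell₂] at hm hn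
    linarith
  · push_cast
    simp only [ell₁, ell₂] at hm hn
    linarith

theorem eq_trig_of_vel_eq (ha : 0 < W.a) (hb : 0 < W.b) (hab : W.a + W.b = 1) {p : Fin 2}
    {k k' : Fin 2 → ℝ} {ε : ℝ} (hε : ε ^ 2 = 1) (hk : 0 < ε * csum W k) (hk' : 0 < ε * csum W k')
    (h : vel W p k = vel W p k') :
    (Real.cos (ell₁ W k) = Real.cos (ell₁ W k') ∧ Real.sin (ell₁ W k) = Real.sin (ell₁ W k')) ∧
      Real.cos (ell₂ W k) = Real.cos (ell₂ W k') ∧ Real.sin (ell₂ W k) = Real.sin (ell₂ W k') := by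
  have hc₁ : Real.cos (ell₁ W k) = Real.cos (ell₁ W k') := by
    rw [← branchC₁_vel ha hb hab p hε hk, ← branchC₁_vel ha hb hab p hε hk', h]
  have hc₂ : Real.cos (ell₂ W k) = Real.cos (ell₂ W k') := by
    rw [← branchC₂_vel ha hb hab p hε hk, ← branchC₂_vel ha hb hab p hε hk', h]
  have hτ : tau W k = tau W k' := by rw [tau, tau, hc₁, hc₂]
  have hD : √(1 - tau W k' ^ 2) ≠ 0 := (Real.sqrt_pos.2 (by
    linarith [tau_sq_lt_one ha hb hab (right_ne_zero_of_mul hk'.ne')])).ne'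
  have hp : (-1 : ℝ) ^ (p : ℕ) ≠ 0 := by simp
  refine ⟨⟨hc₁, ?_⟩, hc₂, ?_⟩
  · have h1 := vel_add ha hb hab p k
    rw [h, vel_add ha hb hab p k', hτ] at h1
    have h2 := (div_left_inj' hD).1 (mul_left_cancel₀ hp h1)
    exact (mul_left_cancel₀ (by simp [ha.ne']) h2).symm
  · have h1 := vel_sub ha hb hab p k
    rw [h, vel_sub ha hb hab p k', hτ] at h1
    have h2 := (div_left_inj' hD).1 (mul_left_cancel₀ hp h1)
    exact (mul_left_cancel₀ (by simp [hb.ne']) h2).symm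

/-- Two preimages with the same sign of c differ by π(m - n, m + n). Lying in the same half of the
torus forces m = n; the second difference is then 2πm and smaller than 2π in absolute value, so m =
0. -/
theorem injOn_vel_piece (ha : 0 < W.a) (hb : 0 < W.b) (hab : W.a + W.b = 1) (p i j : Fin 2) :
    Set.InjOn (vel W p) (piece W i j) := by
  rintro k ⟨hk, hk1, hk2⟩ k' ⟨hk', hk1', hk2'⟩ h
  obtain ⟨⟨h1, h2⟩, h3, h4⟩ := eq_trig_of_vel_eq ha hb hab (neg_one_pow_sq i) hk1 hk1' h
  obtain ⟨m, n, h5, h6⟩ := exists_int_of_cos_sin_ell h1 h2 h3 h4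
  have hpi := Real.pi_pos
  have hk0 : k 0 ∈ Set.Ico (-Real.pi) Real.pi := hk 0 (Set.mem_univ 0)
  have hk0' : k' 0 ∈ Set.Ico (-Real.pi) Real.pi := hk' 0 (Set.mem_univ 0)
  have hk1 : k 1 ∈ Set.Ico (-Real.pi) Real.pi := hk 1 (Set.mem_univ 1)
  have hk1' : k' 1 ∈ Set.Ico (-Real.pi) Real.pi := hk' 1 (Set.mem_univ 1)
  have h7 : |k 0 - k' 0| < Real.pi := by
    have h8 := hk2.symm.trans hk2'
    rw [abs_lt]
    by_cases h9 : k 0 < 0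
    · have := h8.1 h9
      constructor <;> linarith [hk0.1, hk0'.1]
    · have : ¬ k' 0 < 0 := fun h => h9 (h8.2 h)
      constructor <;> linarith [hk0.2, hk0'.2]
  have h8 : m - n = 0 := by
    rw [h5, abs_mul, abs_of_pos hpi, mul_lt_iff_lt_one_right hpi, ← Int.cast_abs] at h7
    exact Int.abs_lt_one_iff.1 (by exact_mod_cast h7)
  have h9 : |k 1 - k' 1| < 2 * Real.pi := by
    rw [abs_lt]
    constructor <;> linarith [hk1.1, hk1'.1, hk1.2, hk1'.2]
  have h10 : m + n = 0 := by
    rw [h6, abs_mul, abs_of_pos hpi, mul_comm, mul_lt_mul_iff_left₀ hpi, ← Int.cast_abs] at h9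
    have : |m + n| < 2 := by exact_mod_cast h9
    rw [abs_lt] at this
    omega
  ext q
  fin_cases q
  · rw [h8] at h5
    simp at h5 ⊢
    linarith
  · rw [h10] at h6
    simp at h6 ⊢
    linarith

/-- The contribution of one piece of the fundamental domain to `weightW`. -/
def pieceWeight (W : Params) (Ψ₀ : StateSpace)
    (e : (Fin 2 → ℝ) → OrthonormalBasis (Fin 2) ℂ Coin) (p i j : Fin 2) (v : Fin 2 → ℝ) : ℝ :=
  ∑ᶠ k ∈ {k | k ∈ piece W i j ∧ vel W p k = v}, weightP Ψ₀ e p k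

theorem pieceWeight_vel (ha : 0 < W.a) (hb : 0 < W.b) (hab : W.a + W.b = 1) (Ψ₀ : StateSpace)
    {p i j : Fin 2} {k : Fin 2 → ℝ} (hk : k ∈ piece W i j) :
    pieceWeight W Ψ₀ e p i j (vel W p k) = weightP Ψ₀ e p k := by
  have : {k' | k' ∈ piece W i j ∧ vel W p k' = vel W p k} = {k} := by
    ext k'
    exact ⟨fun h => injOn_vel_piece ha hb hab p i j h.1 hk h.2, fun h => by
      rw [Set.mem_singleton_iff] at h
      rw [h]
      exact ⟨hk, rfl⟩⟩
  rw [pieceWeight, this, finsum_mem_singleton]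

theorem pieceWeight_eq_zero (Ψ₀ : StateSpace) {p i j : Fin 2} {v : Fin 2 → ℝ}
    (hv : v ∉ vel W p '' piece W i j) : pieceWeight W Ψ₀ e p i j v = 0 := by
  have : {k | k ∈ piece W i j ∧ vel W p k = v} = ∅ :=
    Set.eq_empty_of_forall_notMem fun k hk => hv ⟨k, hk.1, hk.2⟩
  rw [pieceWeight, this, finsum_mem_empty]

theorem mem_iUnion_piece {k : Fin 2 → ℝ} (hk : k ∈ torus) (hc : csum W k ≠ 0) :
    ∃ i : Fin 2 × Fin 2, k ∈ piece W i.1 i.2 := by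
  by_cases h0 : k 0 < 0
  · rcases hc.lt_or_gt with h | h
    · exact ⟨(1, 0), hk, by simpa using h, by simpa using h0⟩
    · exact ⟨(0, 0), hk, by simpa using h, by simpa using h0⟩
  · rcases hc.lt_or_gt with h | h
    · exact ⟨(1, 1), hk, by simpa using h, by simpa using h0⟩
    · exact ⟨(0, 1), hk, by simpa using h, by simpa using h0⟩

theorem pairwise_disjoint_piece :
    Pairwise (Function.onFun Disjoint fun i : Fin 2 × Fin 2 => piece W i.1 i.2) := by
  rintro ⟨i, j⟩ ⟨i', j'⟩ hne
  rw [Function.onFun, Set.disjoint_left]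
  rintro k ⟨-, h1, h2⟩ ⟨-, h1', h2'⟩
  apply hne
  have hj : j = j' := by
    have := h2.trans h2'.symm
    revert this
    fin_cases j <;> fin_cases j' <;> simp
  have hi : i = i' := by
    fin_cases i <;> fin_cases i' <;> simp at h1 h1' ⊢ <;> linarith
  rw [hi, hj]

/-- A wave number with c = 0 either is degenerate, with velocity 0, or has v₁² = 1 or v₂² = 1 by
`speed_prod_vel`. The velocities excluded here form a null set. -/
theorem csum_ne_zero_of_vel (ha : 0 < W.a) (hb : 0 < W.b) (hab : W.a + W.b = 1) {p : Fin 2}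
    {k : Fin 2 → ℝ} (h0 : vel W p k ≠ 0) (h1 : vel W p k 0 ^ 2 ≠ 1) (h2 : vel W p k 1 ^ 2 ≠ 1) :
    csum W k ≠ 0 := by
  intro hc
  have hk : tau W k ^ 2 < 1 := by
    by_contra hk
    exact h0 (vel_eq_zero_of_tau_sq ha hb hab p hk)
  have h := speed_prod_vel ha hb hab p hk
  rw [hc, mul_zero, zero_div, zero_pow two_ne_zero, mul_eq_zero, sub_eq_zero, sub_eq_zero] at h
  rcases h with h | h
  · exact h1 h.symm
  · exact h2 h.symm

theorem weightW_eq_sum_pieceWeight (ha : 0 < W.a) (hb : 0 < W.b) (hab : W.a + W.b = 1)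
    (Ψ₀ : StateSpace) {v : Fin 2 → ℝ} (h0 : v ≠ 0) (h1 : v 0 ^ 2 ≠ 1) (h2 : v 1 ^ 2 ≠ 1) :
    weightW W Ψ₀ e v = ∑ p, ∑ i : Fin 2 × Fin 2, pieceWeight W Ψ₀ e p i.1 i.2 v := by
  rw [weightW]
  refine Finset.sum_congr rfl fun p _ => ?_
  have hset : {k | k ∈ torus ∧ vel W p k = v} =
      ⋃ i : Fin 2 × Fin 2, {k | k ∈ piece W i.1 i.2 ∧ vel W p k = v} := by
    ext k
    simp only [Set.mem_iUnion]
    constructor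
    · rintro ⟨hk, rfl⟩
      obtain ⟨i, hi⟩ := mem_iUnion_piece hk (csum_ne_zero_of_vel ha hb hab h0 h1 h2)
      exact ⟨i, hi, rfl⟩
    · rintro ⟨i, hi, hv⟩
      exact ⟨hi.1, hv⟩
  rw [hset, finsum_mem_iUnion, finsum_eq_sum_of_fintype]
  · rfl
  · intro i i' hne
    exact (pairwise_disjoint_piece hne).mono (fun _ h => h.1) fun _ h => h.1
  · intro i
    refine Set.Subsingleton.finite fun k hk k' hk' => ?_
    exact injOn_vel_piece ha hb hab p _ _ hk.1 hk'.1 (hk.2.trans hk'.2.symm)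

theorem weightP_eq_norm_eigenProj (he : IsEigenframe W e) (Ψ : StateSpace) (p : Fin 2)
    {k : Fin 2 → ℝ} (hk : tau W k ^ 2 < 1) :
    weightP Ψ e p k = ‖eigenProj W p k (fourier Ψ k)‖ ^ 2 := by
  rw [eigenProj_eq he p hk, norm_smul, (e k).orthonormal.1, mul_one, weightP, norm_inner_symm]

theorem aestronglyMeasurable_eigenProj {f : (Fin 2 → ℝ) → Coin} {μ : Measure (Fin 2 → ℝ)}
    (hf : AEStronglyMeasurable f μ) (p : Fin 2) :
    AEStronglyMeasurable (fun k => eigenProj W p k (f k)) μ :=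
  ((measurable_eigenProj p).comp_aemeasurable
    (aemeasurable_id.prodMk hf.aemeasurable)).aestronglyMeasurable

theorem weightP_le (Ψ : StateSpace) (p : Fin 2) (k : Fin 2 → ℝ) :
    weightP Ψ e p k ≤ ‖fourier Ψ k‖ ^ 2 := by
  rw [weightP]
  gcongr
  exact (norm_inner_le_norm _ _).trans (by rw [(e k).orthonormal.1, mul_one])

theorem integrableOn_weightP (ha : 0 < W.a) (hb : 0 < W.b) (hab : W.a + W.b = 1)
    (he : IsEigenframe W e) (Ψ : StateSpace) (p : Fin 2) :
    IntegrableOn (weightP Ψ e p) torus := by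
  refine ((memLp_fourier Ψ).integrable_norm_pow (by norm_num)).mono' ?_
    (Eventually.of_forall fun k => ?_)
  · refine ((aestronglyMeasurable_eigenProj (W := W)
      (memLp_fourier Ψ).aestronglyMeasurable p).norm.pow 2).congr ?_
    filter_upwards [ae_restrict_of_ae (ae_tau_sq_lt_one ha hb hab)] with k hk
    exact (weightP_eq_norm_eigenProj he Ψ p hk).symm
  · rw [Real.norm_of_nonneg (by rw [weightP]; positivity)]
    exact weightP_le Ψ p k

theorem measurable_vel (ha : 0 < W.a) (hb : 0 < W.b) (hab : W.a + W.b = 1) (p : Fin 2) :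
    Measurable (vel W p) := by
  refine measurable_pi_lambda _ fun q => ?_
  simp only [vel_eq ha hb hab]
  have h1 := (continuous_tau W).measurable
  have h2 := (continuous_dtau W q).measurable
  fun_prop

theorem integrableOn_phase_weightP (ha : 0 < W.a) (hb : 0 < W.b) (hab : W.a + W.b = 1)
    (he : IsEigenframe W e) (Ψ : StateSpace) (p : Fin 2) (ξ : Fin 2 → ℝ) :
    IntegrableOn (fun k => Complex.exp (Complex.I * ((∑ q, ξ q * vel W p k q : ℝ) : ℂ)) *
      (weightP Ψ e p k : ℂ)) torus := by
  have hv := measurable_vel ha hb hab p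
  refine (integrableOn_weightP ha hb hab he Ψ p).ofReal.bdd_mul (c := 1) ?_
    (Eventually.of_forall fun k => ?_)
  · have : ∀ q, Measurable fun k => vel W p k q := fun q => (measurable_pi_apply q).comp hv
    exact Measurable.aestronglyMeasurable (by fun_prop)
  · rw [mul_comm Complex.I, Complex.norm_exp_ofReal_mul_I]

/-! ### Transport of integrals from wave numbers to velocities -/

theorem isClosed_ellipse : IsClosed (ellipse W) := by
  unfold ellipse
  exact isClosed_le (by fun_prop) continuous_const

theorem measurableSet_ellipse : MeasurableSet (ellipse W) :=
  isClosed_ellipse.measurableSet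

theorem abs_det_smul (ha : 0 < W.a) (hb : 0 < W.b) (hab : W.a + W.b = 1) (p i j : Fin 2)
    {k : Fin 2 → ℝ} (hk : k ∈ piece W i j) (x : ℝ) :
    |(velDeriv W p k).det| * (x / ((1 - vel W p k 0 ^ 2) * (1 - vel W p k 1 ^ 2))) = x := by
  have hc : csum W k ≠ 0 := right_ne_zero_of_mul hk.2.1.ne'
  have hτ := tau_sq_lt_one ha hb hab hc
  have hD : 0 < 1 - tau W k ^ 2 := by linarith
  rw [det_velDeriv hab p hτ, speed_prod_vel ha hb hab p hτ, abs_neg, abs_of_nonneg (by positivity),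
    mul_div_cancel₀]
  positivity

theorem integrableOn_pieceWeight (ha : 0 < W.a) (hb : 0 < W.b) (hab : W.a + W.b = 1)
    (he : IsEigenframe W e) (Ψ : StateSpace) (p i j : Fin 2) :
    IntegrableOn (fun v => pieceWeight W Ψ e p i j v / ((1 - v 0 ^ 2) * (1 - v 1 ^ 2)))
      (ellipse W) := by
  have h1 : IntegrableOn (fun v => pieceWeight W Ψ e p i j v / ((1 - v 0 ^ 2) * (1 - v 1 ^ 2)))
      (vel W p '' piece W i j) := by
    rw [integrableOn_image_iff_integrableOn_abs_det_fderiv_smul volume (measurableSet_piece i j)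
      (fun k hk => (hasFDerivAt_vel ha hb hab p (tau_sq_lt_one ha hb hab
        (right_ne_zero_of_mul hk.2.1.ne'))).hasFDerivWithinAt) (injOn_vel_piece ha hb hab p i j)]
    refine ((integrableOn_weightP ha hb hab he Ψ p).mono_set fun k hk => hk.1).congr_fun
      (fun k hk => ?_) (measurableSet_piece i j)
    simp only [smul_eq_mul]
    rw [pieceWeight_vel ha hb hab Ψ hk, abs_det_smul ha hb hab p i j hk]
  refine h1.of_forall_sdiff_eq_zero measurableSet_ellipse fun v hv => ?_
  rw [pieceWeight_eq_zero Ψ hv.2, zero_div]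

theorem setIntegral_pieceWeight (ha : 0 < W.a) (hb : 0 < W.b) (hab : W.a + W.b = 1)
    (Ψ : StateSpace) (p i j : Fin 2) (ξ : Fin 2 → ℝ) :
    ∫ v in ellipse W, Complex.exp (Complex.I * ((∑ q, ξ q * v q : ℝ) : ℂ)) *
      ((pieceWeight W Ψ e p i j v / ((1 - v 0 ^ 2) * (1 - v 1 ^ 2)) : ℝ) : ℂ) =
    ∫ k in piece W i j, Complex.exp (Complex.I * ((∑ q, ξ q * vel W p k q : ℝ) : ℂ)) *
      (weightP Ψ e p k : ℂ) := by
  have hsub : vel W p '' piece W i j ⊆ ellipse W := by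
    rintro _ ⟨k, -, rfl⟩
    exact vel_mem_ellipse ha hb hab p k
  rw [setIntegral_eq_of_subset_of_forall_sdiff_eq_zero measurableSet_ellipse hsub fun v hv => by
      rw [pieceWeight_eq_zero Ψ hv.2, zero_div, Complex.ofReal_zero, mul_zero],
    integral_image_eq_integral_abs_det_fderiv_smul volume (measurableSet_piece i j)
      (fun k hk => (hasFDerivAt_vel ha hb hab p (tau_sq_lt_one ha hb hab
        (right_ne_zero_of_mul hk.2.1.ne'))).hasFDerivWithinAt) (injOn_vel_piece ha hb hab p i j)]
  refine setIntegral_congr_fun (measurableSet_piece i j) fun k hk => ?_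
  rw [pieceWeight_vel ha hb hab Ψ hk, Complex.real_smul, mul_left_comm, ← Complex.ofReal_mul,
    abs_det_smul ha hb hab p i j hk]

theorem limitDensity_ae_eq (ha : 0 < W.a) (hb : 0 < W.b) (hab : W.a + W.b = 1)
    (Ψ : StateSpace) : ∀ᵐ v : Fin 2 → ℝ, limitDensity W Ψ e v = ∑ p, ∑ i : Fin 2 × Fin 2,
      pieceWeight W Ψ e p i.1 i.2 v / ((1 - v 0 ^ 2) * (1 - v 1 ^ 2)) := by
  have h : ∀ (q : Fin 2) (c : ℝ), ∀ᵐ v : Fin 2 → ℝ, v q ≠ c := fun q c =>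
    Measure.ae_eval_ne (fun _ : Fin 2 => (volume : Measure ℝ)) q c
  filter_upwards [h 0 0, h 0 1, h 0 (-1), h 1 1, h 1 (-1)] with v h0 h1 h2 h3 h4
  rw [limitDensity, weightW_eq_sum_pieceWeight ha hb hab Ψ (fun hv => h0 (by rw [hv]; rfl))
    (fun h => (eq_or_eq_neg_of_sq_eq_sq _ _ (h.trans (one_pow 2).symm)).elim h1 h2)
    (fun h => (eq_or_eq_neg_of_sq_eq_sq _ _ (h.trans (one_pow 2).symm)).elim h3 h4),
    Finset.sum_div]
  simp only [Finset.sum_div]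

theorem integrableOn_limitDensity (ha : 0 < W.a) (hb : 0 < W.b) (hab : W.a + W.b = 1)
    (he : IsEigenframe W e) (Ψ : StateSpace) : IntegrableOn (limitDensity W Ψ e) (ellipse W) := by
  refine Integrable.congr (f := fun v => ∑ p, ∑ i : Fin 2 × Fin 2,
      pieceWeight W Ψ e p i.1 i.2 v / ((1 - v 0 ^ 2) * (1 - v 1 ^ 2))) ?_ ?_
  · exact integrable_finsetSum _ fun p _ => integrable_finsetSum _ fun i _ =>
      integrableOn_pieceWeight ha hb hab he Ψ p i.1 i.2
  · filter_upwards [ae_restrict_of_ae (limitDensity_ae_eq (e := e) ha hb hab Ψ)] with v hv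
    exact hv.symm

theorem setIntegral_iUnion_piece {f : (Fin 2 → ℝ) → ℂ} (hf : IntegrableOn f torus) :
    ∑ i : Fin 2 × Fin 2, ∫ k in piece W i.1 i.2, f k = ∫ k in torus, f k := by
  rw [← integral_iUnion_fintype (s := fun i : Fin 2 × Fin 2 => piece W i.1 i.2)
    (fun i => measurableSet_piece i.1 i.2) pairwise_disjoint_piece
    fun i => hf.mono_set fun k hk => hk.1]
  refine setIntegral_congr_set ?_
  filter_upwards [ae_csum_ne_zero W] with k hk
  refine propext ⟨fun h => ?_, fun h => ?_⟩
  · obtain ⟨i, hi⟩ := Set.mem_iUnion.1 h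
    exact hi.1
  · exact Set.mem_iUnion.2 (mem_iUnion_piece h hk)

theorem setIntegral_limitDensity (ha : 0 < W.a) (hb : 0 < W.b) (hab : W.a + W.b = 1)
    (he : IsEigenframe W e) (Ψ : StateSpace) (ξ : Fin 2 → ℝ) :
    ∫ v in ellipse W, (1 / (2 * (Real.pi : ℂ)) ^ 2) *
      (Complex.exp (Complex.I * ((∑ q, ξ q * v q : ℝ) : ℂ)) * (limitDensity W Ψ e v : ℂ)) =
    ((2 * Real.pi : ℂ) ^ 2)⁻¹ * ∫ k in torus, ∑ p,
      Complex.exp (Complex.I * ((∑ q, ξ q * vel W p k q : ℝ) : ℂ)) * (weightP Ψ e p k : ℂ) := by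
  rw [integral_const_mul, one_div]
  congr 1
  rw [integral_finsetSum _ fun p _ => integrableOn_phase_weightP ha hb hab he Ψ p ξ]
  have h1 : ∀ p, ∫ k in torus, Complex.exp (Complex.I * ((∑ q, ξ q * vel W p k q : ℝ) : ℂ)) *
      (weightP Ψ e p k : ℂ) = ∑ i : Fin 2 × Fin 2, ∫ v in ellipse W,
        Complex.exp (Complex.I * ((∑ q, ξ q * v q : ℝ) : ℂ)) *
        ((pieceWeight W Ψ e p i.1 i.2 v / ((1 - v 0 ^ 2) * (1 - v 1 ^ 2)) : ℝ) : ℂ) := fun p => by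
    rw [← setIntegral_iUnion_piece (W := W) (integrableOn_phase_weightP ha hb hab he Ψ p ξ)]
    exact Finset.sum_congr rfl fun i _ => (setIntegral_pieceWeight ha hb hab Ψ p i.1 i.2 ξ).symm
  have hint : ∀ (p : Fin 2) (i : Fin 2 × Fin 2), IntegrableOn (fun v : Fin 2 → ℝ =>
      Complex.exp (Complex.I * ((∑ q, ξ q * v q : ℝ) : ℂ)) *
        ((pieceWeight W Ψ e p i.1 i.2 v / ((1 - v 0 ^ 2) * (1 - v 1 ^ 2)) : ℝ) : ℂ))
      (ellipse W) := fun p i => by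
    refine (integrableOn_pieceWeight ha hb hab he Ψ p i.1 i.2).ofReal.bdd_mul (c := 1) ?_
      (Eventually.of_forall fun k => ?_)
    · exact Continuous.aestronglyMeasurable (by fun_prop)
    · rw [mul_comm Complex.I, Complex.norm_exp_ofReal_mul_I]
  simp only [h1]
  simp_rw [← integral_finsetSum Finset.univ fun i _ => hint _ i]
  rw [← integral_finsetSum _ fun p _ => integrable_finsetSum _ fun i _ => hint p i]
  refine integral_congr_ae ?_
  filter_upwards [ae_restrict_of_ae (limitDensity_ae_eq (e := e) ha hb hab Ψ)] with v hv
  rw [hv]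
  simp only [Complex.ofReal_sum, Finset.mul_sum]

end ChangeOfVariables

/-! ### Inverse branches of the velocity map -/

section Branches

variable {W : Params} {e : (Fin 2 → ℝ) → OrthonormalBasis (Fin 2) ℂ Coin}

/-- The difference of the two sides is a square over 4ab: the ellipse is inscribed in [-1, 1]², so
the square roots in c₁ and c₂ are positive in its interior. -/
theorem ellipseForm_le (ha : 0 < W.a) (hb : 0 < W.b) (hab : W.a + W.b = 1)
    (v : Fin 2 → ℝ) (q : Fin 2) : ellipseForm W v ≤ 1 - v q ^ 2 := by
  have hb' : W.b = 1 - W.a := by linarith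
  have h0 : ellipseForm W v = 1 - v 0 ^ 2 -
      (W.b * (v 0 + v 1) - W.a * (v 0 - v 1)) ^ 2 / (4 * W.a * W.b) := by
    rw [ellipseForm]
    field_simp
    rw [hb']
    ring
  have h1 : ellipseForm W v = 1 - v 1 ^ 2 -
      (W.b * (v 0 + v 1) + W.a * (v 0 - v 1)) ^ 2 / (4 * W.a * W.b) := by
    rw [ellipseForm]
    field_simp
    rw [hb']
    ring
  have h2 : 0 ≤ (W.b * (v 0 + v 1) - W.a * (v 0 - v 1)) ^ 2 / (4 * W.a * W.b) := by positivity
  have h3 : 0 ≤ (W.b * (v 0 + v 1) + W.a * (v 0 - v 1)) ^ 2 / (4 * W.a * W.b) := by positivity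
  fin_cases q
  · change ellipseForm W v ≤ 1 - v 0 ^ 2
    linarith
  · change ellipseForm W v ≤ 1 - v 1 ^ 2
    linarith

theorem sq_lt_one_of_ellipseForm (ha : 0 < W.a) (hb : 0 < W.b) (hab : W.a + W.b = 1)
    {v : Fin 2 → ℝ} (hv : 0 < ellipseForm W v) (q : Fin 2) : v q ^ 2 < 1 := by
  linarith [ellipseForm_le ha hb hab v q]

theorem speed_prod_pos (ha : 0 < W.a) (hb : 0 < W.b) (hab : W.a + W.b = 1)
    {v : Fin 2 → ℝ} (hv : 0 < ellipseForm W v) : 0 < (1 - v 0 ^ 2) * (1 - v 1 ^ 2) :=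
  mul_pos (by linarith [sq_lt_one_of_ellipseForm ha hb hab hv 0])
    (by linarith [sq_lt_one_of_ellipseForm ha hb hab hv 1])

/-- The value of `√(1 - τ²)` as a function of `v`. -/
def branchDisp (W : Params) (v : Fin 2 → ℝ) : ℝ :=
  √(4 * W.a * W.b * ellipseForm W v / ((1 - v 0 ^ 2) * (1 - v 1 ^ 2)))

theorem branchDisp_pos (ha : 0 < W.a) (hb : 0 < W.b) (hab : W.a + W.b = 1)
    {v : Fin 2 → ℝ} (hv : 0 < ellipseForm W v) : 0 < branchDisp W v := by
  have := speed_prod_pos ha hb hab hv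
  exact Real.sqrt_pos.2 (by positivity)

theorem branchDisp_sq (ha : 0 < W.a) (hb : 0 < W.b) (hab : W.a + W.b = 1)
    {v : Fin 2 → ℝ} (hv : 0 < ellipseForm W v) :
    branchDisp W v ^ 2 = 4 * W.a * W.b * ellipseForm W v / ((1 - v 0 ^ 2) * (1 - v 1 ^ 2)) := by
  have := speed_prod_pos ha hb hab hv
  exact Real.sq_sqrt (by positivity)

theorem branchC_add (ha : 0 < W.a) (hb : 0 < W.b) (hab : W.a + W.b = 1) (ε : ℝ) (v : Fin 2 → ℝ) :
    branchC₁ W ε v + branchC₂ W ε v =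
      2 * ε * ellipseForm W v / √((1 - v 0 ^ 2) * (1 - v 1 ^ 2)) := by
  have hb' : W.b = 1 - W.a := by linarith
  rw [branchC₁, branchC₂, ← add_div, ellipseForm]
  congr 1
  field_simp
  rw [hb']
  ring

/-- The right side is the square of the sine that `vel_add` demands of l₁. So c₁ and that sine are
the coordinates of a point of the unit circle, and in particular |c₁| ≤ 1. -/
theorem branchC₁_sq (ha : 0 < W.a) (hb : 0 < W.b) (hab : W.a + W.b = 1) {ε : ℝ} (hε : ε ^ 2 = 1)
    {v : Fin 2 → ℝ} (hv : 0 < ellipseForm W v) :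
    1 - branchC₁ W ε v ^ 2 = ((v 0 + v 1) * branchDisp W v / (2 * W.a)) ^ 2 := by
  have hb' : W.b = 1 - W.a := by linarith
  have hG := speed_prod_pos ha hb hab hv
  rw [div_pow, mul_pow, branchDisp_sq ha hb hab hv, branchC₁, div_pow, mul_pow, hε,
    Real.sq_sqrt hG.le]
  generalize hg : (1 - v 0 ^ 2) * (1 - v 1 ^ 2) = G at hG
  rw [ellipseForm]
  field_simp
  rw [← hg, hb']
  ring

theorem branchC₂_sq (ha : 0 < W.a) (hb : 0 < W.b) (hab : W.a + W.b = 1) {ε : ℝ} (hε : ε ^ 2 = 1)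
    {v : Fin 2 → ℝ} (hv : 0 < ellipseForm W v) :
    1 - branchC₂ W ε v ^ 2 = ((v 0 - v 1) * branchDisp W v / (2 * W.b)) ^ 2 := by
  have ha' : W.a = 1 - W.b := by linarith
  have hG := speed_prod_pos ha hb hab hv
  rw [div_pow, mul_pow, branchDisp_sq ha hb hab hv, branchC₂, div_pow, mul_pow, hε,
    Real.sq_sqrt hG.le]
  generalize hg : (1 - v 0 ^ 2) * (1 - v 1 ^ 2) = G at hG
  rw [ellipseForm]
  field_simp
  rw [← hg, ha']
  ring

/-- Consistency of the inversion: the value of √(1 - τ²) assumed in the sines is the one that the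
cosines c₁, c₂ produce. -/
theorem branch_tau_sq (ha : 0 < W.a) (hb : 0 < W.b) (hab : W.a + W.b = 1) {ε : ℝ} (hε : ε ^ 2 = 1)
    {v : Fin 2 → ℝ} (hv : 0 < ellipseForm W v) :
    1 - (W.a * branchC₁ W ε v - W.b * branchC₂ W ε v) ^ 2 = branchDisp W v ^ 2 := by
  have hb' : W.b = 1 - W.a := by linarith
  have hG := speed_prod_pos ha hb hab hv
  have h1 : W.a * branchC₁ W ε v - W.b * branchC₂ W ε v = ε * (W.a - W.b - (v 0 + v 1) ^ 2 / 4 +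
      (v 0 - v 1) ^ 2 / 4) / √((1 - v 0 ^ 2) * (1 - v 1 ^ 2)) := by
    rw [branchC₁, branchC₂, mul_div_assoc', mul_div_assoc', ← sub_div]
    congr 1
    field_simp
    rw [hb']
    ring
  rw [branchDisp_sq ha hb hab hv, h1, div_pow, mul_pow, hε, Real.sq_sqrt hG.le]
  generalize hg : (1 - v 0 ^ 2) * (1 - v 1 ^ 2) = G at hG
  rw [ellipseForm]
  field_simp
  rw [← hg, hb']
  ring

theorem vel_eq_of_trig (ha : 0 < W.a) (hb : 0 < W.b) (hab : W.a + W.b = 1) {p : Fin 2} {ε : ℝ}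
    (hε : ε ^ 2 = 1) {v k : Fin 2 → ℝ} (hv : 0 < ellipseForm W v)
    (hc₁ : Real.cos (ell₁ W k) = branchC₁ W ε v) (hc₂ : Real.cos (ell₂ W k) = branchC₂ W ε v)
    (hs₁ : Real.sin (ell₁ W k) =
      -((-1) ^ (p : ℕ) * (v 0 + v 1) * branchDisp W v / (2 * W.a)))
    (hs₂ : Real.sin (ell₂ W k) =
      -((-1) ^ (p : ℕ) * (v 0 - v 1) * branchDisp W v / (2 * W.b))) :
    vel W p k = v ∧ 0 < ε * csum W k := by
  have hD := branchDisp_pos ha hb hab hv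
  have hG := speed_prod_pos ha hb hab hv
  have hτ : √(1 - tau W k ^ 2) = branchDisp W v := by
    rw [tau, hc₁, hc₂, branch_tau_sq ha hb hab hε hv, Real.sqrt_sq hD.le]
  have hs := neg_one_pow_sq (p : ℕ)
  have h1 : vel W p k 0 + vel W p k 1 = v 0 + v 1 := by
    rw [vel_add ha hb hab, hτ, hs₁]
    field_simp
    rw [hs, one_mul]
  have h2 : vel W p k 0 - vel W p k 1 = v 0 - v 1 := by
    rw [vel_sub ha hb hab, hτ, hs₂]
    field_simp
    rw [hs, one_mul]
  refine ⟨?_, ?_⟩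
  · ext q
    fin_cases q
    · change vel W p k 0 = v 0
      linarith
    · change vel W p k 1 = v 1
      linarith
  · have : ε * (2 * ε * ellipseForm W v / √((1 - v 0 ^ 2) * (1 - v 1 ^ 2))) =
        2 * ε ^ 2 * ellipseForm W v / √((1 - v 0 ^ 2) * (1 - v 1 ^ 2)) := by ring
    rw [csum, hc₁, hc₂, branchC_add ha hb hab, this, hε]
    positivity

theorem exists_cos_sin {c s : ℝ} (h : 1 - c ^ 2 = s ^ 2) :
    ∃ x, Real.cos x = c ∧ Real.sin x = s := by
  refine ⟨Complex.arg ⟨c, s⟩, ?_⟩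
  have hn : ‖(⟨c, s⟩ : ℂ)‖ = 1 := by
    rw [Complex.norm_def, Complex.normSq_mk, Real.sqrt_eq_one]
    linarith
  have h0 : (⟨c, s⟩ : ℂ) ≠ 0 := by
    rw [← norm_ne_zero_iff, hn]
    exact one_ne_zero
  rw [Complex.cos_arg h0, Complex.sin_arg, hn, div_one, div_one]
  exact ⟨rfl, rfl⟩

/-- Surjectivity onto the whole open ellipse, including the axes v₁ = ±v₂ that `vel_branchK` leaves
out: the angles come from prescribed cosine and sine, without sgn and arccos. -/
theorem exists_vel_eq (ha : 0 < W.a) (hb : 0 < W.b) (hab : W.a + W.b = 1) (p : Fin 2)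
    {v : Fin 2 → ℝ} (hv : 0 < ellipseForm W v) : ∃ k, vel W p k = v ∧ csum W k ≠ 0 := by
  have hs := neg_one_pow_sq (p : ℕ)
  obtain ⟨x, hx1, hx2⟩ := exists_cos_sin (c := branchC₁ W 1 v)
    (s := -((-1) ^ (p : ℕ) * (v 0 + v 1) * branchDisp W v / (2 * W.a))) (by
      rw [branchC₁_sq ha hb hab (one_pow 2) hv]
      linear_combination (-((v 0 + v 1) * branchDisp W v / (2 * W.a)) ^ 2) * hs)
  obtain ⟨y, hy1, hy2⟩ := exists_cos_sin (c := branchC₂ W 1 v)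
    (s := -((-1) ^ (p : ℕ) * (v 0 - v 1) * branchDisp W v / (2 * W.b))) (by
      rw [branchC₂_sq ha hb hab (one_pow 2) hv]
      linear_combination (-((v 0 - v 1) * branchDisp W v / (2 * W.b)) ^ 2) * hs)
  let k : Fin 2 → ℝ := ![((x - W.α 1 - W.α 0) - (y - W.β 1 + W.β 0)) / 2,
    ((x - W.α 1 - W.α 0) + (y - W.β 1 + W.β 0)) / 2]
  have h1 : ell₁ W k = x := by
    simp [ell₁, k]
    ring
  have h2 : ell₂ W k = y := by
    simp [ell₂, k]
    ring
  obtain ⟨h3, h4⟩ := vel_eq_of_trig (p := p) ha hb hab (one_pow 2) hv (h1 ▸ hx1) (h2 ▸ hy1)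
    (h1 ▸ hx2) (h2 ▸ hy2)
  exact ⟨k, h3, right_ne_zero_of_mul h4.ne'⟩

theorem cos_neg_sign_mul_arccos {x c : ℝ} (hx : x ≠ 0) (hc : |c| ≤ 1) :
    Real.cos (-(SignType.sign x : ℝ) * Real.arccos c) = c := by
  rw [abs_le] at hc
  rcases hx.lt_or_gt with h | h
  · simp [sign_neg h, Real.cos_arccos hc.1 hc.2]
  · simp [sign_pos h, Real.cos_arccos hc.1 hc.2]

theorem sin_neg_sign_mul_arccos {x c r : ℝ} (hx : x ≠ 0) (hr : 0 < r)
    (h : 1 - c ^ 2 = (x * r) ^ 2) :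
    Real.sin (-(SignType.sign x : ℝ) * Real.arccos c) = -(x * r) := by
  rcases hx.lt_or_gt with h' | h'
  · have : x * r < 0 := mul_neg_of_neg_of_pos h' hr
    simp only [sign_neg h', SignType.coe_neg_one, neg_neg, one_mul, Real.sin_arccos, h,
      Real.sqrt_sq_eq_abs, abs_of_neg this]
  · have : 0 < x * r := mul_pos h' hr
    simp only [sign_pos h', SignType.coe_one, neg_mul, one_mul, Real.sin_neg, Real.sin_arccos, h,
      Real.sqrt_sq_eq_abs, abs_of_pos this]

theorem ell₁_branchK (p : Fin 2) (ε : ℝ) (j : Fin 2) (v : Fin 2 → ℝ) :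
    ell₁ W (branchK W p ε j v) = branchL₁ W p ε v + ((j : ℕ) : ℤ) * (2 * Real.pi) := by
  simp [ell₁, branchK]
  ring

theorem ell₂_branchK (p : Fin 2) (ε : ℝ) (j : Fin 2) (v : Fin 2 → ℝ) :
    ell₂ W (branchK W p ε j v) = branchL₂ W p ε v := by
  simp [ell₂, branchK]
  ring

/-- The factor -sgn selects the angle with cosine c_i whose sine has the required sign. On an axis
with ε = -1 the corresponding c_i is -1, but sgn 0 = 0 would give the angle 0 instead of π; this is
why the axes are excluded. -/
theorem vel_branchK (ha : 0 < W.a) (hb : 0 < W.b) (hab : W.a + W.b = 1) {p : Fin 2} {ε : ℝ}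
    (hε : ε ^ 2 = 1) (j : Fin 2) {v : Fin 2 → ℝ} (hv : 0 < ellipseForm W v)
    (h₁ : v 0 + v 1 ≠ 0) (h₂ : v 0 - v 1 ≠ 0) :
    vel W p (branchK W p ε j v) = v ∧ 0 < ε * csum W (branchK W p ε j v) := by
  have hD := branchDisp_pos ha hb hab hv
  have hs := neg_one_pow_sq (p : ℕ)
  have hp : (-1 : ℝ) ^ (p : ℕ) ≠ 0 := by simp
  have e₁ := branchC₁_sq ha hb hab hε hv
  have e₂ := branchC₂_sq ha hb hab hε hv
  have b₁ : |branchC₁ W ε v| ≤ 1 := by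
    rw [← sq_le_one_iff_abs_le_one]
    linarith [sq_nonneg ((v 0 + v 1) * branchDisp W v / (2 * W.a))]
  have b₂ : |branchC₂ W ε v| ≤ 1 := by
    rw [← sq_le_one_iff_abs_le_one]
    linarith [sq_nonneg ((v 0 - v 1) * branchDisp W v / (2 * W.b))]
  refine vel_eq_of_trig ha hb hab hε hv ?_ ?_ ?_ ?_
  · rw [ell₁_branchK, Real.cos_add_int_mul_two_pi, branchL₁,
      cos_neg_sign_mul_arccos (mul_ne_zero hp h₁) b₁]
  · rw [ell₂_branchK, branchL₂, cos_neg_sign_mul_arccos (mul_ne_zero hp h₂) b₂]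
  · rw [ell₁_branchK, Real.sin_add_int_mul_two_pi, branchL₁,
      sin_neg_sign_mul_arccos (r := branchDisp W v / (2 * W.a)) (mul_ne_zero hp h₁)
        (by positivity), mul_div_assoc]
    rw [e₁]
    linear_combination (-((v 0 + v 1) * branchDisp W v / (2 * W.a)) ^ 2) * hs
  · rw [ell₂_branchK, branchL₂,
      sin_neg_sign_mul_arccos (r := branchDisp W v / (2 * W.b)) (mul_ne_zero hp h₂)
        (by positivity), mul_div_assoc]
    rw [e₂]
    linear_combination (-((v 0 - v 1) * branchDisp W v / (2 * W.b)) ^ 2) * hs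

theorem branchK_apply (p : Fin 2) (ε : ℝ) (j q : Fin 2) (v : Fin 2 → ℝ) :
    branchK W p ε j v q = branchK W p ε 0 v q + (j : ℕ) * Real.pi := by
  fin_cases q <;> simp [branchK]

/-- The representative of a wave number in the fundamental domain. -/
def toTorus (k : Fin 2 → ℝ) : Fin 2 → ℝ :=
  fun q => toIcoMod Real.two_pi_pos (-Real.pi) (k q)

theorem toTorus_mem (k : Fin 2 → ℝ) : toTorus k ∈ torus := by
  intro q _
  have := toIcoMod_mem_Ico Real.two_pi_pos (-Real.pi) (k q)
  rwa [show -Real.pi + 2 * Real.pi = Real.pi by ring] at this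

theorem exists_toTorus_eq (k : Fin 2 → ℝ) :
    ∃ n : Site, toTorus k = fun q => k q + 2 * Real.pi * n q := by
  refine ⟨fun q => -toIcoDiv Real.two_pi_pos (-Real.pi) (k q), ?_⟩
  ext q
  rw [toTorus, toIcoMod, zsmul_eq_mul]
  push_cast
  ring

theorem toTorus_eq_of_mem {k k' : Fin 2 → ℝ} (hk : k ∈ torus)
    (h : ∀ q, ∃ n : ℤ, k q - k' q = 2 * Real.pi * n) : toTorus k' = k := by
  ext q
  obtain ⟨n, hn⟩ := h q
  rw [toTorus, toIcoMod_eq_iff]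
  refine ⟨?_, -n, ?_⟩
  · rw [show -Real.pi + 2 * Real.pi = Real.pi by ring]
    exact hk q (Set.mem_univ q)
  · rw [zsmul_eq_mul]
    push_cast
    linarith

/-! ### Periodicity in the wave number -/

theorem ell₁_translate (k : Fin 2 → ℝ) (n : Site) :
    ell₁ W (fun q => k q + 2 * Real.pi * n q) = ell₁ W k + (n 1 + n 0 : ℤ) * (2 * Real.pi) := by
  simp [ell₁]
  ring

theorem ell₂_translate (k : Fin 2 → ℝ) (n : Site) :
    ell₂ W (fun q => k q + 2 * Real.pi * n q) = ell₂ W k + (n 1 - n 0 : ℤ) * (2 * Real.pi) := by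
  simp [ell₂]
  ring

theorem csum_translate (k : Fin 2 → ℝ) (n : Site) :
    csum W (fun q => k q + 2 * Real.pi * n q) = csum W k := by
  rw [csum, ell₁_translate, ell₂_translate, Real.cos_add_int_mul_two_pi,
    Real.cos_add_int_mul_two_pi, csum]

theorem tau_translate (k : Fin 2 → ℝ) (n : Site) :
    tau W (fun q => k q + 2 * Real.pi * n q) = tau W k := by
  rw [tau, ell₁_translate, ell₂_translate, Real.cos_add_int_mul_two_pi,
    Real.cos_add_int_mul_two_pi, tau]

theorem vel_translate (ha : 0 < W.a) (hb : 0 < W.b) (hab : W.a + W.b = 1) (p : Fin 2)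
    (k : Fin 2 → ℝ) (n : Site) : vel W p (fun q => k q + 2 * Real.pi * n q) = vel W p k := by
  ext q
  rw [vel_eq ha hb hab, vel_eq ha hb hab, tau_translate, dtau, ell₁_translate, ell₂_translate,
    Real.sin_add_int_mul_two_pi, Real.sin_add_int_mul_two_pi, dtau]

theorem shiftHat_translate (q : Fin 2) (k : Fin 2 → ℝ) (n : Site) :
    shiftHat q (fun q => k q + 2 * Real.pi * n q) = shiftHat q k := by
  have h : Complex.exp (Complex.I * ((k q + 2 * Real.pi * n q : ℝ) : ℂ)) =
      Complex.exp (Complex.I * (k q : ℂ)) := by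
    rw [Complex.exp_eq_exp_iff_exists_int]
    exact ⟨n q, by push_cast; ring⟩
  simp only [shiftHat, h, Complex.exp_neg]

/-- The frame itself need not be periodic, but for simple eigenvalues its projections are, since the
symbol is. -/
theorem weightP_translate (he : IsEigenframe W e) (Ψ : StateSpace) (p : Fin 2) {k : Fin 2 → ℝ}
    (hk : tau W k ^ 2 < 1) (n : Site) :
    weightP Ψ e p (fun q => k q + 2 * Real.pi * n q) = weightP Ψ e p k := by
  rw [weightP_eq_norm_eigenProj he Ψ p hk, weightP_eq_norm_eigenProj he Ψ p
    (by rwa [tau_translate]), fourier_periodic]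
  simp only [eigenProj, eigval, tau_translate, stepHat, shiftHat_translate]

theorem sign_unique {ε ε' c : ℝ} (hε : ε ^ 2 = 1) (hε' : ε' ^ 2 = 1) (h : 0 < ε * c)
    (h' : 0 < ε' * c) : ε = ε' := by
  have hεε : 0 < ε * ε' := by
    have h1 : 0 < (ε * c) * (ε' * c) := mul_pos h h'
    have h2 : 0 < c ^ 2 := by
      have : c ≠ 0 := right_ne_zero_of_mul h.ne'
      positivity
    have h3 : (ε * c) * (ε' * c) = (ε * ε') * c ^ 2 := by ring
    rw [h3] at h1
    exact pos_of_mul_pos_left h1 h2.le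
  nlinarith [sq_nonneg (ε - ε'), sq_nonneg (ε * ε' - 1)]

theorem weightW_eq_sum_branchK (ha : 0 < W.a) (hb : 0 < W.b) (hab : W.a + W.b = 1)
    (he : IsEigenframe W e) (Ψ : StateSpace) {v : Fin 2 → ℝ} (hv : 0 < ellipseForm W v)
    (h₁ : v 0 + v 1 ≠ 0) (h₂ : v 0 - v 1 ≠ 0) :
    weightW W Ψ e v = ∑ p : Fin 2, ∑ j : Fin 2, (weightP Ψ e p (branchK W p 1 j v) +
      weightP Ψ e p (branchK W p (-1) j v)) := by
  have hpi := Real.pi_pos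
  rw [weightW]
  refine Finset.sum_congr rfl fun p _ => ?_
  let K : Fin 2 × Fin 2 → Fin 2 → ℝ := fun i => branchK W p ((-1) ^ (i.1 : ℕ)) i.2 v
  have hK : ∀ i, vel W p (K i) = v ∧ 0 < (-1) ^ (i.1 : ℕ) * csum W (K i) := fun i =>
    vel_branchK ha hb hab (neg_one_pow_sq _) i.2 hv h₁ h₂
  have hτ : ∀ i, tau W (K i) ^ 2 < 1 := fun i =>
    tau_sq_lt_one ha hb hab (right_ne_zero_of_mul (hK i).2.ne')
  have hset : {k | k ∈ torus ∧ vel W p k = v} = Set.range fun i => toTorus (K i) := by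
    ext k
    constructor
    · rintro ⟨hk, hkv⟩
      have hc : csum W k ≠ 0 := by
        refine csum_ne_zero_of_vel ha hb hab (p := p) ?_ ?_ ?_
        · rintro h0
          rw [hkv] at h0
          exact h₁ (by simp [h0])
        · rw [hkv]
          exact (sq_lt_one_of_ellipseForm ha hb hab hv 0).ne
        · rw [hkv]
          exact (sq_lt_one_of_ellipseForm ha hb hab hv 1).ne
      obtain ⟨i, -, hi, -⟩ := mem_iUnion_piece hk hc
      have hKi := hK (i.1, 0)
      obtain ⟨⟨t1, t2⟩, t3, t4⟩ := eq_trig_of_vel_eq ha hb hab (neg_one_pow_sq _) hi hKi.2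
        (hkv.trans hKi.1.symm)
      obtain ⟨m, n, hm, hn⟩ := exists_int_of_cos_sin_ell t1 t2 t3 t4
      -- The two classes of the ambiguity lattice modulo 2π are told apart by the parity of m + n,
      -- which is also that of m - n; odd parity is the translation by (π, π).
      obtain ⟨j, u, hu⟩ : ∃ (j : Fin 2) (u : ℤ), m + n = (j : ℕ) + 2 * u := by
        rcases Int.even_or_odd' (m + n) with ⟨u, hu | hu⟩
        · exact ⟨0, u, by simpa using hu⟩
        · exact ⟨1, u, by simpa [add_comm] using hu⟩
      refine ⟨(i.1, j), toTorus_eq_of_mem hk fun q => ?_⟩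
      simp only [K] at hm hn ⊢
      fin_cases q
      · refine ⟨u - n, ?_⟩
        have : (m - n : ℤ) = (j : ℕ) + 2 * (u - n) := by linarith
        rw [this] at hm
        simp only [Fin.zero_eta]
        rw [branchK_apply]
        push_cast at hm ⊢
        linarith
      · refine ⟨u, ?_⟩
        rw [hu] at hn
        simp only [Fin.mk_one]
        rw [branchK_apply]
        push_cast at hn ⊢
        linarith
    · rintro ⟨i, rfl⟩
      obtain ⟨n, hn⟩ := exists_toTorus_eq (K i)
      refine ⟨toTorus_mem _, ?_⟩
      simp only [hn]
      rw [vel_translate ha hb hab, (hK i).1]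
  have hinj : Function.Injective fun i => toTorus (K i) := by
    rintro ⟨i, j⟩ ⟨i', j'⟩ h
    obtain ⟨n, hn⟩ := exists_toTorus_eq (K (i, j))
    obtain ⟨n', hn'⟩ := exists_toTorus_eq (K (i', j'))
    simp only [hn, hn'] at h
    have hc : csum W (K (i, j)) = csum W (K (i', j')) := by
      rw [← csum_translate (K (i, j)) n, h, csum_translate]
    have hε := sign_unique (neg_one_pow_sq _) (neg_one_pow_sq _) (hK (i, j)).2
      (hc ▸ (hK (i', j')).2)
    have hi : i = i' := by
      fin_cases i <;> fin_cases i' <;> simp at hε ⊢ <;> norm_num at hε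
    subst hi
    have h0 := congrFun h 0
    simp only [K] at h0
    rw [branchK_apply, branchK_apply _ _ j'] at h0
    have h1 : ((j : ℕ) : ℝ) + 2 * n 0 = (j' : ℕ) + 2 * n' 0 := by
      have : Real.pi * (((j : ℕ) : ℝ) + 2 * n 0) = Real.pi * ((j' : ℕ) + 2 * n' 0) := by linarith
      exact mul_left_cancel₀ hpi.ne' this
    have h2 : ((j : ℕ) : ℤ) + 2 * n 0 = (j' : ℕ) + 2 * n' 0 := by exact_mod_cast h1
    have hj : j = j' := by
      ext
      omega
    rw [hj]
  have hw : ∀ i, weightP Ψ e p (toTorus (K i)) = weightP Ψ e p (K i) := fun i => by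
    obtain ⟨n, hn⟩ := exists_toTorus_eq (K i)
    rw [hn, weightP_translate he Ψ p (hτ i)]
  rw [hset, finsum_mem_range hinj, finsum_eq_sum_of_fintype]
  simp only [hw]
  simp [K, Fintype.sum_prod_type, Fin.sum_univ_two]
  ring

end Branches

/-! ### Operators that are diagonal in the eigenframe -/

section Spectral

variable {W : Params} {e : (Fin 2 → ℝ) → OrthonormalBasis (Fin 2) ℂ Coin}

/-- The vector with coordinates `c p k * ⟨e_p(k), x⟩` in the frame `e k`. -/
def frameMul (e : (Fin 2 → ℝ) → OrthonormalBasis (Fin 2) ℂ Coin)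
    (c : Fin 2 → (Fin 2 → ℝ) → ℂ) (k : Fin 2 → ℝ) (x : Coin) : Coin :=
  ∑ p, (c p k * inner ℂ (e k p) x) • e k p

/-- `T` multiplies by `c p k` along the eigenvector `e k p` in Fourier space. -/
def IsFrameMultiplier (e : (Fin 2 → ℝ) → OrthonormalBasis (Fin 2) ℂ Coin)
    (c : Fin 2 → (Fin 2 → ℝ) → ℂ) (T : StateSpace →L[ℂ] StateSpace) : Prop :=
  ∀ Ψ, ∀ᵐ k ∂(volume.restrict torus), fourier (T Ψ) k = frameMul e c k (fourier Ψ k)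

variable {c d : Fin 2 → (Fin 2 → ℝ) → ℂ} {T S : StateSpace →L[ℂ] StateSpace}

theorem inner_frameMul_right (p : Fin 2) (k : Fin 2 → ℝ) (x : Coin) :
    inner ℂ (e k p) (frameMul e c k x) = c p k * inner ℂ (e k p) x :=
  (e k).orthonormal.inner_right_fintype _ p

theorem frameMul_frameMul (k : Fin 2 → ℝ) (x : Coin) :
    frameMul e c k (frameMul e d k x) = frameMul e (fun p k => c p k * d p k) k x :=
  Finset.sum_congr rfl fun p _ => by rw [inner_frameMul_right, mul_assoc]

theorem frameMul_add (k : Fin 2 → ℝ) (x y : Coin) :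
    frameMul e c k (x + y) = frameMul e c k x + frameMul e c k y := by
  simp only [frameMul, inner_add_right, mul_add, add_smul, Finset.sum_add_distrib]

theorem frameMul_smul (k : Fin 2 → ℝ) (r : ℂ) (x : Coin) :
    frameMul e c k (r • x) = r • frameMul e c k x := by
  simp only [frameMul, inner_smul_right, Finset.smul_sum, smul_smul]
  exact Finset.sum_congr rfl fun p _ => by rw [mul_left_comm]

theorem norm_frameMul_le {C : ℝ} (hC : ∀ p k, ‖c p k‖ ≤ C) (k : Fin 2 → ℝ) (x : Coin) :
    ‖frameMul e c k x‖ ≤ C * ‖x‖ := by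
  have hC0 : 0 ≤ C := (norm_nonneg _).trans (hC 0 0)
  refine (sq_le_sq₀ (norm_nonneg _) (by positivity)).1 ?_
  rw [mul_pow, ← (e k).sum_sq_norm_inner_right, ← (e k).sum_sq_norm_inner_right x, Finset.mul_sum]
  refine Finset.sum_le_sum fun p _ => ?_
  rw [inner_frameMul_right, norm_mul, mul_pow]
  have := hC p k
  gcongr

/-- Measurability is the only issue, as the frame may be non-measurable: almost everywhere the
vector is a combination of spectral projections. -/
theorem memLp_frameMul (ha : 0 < W.a) (hb : 0 < W.b) (hab : W.a + W.b = 1)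
    (he : IsEigenframe W e) (hc : ∀ p, Measurable (c p)) {C : ℝ} (hC : ∀ p k, ‖c p k‖ ≤ C)
    (Ψ : StateSpace) : MemLp (fun k => frameMul e c k (fourier Ψ k)) 2 (volume.restrict torus) := by
  refine (memLp_fourier Ψ).of_le_mul (c := C) ?_
    (Eventually.of_forall fun k => norm_frameMul_le hC k _)
  have h1 : AEStronglyMeasurable (fun k => ∑ p, c p k • eigenProj W p k (fourier Ψ k))
      (volume.restrict torus) :=
    Finset.aestronglyMeasurable_fun_sum _ fun p _ => (hc p).aestronglyMeasurable.smul
      (aestronglyMeasurable_eigenProj (memLp_fourier Ψ).aestronglyMeasurable p)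
  refine h1.congr ?_
  filter_upwards [ae_restrict_of_ae (ae_tau_sq_lt_one ha hb hab)] with k hk
  simp only [eigenProj_eq he _ hk, frameMul, smul_smul]

/-- A preimage is chosen separately for each Ψ; injectivity of the Fourier transform makes the
choice linear. -/
theorem exists_isFrameMultiplier (ha : 0 < W.a) (hb : 0 < W.b) (hab : W.a + W.b = 1)
    (he : IsEigenframe W e) (hc : ∀ p, Measurable (c p)) {C : ℝ} (hC : ∀ p k, ‖c p k‖ ≤ C) :
    ∃ T, IsFrameMultiplier e c T := by
  choose f hf using fun Ψ => exists_fourier_eq (memLp_frameMul ha hb hab he hc hC Ψ)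
  have hC0 : 0 ≤ C := (norm_nonneg _).trans (hC 0 0)
  let L : StateSpace →ₗ[ℂ] StateSpace :=
    { toFun := f
      map_add' := fun Φ Ψ => fourier_injective (by
        filter_upwards [hf (Φ + Ψ), hf Φ, hf Ψ, fourier_add Φ Ψ, fourier_add (f Φ) (f Ψ)]
          with k h1 h2 h3 h4 h5
        rw [h1, h4, h5, h2, h3, frameMul_add])
      map_smul' := fun r Ψ => fourier_injective (by
        filter_upwards [hf (r • Ψ), hf Ψ, fourier_smul r Ψ, fourier_smul r (f Ψ)]
          with k h1 h2 h3 h4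
        rw [h1, h3, RingHom.id_apply, h4, h2, frameMul_smul]) }
  refine ⟨L.mkContinuous C fun Ψ => ?_, hf⟩
  refine (sq_le_sq₀ (norm_nonneg _) (mul_nonneg hC0 (norm_nonneg Ψ))).1 ?_
  rw [mul_pow, norm_sq_eq_integral, norm_sq_eq_integral Ψ, mul_left_comm,
    ← integral_const_mul (C ^ 2)]
  have hpi : (0 : ℝ) ≤ ((2 * Real.pi) ^ 2)⁻¹ := by positivity
  refine mul_le_mul_of_nonneg_left ?_ hpi
  refine integral_mono_ae ((memLp_fourier _).integrable_norm_pow (by norm_num))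
    (((memLp_fourier _).integrable_norm_pow (by norm_num)).const_mul _) ?_
  filter_upwards [hf Ψ] with k hk
  rw [← mul_pow]
  have h1 : ‖fourier (L Ψ) k‖ ≤ C * ‖fourier Ψ k‖ := by
    rw [show fourier (L Ψ) k = _ from hk]
    exact norm_frameMul_le hC k _
  exact pow_le_pow_left₀ (norm_nonneg _) h1 2

theorem IsFrameMultiplier.unique (hT : IsFrameMultiplier e c T) (hS : IsFrameMultiplier e c S) :
    T = S := by
  ext1 Ψ
  refine fourier_injective ?_
  filter_upwards [hT Ψ, hS Ψ] with k h1 h2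
  rw [h1, h2]

theorem IsFrameMultiplier.mul (hT : IsFrameMultiplier e c T) (hS : IsFrameMultiplier e d S) :
    IsFrameMultiplier e (fun p k => c p k * d p k) (T * S) := by
  intro Ψ
  filter_upwards [hT (S Ψ), hS Ψ] with k h1 h2
  rw [mul_apply_eq_comp, h1, h2, frameMul_frameMul]

theorem IsFrameMultiplier.add (hT : IsFrameMultiplier e c T) (hS : IsFrameMultiplier e d S) :
    IsFrameMultiplier e (fun p k => c p k + d p k) (T + S) := by
  intro Ψ
  filter_upwards [hT Ψ, hS Ψ, fourier_add (T Ψ) (S Ψ)] with k h1 h2 h3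
  rw [add_apply, h3, h1, h2]
  simp only [frameMul, add_mul, add_smul, Finset.sum_add_distrib]

theorem isFrameMultiplier_one : IsFrameMultiplier e (fun _ _ => 1) 1 := fun Ψ =>
  Eventually.of_forall fun k => by
    simp only [frameMul, one_mul]
    exact ((e k).sum_repr' _).symm

theorem isFrameMultiplier_zero : IsFrameMultiplier e (fun _ _ => 0) 0 := fun Ψ => by
  filter_upwards [fourier_smul 0 Ψ] with k hk
  rw [zero_smul, zero_smul] at hk
  simp [frameMul, hk]

theorem inner_frameMul (k : Fin 2 → ℝ) (x y : Coin) :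
    inner ℂ x (frameMul e c k y) = ∑ p, c p k * (inner ℂ x (e k p) * inner ℂ (e k p) y) := by
  rw [frameMul, inner_sum]
  refine Finset.sum_congr rfl fun p _ => ?_
  rw [inner_smul_right]
  ring

theorem IsFrameMultiplier.isSelfAdjoint (hT : IsFrameMultiplier e c T)
    (hc : ∀ p k, (starRingEnd ℂ) (c p k) = c p k) : IsSelfAdjoint T := by
  rw [ContinuousLinearMap.isSelfAdjoint_iff_isSymmetric]
  intro Φ Ψ
  change inner ℂ (T Φ) Ψ = inner ℂ Φ (T Ψ)
  rw [inner_eq_integral, inner_eq_integral]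
  congr 1
  refine integral_congr_ae ?_
  filter_upwards [hT Φ, hT Ψ] with k h1 h2
  rw [h1, h2, inner_frameMul, ← inner_conj_symm, inner_frameMul, map_sum]
  refine Finset.sum_congr rfl fun p _ => ?_
  rw [map_mul, map_mul, inner_conj_symm, inner_conj_symm, hc, mul_comm (inner ℂ (e k p) _)]

theorem inner_frameMul_self (Ψ : StateSpace) (k : Fin 2 → ℝ) :
    inner ℂ (fourier Ψ k) (frameMul e c k (fourier Ψ k)) =
      ∑ p, c p k * (weightP Ψ e p k : ℂ) := by
  rw [inner_frameMul]
  refine Finset.sum_congr rfl fun p _ => ?_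
  rw [← inner_conj_symm (e k p), Complex.mul_conj, Complex.normSq_eq_norm_sq, weightP]

/-! ### The spectral measure of a state -/

/-- The spectral measure of the velocity operators in the state `Ψ`. -/
def stateMeasure (W : Params) (e : (Fin 2 → ℝ) → OrthonormalBasis (Fin 2) ℂ Coin)
    (Ψ : StateSpace) : Measure (Fin 2 → ℝ) :=
  ∑ p, Measure.map (vel W p) ((volume.restrict torus).withDensity fun k =>
    ENNReal.ofReal (((2 * Real.pi) ^ 2)⁻¹ * weightP Ψ e p k))

theorem weightP_nonneg (Ψ : StateSpace) (p : Fin 2) (k : Fin 2 → ℝ) : 0 ≤ weightP Ψ e p k := by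
  rw [weightP]
  positivity

theorem isFiniteMeasure_withDensity_weightP (ha : 0 < W.a) (hb : 0 < W.b) (hab : W.a + W.b = 1)
    (he : IsEigenframe W e) (Ψ : StateSpace) (p : Fin 2) :
    IsFiniteMeasure ((volume.restrict torus).withDensity fun k =>
      ENNReal.ofReal (((2 * Real.pi) ^ 2)⁻¹ * weightP Ψ e p k)) :=
  isFiniteMeasure_withDensity_ofReal
    ((integrableOn_weightP ha hb hab he Ψ p).const_mul _).hasFiniteIntegral

theorem isFiniteMeasure_stateMeasure (ha : 0 < W.a) (hb : 0 < W.b) (hab : W.a + W.b = 1)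
    (he : IsEigenframe W e) (Ψ : StateSpace) : IsFiniteMeasure (stateMeasure W e Ψ) := by
  have := isFiniteMeasure_withDensity_weightP ha hb hab he Ψ
  unfold stateMeasure
  infer_instance

theorem integral_stateMeasure (ha : 0 < W.a) (hb : 0 < W.b) (hab : W.a + W.b = 1)
    (he : IsEigenframe W e) (Ψ : StateSpace) {h : (Fin 2 → ℝ) → ℝ} (hm : Measurable h) {C : ℝ}
    (hC : ∀ p k, |h (vel W p k)| ≤ C) :
    Integrable h (stateMeasure W e Ψ) ∧ ∫ v, h v ∂(stateMeasure W e Ψ) =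
      ((2 * Real.pi) ^ 2)⁻¹ * ∫ k in torus, ∑ p, h (vel W p k) * weightP Ψ e p k := by
  have hfin := isFiniteMeasure_withDensity_weightP ha hb hab he Ψ
  have hv := measurable_vel ha hb hab
  have h1 : ∀ p, Integrable h (Measure.map (vel W p) ((volume.restrict torus).withDensity fun k =>
      ENNReal.ofReal (((2 * Real.pi) ^ 2)⁻¹ * weightP Ψ e p k))) := fun p => by
    rw [integrable_map_measure hm.aestronglyMeasurable (hv p).aemeasurable]
    have := hfin p
    exact Integrable.of_bound (hm.comp (hv p)).aestronglyMeasurable C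
      (Eventually.of_forall fun k => hC p k)
  have h2 : ∀ p, IntegrableOn (fun k => h (vel W p k) * weightP Ψ e p k) torus := fun p =>
    (integrableOn_weightP ha hb hab he Ψ p).bdd_mul (c := C)
      (hm.comp (hv p)).aestronglyMeasurable (Eventually.of_forall fun k => hC p k)
  refine ⟨integrable_finsetSum_measure.2 fun p _ => h1 p, ?_⟩
  rw [stateMeasure, integral_finsetSum_measure fun p _ => h1 p,
    integral_finsetSum _ fun p _ => h2 p, Finset.mul_sum]
  refine Finset.sum_congr rfl fun p _ => ?_
  rw [integral_map (hv p).aemeasurable hm.aestronglyMeasurable,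
    integral_withDensity_eq_integral_toReal_smul₀
      ((integrableOn_weightP ha hb hab he Ψ p).const_mul _).aemeasurable.ennreal_ofReal
      (Eventually.of_forall fun k => ENNReal.ofReal_lt_top), ← integral_const_mul]
  refine integral_congr_ae (Eventually.of_forall fun k => ?_)
  simp only [smul_eq_mul]
  rw [ENNReal.toReal_ofReal (mul_nonneg (by positivity) (weightP_nonneg Ψ p k))]
  ring

/-- The multiplier of the spectral projection of a set. -/
def setMul (W : Params) (s : Set (Fin 2 → ℝ)) (p : Fin 2) (k : Fin 2 → ℝ) : ℂ :=
  s.indicator (fun _ => 1) (vel W p k)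

theorem measurable_setMul (ha : 0 < W.a) (hb : 0 < W.b) (hab : W.a + W.b = 1)
    {s : Set (Fin 2 → ℝ)} (hs : MeasurableSet s) (p : Fin 2) : Measurable (setMul W s p) :=
  (measurable_const.indicator hs).comp (measurable_vel ha hb hab p)

theorem norm_setMul_le (s : Set (Fin 2 → ℝ)) (p : Fin 2) (k : Fin 2 → ℝ) :
    ‖setMul W s p k‖ ≤ 1 := by
  classical
  rw [setMul, Set.indicator_apply]
  split_ifs <;> simp

theorem conj_setMul (s : Set (Fin 2 → ℝ)) (p : Fin 2) (k : Fin 2 → ℝ) :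
    (starRingEnd ℂ) (setMul W s p k) = setMul W s p k := by
  classical
  rw [setMul, Set.indicator_apply]
  split_ifs <;> simp

theorem setMul_inter (s t : Set (Fin 2 → ℝ)) :
    setMul W (s ∩ t) = fun p k => setMul W s p k * setMul W t p k := by
  funext p k
  classical
  simp only [setMul, Set.indicator_apply, Set.mem_inter_iff]
  split_ifs <;> simp_all

theorem setMul_union {s t : Set (Fin 2 → ℝ)} (h : Disjoint s t) :
    setMul W (s ∪ t) = fun p k => setMul W s p k + setMul W t p k := by
  funext p k
  simp only [setMul]
  rw [Set.indicator_union_of_disjoint h]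

theorem IsFrameMultiplier.norm_sq_eq (ha : 0 < W.a) (hb : 0 < W.b) (hab : W.a + W.b = 1)
    (he : IsEigenframe W e) {s : Set (Fin 2 → ℝ)} (hs : MeasurableSet s)
    (hT : IsFrameMultiplier e (setMul W s) T) (Ψ : StateSpace) :
    ‖T Ψ‖ ^ 2 = (stateMeasure W e Ψ).real s := by
  classical
  have h1 := (integral_stateMeasure ha hb hab he Ψ (h := s.indicator fun _ => 1)
    (measurable_const.indicator hs) (C := 1) (fun p k => by
      rw [Set.indicator_apply]
      split_ifs <;> simp)).2
  rw [integral_indicator_const _ hs, smul_eq_mul, mul_one] at h1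
  rw [h1, norm_sq_eq_integral]
  congr 1
  refine integral_congr_ae ?_
  filter_upwards [hT Ψ] with k hk
  rw [hk, ← (e k).sum_sq_norm_inner_right]
  refine Finset.sum_congr rfl fun p _ => ?_
  rw [inner_frameMul_right, norm_mul, mul_pow, weightP, norm_inner_symm, setMul,
    Set.indicator_apply, Set.indicator_apply]
  split_ifs <;> simp

/-- The squared norm of the remainder of a finite partial sum is the state measure of the sets not
yet summed, so strong convergence follows from countable additivity of a finite measure. -/
theorem hasSum_frameMultiplier (ha : 0 < W.a) (hb : 0 < W.b) (hab : W.a + W.b = 1)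
    (he : IsEigenframe W e) {E : Set (Fin 2 → ℝ) → StateSpace →L[ℂ] StateSpace}
    (hE : ∀ s, MeasurableSet s → IsFrameMultiplier e (setMul W s) (E s))
    {s : ℕ → Set (Fin 2 → ℝ)} (hs : ∀ n, MeasurableSet (s n))
    (hd : ∀ m n, m ≠ n → Disjoint (s m) (s n)) (Ψ : StateSpace) :
    HasSum (fun n => E (s n) Ψ) (E (⋃ n, s n) Ψ) := by
  have := isFiniteMeasure_stateMeasure ha hb hab he Ψ
  have hadd : ∀ {A B : Set (Fin 2 → ℝ)}, MeasurableSet A → MeasurableSet B → Disjoint A B →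
      E (A ∪ B) = E A + E B := fun {A B} hA hB h =>
    (hE _ (hA.union hB)).unique (by rw [setMul_union h]; exact (hE A hA).add (hE B hB))
  have hmeas : ∀ F : Finset ℕ, MeasurableSet (⋃ n ∈ F, s n) := fun F =>
    F.measurableSet_biUnion fun n _ => hs n
  have hfin : ∀ F : Finset ℕ, E (⋃ n ∈ F, s n) = ∑ n ∈ F, E (s n) := fun F => by
    induction F using Finset.induction_on with
    | empty =>
      simp only [Finset.notMem_empty, Set.iUnion_of_empty, Set.iUnion_empty, Finset.sum_empty]
      refine (hE ∅ MeasurableSet.empty).unique ?_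
      have : setMul W ∅ = fun _ _ => 0 := by
        funext p k
        simp [setMul]
      rw [this]
      exact isFrameMultiplier_zero
    | insert n F hn ih =>
      rw [Finset.set_biUnion_insert, hadd (hs n) (hmeas F), ih, Finset.sum_insert hn]
      rw [Set.disjoint_iUnion₂_right]
      intro m hm
      exact hd n m fun h => hn (h ▸ hm)
  have hU : MeasurableSet (⋃ n, s n) := MeasurableSet.iUnion hs
  have hsub : ∀ F : Finset ℕ, (⋃ n ∈ F, s n) ⊆ ⋃ n, s n := fun F =>
    Set.iUnion₂_subset fun n _ => Set.subset_iUnion s n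
  have hnorm : ∀ F : Finset ℕ, ‖(∑ n ∈ F, E (s n) Ψ) - E (⋃ n, s n) Ψ‖ ^ 2 =
      (stateMeasure W e Ψ).real (⋃ n, s n) -
        ∑ n ∈ F, (stateMeasure W e Ψ).real (s n) := fun F => by
    have h1 : E (⋃ n, s n) = E (⋃ n ∈ F, s n) + E ((⋃ n, s n) \ ⋃ n ∈ F, s n) := by
      rw [← hadd (hmeas F) (hU.diff (hmeas F)) Set.disjoint_sdiff_right,
        Set.union_sdiff_cancel (hsub F)]
    rw [h1, hfin, add_apply, sum_apply, norm_sub_rev,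
      add_sub_cancel_left, (hE _ (hU.diff (hmeas F))).norm_sq_eq ha hb hab he (hU.diff (hmeas F)),
      measureReal_sdiff (hsub F) (hmeas F), measureReal_biUnion_finset
        (fun m _ n _ h => hd m n h) fun n _ => hs n]
  have hsum : HasSum (fun n => (stateMeasure W e Ψ).real (s n))
      ((stateMeasure W e Ψ).real (⋃ n, s n)) := by
    rw [measureReal_def, measure_iUnion hd hs]
    rw [ENNReal.tsum_toReal_eq fun n => measure_ne_top _ _]
    refine ENNReal.hasSum_toReal ?_
    rw [← measure_iUnion hd hs]
    exact measure_ne_top _ _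
  rw [HasSum, tendsto_iff_norm_sub_tendsto_zero]
  have h2 := (hsum.const_sub ((stateMeasure W e Ψ).real (⋃ n, s n))).sqrt
  rw [sub_self, Real.sqrt_zero] at h2
  refine h2.congr fun F => ?_
  rw [← hnorm, Real.sqrt_sq (norm_nonneg _)]

theorem abs_vel_le_one (ha : 0 < W.a) (hb : 0 < W.b) (hab : W.a + W.b = 1) (p : Fin 2)
    (k : Fin 2 → ℝ) (q : Fin 2) : |vel W p k q| ≤ 1 := by
  have h1 := (mem_ellipse_iff _).1 (vel_mem_ellipse ha hb hab p k)
  have h2 := ellipseForm_le ha hb hab (vel W p k) q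
  rw [← sq_le_one_iff_abs_le_one]
  linarith

/-- An operator is determined by its multiplier, so the projection axioms reduce to identities
between indicator functions; the scalar spectral measures are the `stateMeasure`s. -/
theorem isJointSpectralMeasure_of_isFrameMultiplier (ha : 0 < W.a) (hb : 0 < W.b)
    (hab : W.a + W.b = 1) (he : IsEigenframe W e) {V : Fin 2 → StateSpace →L[ℂ] StateSpace}
    (hV : ∀ q, IsFrameMultiplier e (fun p k => (vel W p k q : ℂ)) (V q))
    {E : Set (Fin 2 → ℝ) → StateSpace →L[ℂ] StateSpace}
    (hE : ∀ s, MeasurableSet s → IsFrameMultiplier e (setMul W s) (E s)) :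
    IsJointSpectralMeasure V E where
  isProj s hs := by
    refine ⟨?_, (hE s hs).isSelfAdjoint (conj_setMul s)⟩
    refine ((hE s hs).mul (hE s hs)).unique ?_
    rw [← setMul_inter, Set.inter_self]
    exact hE s hs
  univ := by
    refine (hE _ MeasurableSet.univ).unique ?_
    have : setMul W Set.univ = fun _ _ => 1 := by
      funext p k
      simp [setMul]
    rw [this]
    exact isFrameMultiplier_one
  inter s t hs ht := by
    refine (hE _ (hs.inter ht)).unique ?_
    rw [setMul_inter]
    exact (hE s hs).mul (hE t ht)
  iUnion s hs hd Ψ := hasSum_frameMultiplier ha hb hab he hE hs hd Ψ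
  spectral Ψ := by
    have := isFiniteMeasure_stateMeasure ha hb hab he Ψ
    refine ⟨stateMeasure W e Ψ, fun s hs => ?_, fun q => ?_⟩
    · rw [(hE s hs).norm_sq_eq ha hb hab he hs, ofReal_measureReal]
    · obtain ⟨h1, h2⟩ := integral_stateMeasure ha hb hab he Ψ (measurable_pi_apply q)
        fun p k => abs_vel_le_one ha hb hab p k q
      refine ⟨h1, ?_⟩
      rw [h2, inner_eq_integral]
      push_cast
      rw [← integral_complex_ofReal]
      congr 1
      refine integral_congr_ae ?_
      filter_upwards [hV q Ψ] with k hk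
      rw [hk, inner_frameMul_self]
      push_cast
      rfl

/-! ### The support of the joint spectral measure -/

theorem exists_mem_ellipseForm_pos {v : Fin 2 → ℝ} (hv : v ∈ ellipse W)
    {N : Set (Fin 2 → ℝ)} (hN : N ∈ 𝓝 v) :
    ∃ v' ∈ N, 0 < ellipseForm W v' := by
  have h1 : Tendsto (fun r : ℝ => r • v) (𝓝[<] 1) (𝓝 v) := by
    have : Tendsto (fun r : ℝ => r • v) (𝓝 1) (𝓝 ((1 : ℝ) • v)) :=
      (continuous_id.smul continuous_const).tendsto 1
    rw [one_smul] at this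
    exact this.mono_left nhdsWithin_le_nhds
  have h2 : ∀ᶠ r : ℝ in 𝓝[<] 1, r ∈ Set.Ioo (0 : ℝ) 1 := Ioo_mem_nhdsLT zero_lt_one
  obtain ⟨r, hr1, hr2⟩ := ((h1.eventually hN).and h2).exists
  refine ⟨r • v, hr1, ?_⟩
  rw [ellipse, Set.mem_ofPred_eq] at hv
  have h3 : ellipseForm W (r • v) = 1 - r ^ 2 *
      ((v 0 + v 1) ^ 2 / (4 * W.a) + (v 0 - v 1) ^ 2 / (4 * W.b)) := by
    simp only [ellipseForm, Pi.smul_apply, smul_eq_mul]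
    ring
  rw [h3]
  have h4 : r ^ 2 < 1 := by nlinarith [hr2.1, hr2.2]
  nlinarith [sq_nonneg r]

theorem torus_subset_closure :
    torus ⊆ closure (Set.univ.pi fun _ : Fin 2 => Set.Ioo (-Real.pi) Real.pi) := by
  have := Real.pi_pos
  rw [closure_pi_set]
  refine Set.pi_mono fun q _ => ?_
  rw [closure_Ioo (by linarith)]
  exact Set.Ico_subset_Icc_self

/-- An open set meeting the ellipse contains an interior velocity with a nondegenerate preimage,
near which the velocities stay in the set. That gives a set of wave numbers of positive measure; the
branch p = 1 (index 0) alone suffices. -/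
theorem isFrameMultiplier_ne_zero (ha : 0 < W.a) (hb : 0 < W.b) (hab : W.a + W.b = 1)
    {N : Set (Fin 2 → ℝ)} (hN : IsOpen N) {v : Fin 2 → ℝ} (hv : v ∈ ellipse W) (hvN : v ∈ N)
    (hT : IsFrameMultiplier e (setMul W N) T) : T ≠ 0 := by
  rintro rfl
  obtain ⟨v', hv'N, hv'⟩ := exists_mem_ellipseForm_pos hv (hN.mem_nhds hvN)
  obtain ⟨k₀, hk₀, hc₀⟩ := exists_vel_eq ha hb hab 0 hv'
  obtain ⟨n, hn⟩ := exists_toTorus_eq k₀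
  have hvel : vel W 0 (toTorus k₀) = v' := by rw [hn, vel_translate ha hb hab, hk₀]
  have hτ : tau W (toTorus k₀) ^ 2 < 1 := by
    rw [hn, tau_translate]
    exact tau_sq_lt_one ha hb hab hc₀
  have hcont := (hasFDerivAt_vel ha hb hab 0 hτ).continuousAt
  have hO : vel W 0 ⁻¹' N ∈ 𝓝 (toTorus k₀) :=
    hcont.preimage_mem_nhds (hN.mem_nhds (by rwa [hvel]))
  obtain ⟨O, hON, hOo, hkO⟩ := mem_nhds_iff.1 hO
  -- The preimage may lie on the edge of the half-open torus, so `O` is cut down to the open square,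
  -- whose closure contains the torus.
  have hne : (O ∩ Set.univ.pi fun _ : Fin 2 => Set.Ioo (-Real.pi) Real.pi).Nonempty :=
    mem_closure_iff.1 (torus_subset_closure (toTorus_mem k₀)) O hOo hkO
  have hpos : 0 < volume (O ∩ Set.univ.pi fun _ : Fin 2 => Set.Ioo (-Real.pi) Real.pi) :=
    (hOo.inter (isOpen_set_pi Set.finite_univ fun _ _ => isOpen_Ioo)).measure_pos _ hne
  -- Testing a vanishing operator on states with constant transforms equal to the two basis vectors
  -- would force `e k 0` to be 0 wherever the multiplier is 1.
  have hconst : ∀ i : Fin 2, ∃ Ψ : StateSpace, ∀ᵐ k ∂(volume.restrict torus),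
      fourier Ψ k = EuclideanSpace.single i (1 : ℂ) := fun i => by
    have : IsFiniteMeasure ((volume : Measure (Fin 2 → ℝ)).restrict torus) := by
      refine ⟨?_⟩
      rw [Measure.restrict_apply_univ, torus, Real.volume_pi_Ico]
      exact ENNReal.prod_lt_top fun _ _ => ENNReal.ofReal_lt_top
    exact exists_fourier_eq (memLp_const _)
  have hae : ∀ᵐ k ∂(volume.restrict torus), vel W 0 k ∉ N := by
    choose Ψ hΨ using hconst
    have h0 : ∀ i, ∀ᵐ k ∂(volume.restrict torus),
        setMul W N 0 k * inner ℂ (e k 0) (EuclideanSpace.single i (1 : ℂ)) = 0 := fun i => by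
      filter_upwards [hT (Ψ i), hΨ i, isFrameMultiplier_zero (e := e) (Ψ i)] with k h1 h2 h3
      rw [h3] at h1
      have := congrArg (fun x => inner ℂ (e k 0) x) h1
      simp only [inner_frameMul_right, h2, zero_mul] at this
      exact this.symm
    filter_upwards [ae_all_iff.2 h0] with k hk hkN
    have h1 : ∀ i, e k 0 i = 0 := fun i => by
      have := hk i
      rw [setMul, Set.indicator_of_mem hkN, one_mul, EuclideanSpace.inner_single_right] at this
      simpa using this
    have h2 : e k 0 = 0 := by
      ext i
      exact h1 i
    exact (e k).orthonormal.ne_zero 0 h2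
  rw [ae_restrict_iff' measurableSet_torus] at hae
  refine hpos.ne' (measure_mono_null (fun k hk => ?_) (ae_iff.1 hae))
  simp only [Set.mem_ofPred_eq, Classical.not_imp, not_not]
  exact ⟨fun q _ => Set.Ioo_subset_Ico_self (hk.2 q (Set.mem_univ q)), hON hk.1⟩

theorem spectralSupport_eq_ellipse (ha : 0 < W.a) (hb : 0 < W.b) (hab : W.a + W.b = 1)
    {E : Set (Fin 2 → ℝ) → StateSpace →L[ℂ] StateSpace}
    (hE : ∀ s, MeasurableSet s → IsFrameMultiplier e (setMul W s) (E s)) :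
    spectralSupport E = ellipse W := by
  ext v
  constructor
  · intro hv
    by_contra hv'
    have ho : IsOpen (ellipse W)ᶜ := isClosed_ellipse.isOpen_compl
    refine hv _ ho hv' ((hE _ ho.measurableSet).unique ?_)
    have : setMul W (ellipse W)ᶜ = fun _ _ => 0 := by
      funext p k
      rw [setMul, Set.indicator_of_notMem]
      exact fun h => h (vel_mem_ellipse ha hb hab p k)
    rw [this]
    exact isFrameMultiplier_zero
  · intro hv N hN hvN
    exact isFrameMultiplier_ne_zero ha hb hab hN hv hvN (hE N hN.measurableSet)

theorem exists_spectralMeasure (ha : 0 < W.a) (hb : 0 < W.b) (hab : W.a + W.b = 1)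
    (he : IsEigenframe W e) :
    ∃ (V : Fin 2 → StateSpace →L[ℂ] StateSpace)
      (E : Set (Fin 2 → ℝ) → StateSpace →L[ℂ] StateSpace),
      IsVelocityPair W e V ∧ IsJointSpectralMeasure V E ∧ spectralSupport E = ellipse W := by
  classical
  choose V hV using fun q => exists_isFrameMultiplier ha hb hab he
    (c := fun p k => (vel W p k q : ℂ)) (C := 1)
    (fun p => Complex.measurable_ofReal.comp
      ((measurable_pi_apply q).comp (measurable_vel ha hb hab p)))
    (fun p k => by
      rw [Complex.norm_real]
      exact abs_vel_le_one ha hb hab p k q)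
  choose E hE using fun s : {s : Set (Fin 2 → ℝ) // MeasurableSet s} =>
    exists_isFrameMultiplier ha hb hab he (fun p => measurable_setMul ha hb hab s.2 p)
      (norm_setMul_le s.1)
  -- The value 0 on non-measurable sets is a filler: the axioms concern measurable sets and the
  -- support only tests open ones.
  have hE' : ∀ s, ∀ hs : MeasurableSet s, IsFrameMultiplier e (setMul W s)
      ((fun s => if h : MeasurableSet s then E ⟨s, h⟩ else 0) s) := fun s hs => by
    simp only [dif_pos hs]
    exact hE ⟨s, hs⟩
  exact ⟨V, _, hV, isJointSpectralMeasure_of_isFrameMultiplier ha hb hab he hV hE',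
    spectralSupport_eq_ellipse ha hb hab hE'⟩

end Spectral

end QuantumWalk

end

theorem theorem1 (W : QuantumWalk.Params) (ha : 0 < W.a) (hb : 0 < W.b) (hab : W.a + W.b = 1)
    (Ψ₀ : QuantumWalk.StateSpace) (hΨ₀ : ‖Ψ₀‖ = 1)
    (e : (Fin 2 → ℝ) → OrthonormalBasis (Fin 2) ℂ QuantumWalk.Coin)
    (he : QuantumWalk.IsEigenframe W e) :
    -- the positions are honest random variables
    (∀ t, IsProbabilityMeasure (QuantumWalk.positionLaw W Ψ₀ t)) ∧
    -- the weak limit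
    IntegrableOn (QuantumWalk.limitDensity W Ψ₀ e) (QuantumWalk.ellipse W) ∧
    (∀ ξ : Fin 2 → ℝ,
      Tendsto (fun t : ℕ => QuantumWalk.positionCharFun W Ψ₀ t ξ) atTop
        (𝓝 (∫ v in QuantumWalk.ellipse W, (1 / (2 * (Real.pi : ℂ)) ^ 2) *
          (Complex.exp (Complex.I * ((∑ q, ξ q * v q : ℝ) : ℂ)) *
            (QuantumWalk.limitDensity W Ψ₀ e v : ℂ))))) ∧
    -- the explicit form of `w` inside the ellipse, off the two axes
    (∀ v : Fin 2 → ℝ, 0 < QuantumWalk.ellipseForm W v → v 0 + v 1 ≠ 0 → v 0 - v 1 ≠ 0 →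
      QuantumWalk.weightW W Ψ₀ e v =
        ∑ p : Fin 2, ∑ j : Fin 2,
          (QuantumWalk.weightP Ψ₀ e p (QuantumWalk.branchK W p 1 j v) +
            QuantumWalk.weightP Ψ₀ e p (QuantumWalk.branchK W p (-1) j v))) ∧
    -- the ellipse is the support of the joint spectral measure of the velocity operators
    (∃ (V : Fin 2 → QuantumWalk.StateSpace →L[ℂ] QuantumWalk.StateSpace)
      (E : Set (Fin 2 → ℝ) → QuantumWalk.StateSpace →L[ℂ] QuantumWalk.StateSpace),
      QuantumWalk.IsVelocityPair W e V ∧ QuantumWalk.IsJointSpectralMeasure V E ∧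
        QuantumWalk.spectralSupport E = QuantumWalk.ellipse W) := by
  exact ⟨fun t => QuantumWalk.isProbabilityMeasure_positionLaw ha hb hab he hΨ₀ t,
    QuantumWalk.integrableOn_limitDensity ha hb hab he Ψ₀,
    fun ξ => by
      rw [QuantumWalk.setIntegral_limitDensity ha hb hab he Ψ₀ ξ]
      exact QuantumWalk.tendsto_positionCharFun ha hb hab he hΨ₀ ξ,
    fun v hv h₁ h₂ => QuantumWalk.weightW_eq_sum_branchK ha hb hab he Ψ₀ hv h₁ h₂,
    QuantumWalk.exists_spectralMeasure ha hb hab he⟩
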